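/- Let $I$ and $O$ be finite sets, $h:I\to O$ surjective, and $\Lambda=(\lambda_{ij})_{i,j\in I}$ a rate matrix, i.e. $\lambda_{ij}\ge 0$ for $i\ne j$ and $\sum_j\lambda_{ij}=0$ for every $i$. Let $\Delta$ be the set of probability vectors on $I$ (row vectors), $\Delta_a\subset\Delta$ the set of those supported in $h^{-1}(a)$ ($a\in O$), and $\Delta_e=\bigcup_{a\in O}\Delta_a$. For a row vector $\nu$ and column vector $f$ put $(f*\nu)(i)=f(i)\nu(i)$. Flow: for $x\in\Delta_a$, $t\mapsto\phi(t,x)$ is the unique solution on $[0,\infty)$ of $y'=1_{h^{-1}(a)}*(y\Lambda)-(y\Lambda 1_{h^{-1}(a)})\,y$, $y(0)=x$. Operator $H$: fix arbitrary $\nu_a\in\Delta_a$ ($a\in O$), and let $H_a[\nu]=(\nu 1_{h^{-1}(a)})^{-1}\,1_{h^{-1}(a)}*\nu$ if $\nu 1_{h^{-1}(a)}\neq 0$ and $H_a[\nu]=\nu_a$ otherwise. Let $\Omega$ be the space of càdlàg functions $\mathbb R_+\to I$ ($I$ discrete), $X_t(\omega)=\omega(t)$, with the $\sigma$-algebra generated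 by all $X_t$. Let $\mu\in\Delta$ and let $P_\mu$ be the probability on $\Omega$ under which $X$ is Markov with generator $\Lambda$ and initial distribution $\mu$, that is, $P_\mu(X_0=i)=\mu(i)$ and $E_\mu[f(X_{t+s})\mid\sigma(X_r:r\le t)]=(e^{s\Lambda}f)(X_t)$ a.s. for all $s,t\ge 0$ and $f:I\to\mathbb R$. Let $Y_t=h(X_t)$, let $T_0=0$ and let $T_1<T_2<\cdots$ be the jump times of $Y$ ($T_n=\infty$ if there are fewer than $n$ jumps), $S_n=T_n-T_{n-1}$ on $\{T_{n-1}<\infty\}$, and $$\Sigma_{n-1}=\sigma(Y_0,T_1,Y_{T_1},\dots,T_{n-1},Y_{T_{n-1}}),\qquad \Sigma^+_{n-1}=\sigma(Y_0,T_1,Y_{T_1},\dots,T_{n-1},Y_{T_{n-1}},T_n).$$ The filtering process $(\Pi_t^\mu)$ is given by $\Pi^\mu_0=H_{Y_0}[\mu]$, $\Pi^\mu_t=\phi(t-T_{n-1},\Pi^\mu_{T_{n-1}})$ for $T_{n-1}\le t<T_n$, and $\Pi^\mu_{T_n}=H_{Y_{T_n}}[\Pi^\mu_{T_n-}\Lambda]$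 with $\Pi^\mu_{T_n-}=\phi(T_n-T_{n-1},\Pi^\mu_{T_{n-1}})$, the left limit at $T_n$, if $T_n<\infty$. Then for all $n\ge 1$ and $t\ge 0$, $P_\mu$-a.s., $$P_\mu(S_n>t,\,T_{n-1}<\infty\mid\Sigma_{n-1})=\exp\left(\int_0^t\phi(s,\Pi^\mu_{T_{n-1}})\,\Lambda\, 1_{h^{-1}(Y_{T_{n-1}})}\,ds\right)1_{T_{n-1}<\infty}.$$ Moreover, suppose that $h$ is not constant, and let $q_a$ ($a\in O$) be arbitrary probabilities on $O$ with $q_a(a)=0$. For $\nu\in\Delta_a$ and $b\in O$ put $$q(\nu,b)=\frac{\nu\Lambda 1_{h^{-1}(b)}}{-\nu\Lambda 1_{h^{-1}(a)}}\,1_{b\ne a}\ \text{ if }\ \nu\Lambda 1_{h^{-1}(a)}\ne 0,\qquad q(\nu,b)=q_a(b)\ \text{ otherwise.}$$ Then for all $n\ge1$ and $b\in O$, $P_\mu$-a.s., $$P_\mu(Y_{T_n}=b,\,T_n<\infty\mid\Sigma^+_{n-1})=q(\Pi^\mu_{T_n-},b)\,1_{T_n<\infty}=q(\phi(S_n,\Pi^\mu_{T_{n-1}}),b)\,1_{T_n<\infty}.$$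 -/

import Mathlib

open MeasureTheory ProbabilityTheory Filter Topology Matrix
open scoped NNReal ENNReal

namespace MarkovFilter

section Basic

variable {I O : Type*} [Fintype I]

/-- `Λ` is a rate transition matrix (`Q`-matrix). -/
def IsRateMatrix (Λ : Matrix I I ℝ) : Prop :=
  (∀ i j, i ≠ j → 0 ≤ Λ i j) ∧ ∀ i, ∑ j, Λ i j = 0

/-- The face `Δ_a` of the simplex: probability vectors on `I` supported in `h⁻¹(a)`. -/
def face (h : I → O) (a : O) : Set (I → ℝ) :=
  {x | x ∈ stdSimplex ℝ I ∧ ∀ i, h i ≠ a → x i = 0}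

/-- The effective simplex `Δ_e = ⋃ a, Δ_a`. -/
def effSimplex (h : I → O) : Set (I → ℝ) := ⋃ a, face h a

/-- The column vector `1_{h⁻¹(a)}`. -/
noncomputable def classInd (h : I → O) (a : O) : I → ℝ := (h ⁻¹' {a}).indicator 1

/-- The number `ν Λ 1_{h⁻¹(a)}`. -/
noncomputable def rate (Λ : Matrix I I ℝ) (h : I → O) (ν : I → ℝ) (a : O) : ℝ :=
  (ν ᵥ* Λ) ⬝ᵥ classInd h a

/-- The vector field `F_a(y) = 1_{h⁻¹(a)} * (y Λ) - (y Λ 1_{h⁻¹(a)}) y`. -/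
noncomputable def field (Λ : Matrix I I ℝ) (h : I → O) (a : O) (y : I → ℝ) : I → ℝ :=
  classInd h a * (y ᵥ* Λ) - rate Λ h y a • y

/-- `y` solves `y' = F_a(y)` on `[0, ∞)` with `y(0) = x` (one-sided derivative at `0`). -/
def IsFlowLine (Λ : Matrix I I ℝ) (h : I → O) (a : O) (x : I → ℝ) (y : ℝ → I → ℝ) : Prop :=
  y 0 = x ∧ ∀ t, 0 ≤ t → HasDerivWithinAt y (field Λ h a (y t)) (Set.Ici 0) t

open Classical in
/-- The global flow `φ(t, x)`, for `t ≥ 0` and `x ∈ Δ_e`: for `x ∈ Δ_a`, the value at time `t` of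
the (unique) solution of `y' = F_a(y)`, `y(0) = x`. -/
noncomputable def flow (Λ : Matrix I I ℝ) (h : I → O) (t : ℝ) (x : I → ℝ) : I → ℝ :=
  if H : ∃ y : ℝ → I → ℝ, ∃ a, x ∈ face h a ∧ IsFlowLine Λ h a x y then H.choose t else 0

open Classical in
/-- The operator `H_a`, where `νd a` is the default value used when `h⁻¹(a)` has mass zero. -/
noncomputable def condOp (h : I → O) (νd : O → I → ℝ) (a : O) (ν : I → ℝ) : I → ℝ :=
  if ν ⬝ᵥ classInd h a ≠ 0 then (ν ⬝ᵥ classInd h a)⁻¹ • (classInd h a * ν) else νd a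

open Classical in
/-- The probability `q(ν, ·)` on `O`, for `ν ∈ Δ_e`: the letter `a` is the one with `ν ∈ Δ_a`, and
`qd a` is the default value used when `ν Λ 1_{h⁻¹(a)} = 0`. -/
noncomputable def postJumpLaw (Λ : Matrix I I ℝ) (h : I → O) (qd : O → O → ℝ)
    (ν : I → ℝ) (b : O) : ℝ :=
  if H : ∃ a, ν ∈ face h a then
    if rate Λ h ν H.choose ≠ 0 then
      if b ≠ H.choose then rate Λ h ν b / (-rate Λ h ν H.choose) else 0
    else qd H.choose b
  else 0

end Basic

section Paths

/-- The canonical space of cadlag functions `ℝ₊ → I`, the finite set `I` being discrete. -/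
def CadlagPath (I : Type*) : Type _ :=
  {ω : ℝ≥0 → I // (∀ t, ∀ᶠ s in 𝓝[>] t, ω s = ω t) ∧
    ∀ t, 0 < t → ∃ i, ∀ᶠ s in 𝓝[<] t, ω s = i}

variable {I O : Type*}

/-- The canonical process `X_t(ω) = ω(t)`. -/
def coord (t : ℝ≥0) (ω : CadlagPath I) : I := ω.1 t

/-- The σ-algebra generated by all `X_s`, `s ≥ 0`. -/
instance : MeasurableSpace (CadlagPath I) := ⨆ s : ℝ≥0, MeasurableSpace.comap (coord s) ⊤

/-- The σ-algebra generated by `X_s`, `s ∈ [0, t]`. -/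
abbrev natSigma (I : Type*) (t : ℝ≥0) : MeasurableSpace (CadlagPath I) :=
  ⨆ (s : ℝ≥0) (_ : s ≤ t), MeasurableSpace.comap (coord s) ⊤

/-- `P` is the law `P_μ` on path space: under `P` the canonical process is a Markov process with
generator `Λ` and initial distribution `μ`. -/
structure IsMarkovLaw [Fintype I] [DecidableEq I] (Λ : Matrix I I ℝ) (μ : I → ℝ)
    (P : Measure (CadlagPath I)) : Prop where
  isProbabilityMeasure : IsProbabilityMeasure P
  initial : ∀ i, P {ω | coord 0 ω = i} = ENNReal.ofReal (μ i)
  markov : ∀ (t s : ℝ≥0) (f : I → ℝ),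
    P[fun ω => f (coord (t + s) ω) | natSigma I t]
      =ᵐ[P] fun ω => (NormedSpace.exp ((s : ℝ) • Λ) *ᵥ f) (coord t ω)

/-- The observation process `Y_t = h(X_t)`. -/
def obs (h : I → O) (ω : CadlagPath I) (t : ℝ≥0) : O := h (coord t ω)

/-- `t > 0` is a jump time of `Y`, i.e. `Y_{t-} ≠ Y_t`. -/
def IsJump (h : I → O) (ω : CadlagPath I) (t : ℝ≥0) : Prop :=
  0 < t ∧ ¬ ∀ᶠ s in 𝓝[<] t, obs h ω s = obs h ω t

/-- The successive jump times `T_n` of `Y`, with `T_0 = 0` and `T_n = ∞` if there are fewer than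
`n` jumps. -/
noncomputable def jumpTime (h : I → O) : ℕ → CadlagPath I → ℝ≥0∞
  | 0, _ => 0
  | n + 1, ω => ⨅ (t : ℝ≥0) (_ : IsJump h ω t ∧ jumpTime h n ω < t), (t : ℝ≥0∞)

/-- The sojourn time `S_n = T_n - T_{n-1}` (`n ≥ 1`), meaningful on `{T_{n-1} < ∞}`. -/
noncomputable def sojourn (h : I → O) (n : ℕ) (ω : CadlagPath I) : ℝ≥0∞ :=
  jumpTime h n ω - jumpTime h (n - 1) ω

/-- The position `Y_{T_n}`, meaningful on `{T_n < ∞}`. -/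
noncomputable def obsAtJump (h : I → O) (n : ℕ) (ω : CadlagPath I) : O :=
  obs h ω (jumpTime h n ω).toNNReal

open Classical in
/-- `Y_{T_n}` as a partially defined random variable: undefined (`none`) where `T_n = ∞`. -/
noncomputable def obsAtJump? (h : I → O) (n : ℕ) (ω : CadlagPath I) : Option O :=
  if jumpTime h n ω < ⊤ then some (obsAtJump h n ω) else none

/-- `Σ_m = σ(Y_0, T_1, Y_{T_1}, …, T_m, Y_{T_m})`. -/
noncomputable abbrev pastSigma (h : I → O) (m : ℕ) : MeasurableSpace (CadlagPath I) :=
  ⨆ (k : ℕ) (_ : k ≤ m),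
    (MeasurableSpace.comap (jumpTime h k) inferInstance ⊔
      MeasurableSpace.comap (obsAtJump? h k) ⊤)

/-- `Σ_m⁺ = σ(Y_0, T_1, Y_{T_1}, …, T_m, Y_{T_m}, T_{m+1})`. -/
noncomputable abbrev pastSigmaPlus (h : I → O) (m : ℕ) : MeasurableSpace (CadlagPath I) :=
  pastSigma h m ⊔ MeasurableSpace.comap (jumpTime h (m + 1)) inferInstance

variable [Fintype I]

/-- The values of the filtering process at the jump times, with `Π_0 = H_{Y_0}[μ]` and
`Π_{T_{n+1}} = H_{Y_{T_{n+1}}}[φ(T_{n+1} - T_n, Π_{T_n}) Λ]`; meaningful on `{T_n < ∞}`. -/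
noncomputable def filterAtJump (Λ : Matrix I I ℝ) (h : I → O) (νd : O → I → ℝ) (μ : I → ℝ)
    (ω : CadlagPath I) : ℕ → I → ℝ
  | 0 => condOp h νd (obs h ω 0) μ
  | n + 1 => condOp h νd (obsAtJump h (n + 1) ω)
      (flow Λ h (sojourn h (n + 1) ω).toReal (filterAtJump Λ h νd μ ω n) ᵥ* Λ)

/-- The number of jumps of `Y` in `(0, t]`: the `n` with `T_n ≤ t < T_{n+1}`. -/
noncomputable def jumpCount (h : I → O) (ω : CadlagPath I) (t : ℝ≥0) : ℕ :=
  sInf {n | (t : ℝ≥0∞) < jumpTime h (n + 1) ω}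

/-- The filtering process: `Π_t = φ(t - T_n, Π_{T_n})` for `T_n ≤ t < T_{n+1}`. -/
noncomputable def filterProc (Λ : Matrix I I ℝ) (h : I → O) (νd : O → I → ℝ) (μ : I → ℝ)
    (ω : CadlagPath I) (t : ℝ≥0) : I → ℝ :=
  flow Λ h ((t : ℝ) - (jumpTime h (jumpCount h ω t) ω).toReal)
    (filterAtJump Λ h νd μ ω (jumpCount h ω t))

end Paths

end MarkovFilter

open MarkovFilter

/-!
The nonlinear filtering equation is the normalisation of a linear one. For a class `h⁻¹(a)` let
`A_a = diag(1_a) Λ` be the generator of the chain stopped on leaving the class. If `x` is carried by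
the class, then `t ↦ 1_a * (x exp(t A_a))` solves `w' = 1_a * (w Λ)`, and its mass
`m(t) = x exp(t A_a) 1_a`, the probability of staying in the class up to time `t`, satisfies
`m' = w Λ 1_a`. Hence `φ(t, x) = w(t) / m(t)` (`flow_eq`), and `m(t)` is the exponential of the
integral of `φ(s, x) Λ 1_a` over `[0, t]` (`exp_integral_rate_flow`). This turns both formulas into
statements about the semigroup of `A_a`.

The probabilistic input is that, given the past of the optional time `T_n` and on `{Y_{T_n} = a}`,
the position at `(T_n + s) ∧ T_{n+1}` has the law `exp(s A_a)` started at `X_{T_n}`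
(`IsMarkovLaw.measureReal_stopped`). The chain is sampled at the times `T_n + k s / N` and frozen at
the first sample outside the class. By the strong Markov property its transition matrix is
`diag(1_a) exp((s / N) Λ) + diag(1 - 1_a)`, whose `N`-th power tends to `exp(s A_a)` by Chernoff's
product formula (`tendsto_frozen_pow`), while pathwise the frozen chain ends up at the position at
`(T_n + s) ∧ T_{n+1}` (`eventually_frozenChain_eq`).

By induction on `n`, `Π_{T_n}` is the conditional law of `X_{T_n}` given `Σ_n` (`isFilterAt`).
Granted this for `n`, the conditional law of the position at `(T_n + s) ∧ T_{n+1}` given `Σ_n` is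
`Π_{T_n} exp(s A_a)` with `a = Y_{T_n}`. Its mass in the class is the conditional probability that
the sojourn time exceeds `s` (`IsFilterAt.measure_lt_sojourn`), which is the first formula. Its
value at a state `j` outside the class is the integral over `[0, s]` of the flux `(w(u) Λ)(j)`, so
that the flux into a set `J` is the conditional density of the sojourn time on the event that
`X_{T_{n+1}} ∈ J`. Ratios of fluxes are therefore conditional probabilities given the sojourn time
(`IsFilterAt.measure_landing_eq_lintegral`). The flux into the class `b` divided by the total flux
is `q`, which is the second formula, and the flux into `{i}` divided by the flux into the class of
`i` is `H[w(u) Λ](i)`, which is the induction step. The arbitrary defaults in `H` and `q` are used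
only where the corresponding mass or flux vanishes.
-/

namespace MarkovFilter

/-! ### Exponentials of rate matrices -/

section BanachAlgebra

variable {𝔸 : Type*} [NormedRing 𝔸] [NormedAlgebra ℝ 𝔸] [CompleteSpace 𝔸]

/-- Chernoff's product formula for elements `M ε` of a Banach algebra with `M 0 = 1` and derivative
`A` at `0`. -/
lemma tendsto_pow_of_hasDerivAt {M : ℝ → 𝔸} {A : 𝔸} {c : ℝ}
    (hM0 : M 0 = 1) (hM : HasDerivAt M A 0) (hMc : ∀ ε, 0 ≤ ε → ‖M ε‖ ≤ Real.exp (ε * c))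
    (hAc : ∀ ε : ℝ, 0 ≤ ε → ‖NormedSpace.exp (ε • A)‖ ≤ Real.exp (ε * c)) (s : ℝ) (hs : 0 ≤ s) :
    Tendsto (fun N : ℕ => M (s / (N + 1 : ℕ)) ^ (N + 1)) atTop (𝓝 (NormedSpace.exp (s • A))) := by
  have key : ∀ (X Y : 𝔸) (r : ℝ), ‖X‖ ≤ r → ‖Y‖ ≤ r → ∀ N : ℕ,
      ‖X ^ (N + 1) - Y ^ (N + 1)‖ ≤ (N + 1) * r ^ N * ‖X - Y‖ := by
    intro X Y r hX hY N
    have hr : 0 ≤ r := (norm_nonneg X).trans hX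
    induction N with
    | zero => simp
    | succ N ih =>
      have hYN : ‖Y ^ (N + 1)‖ ≤ r ^ (N + 1) :=
        (norm_pow_le' Y N.succ_pos).trans (pow_le_pow_left₀ (norm_nonneg _) hY _)
      have e : X ^ (N + 1 + 1) - Y ^ (N + 1 + 1) =
          X * (X ^ (N + 1) - Y ^ (N + 1)) + (X - Y) * Y ^ (N + 1) := by
        rw [pow_succ' X, pow_succ' Y (N + 1)]; noncomm_ring
      calc ‖X ^ (N + 1 + 1) - Y ^ (N + 1 + 1)‖
          ≤ ‖X‖ * ‖X ^ (N + 1) - Y ^ (N + 1)‖ + ‖X - Y‖ * ‖Y ^ (N + 1)‖ := by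
            rw [e]
            exact (norm_add_le _ _).trans (add_le_add (norm_mul_le _ _) (norm_mul_le _ _))
        _ ≤ r * ((N + 1) * r ^ N * ‖X - Y‖) + ‖X - Y‖ * r ^ (N + 1) := by gcongr
        _ = ((N + 1 : ℕ) + 1) * r ^ (N + 1) * ‖X - Y‖ := by push_cast; ring
  have hdiff : HasDerivAt (fun ε => M ε - NormedSpace.exp (ε • A)) 0 0 := by
    have h2 := hM.sub (hasDerivAt_exp_smul_const A (0 : ℝ))
    rw [zero_smul, NormedSpace.exp_zero, one_mul, sub_self] at h2
    exact h2
  have ho : Tendsto (fun ε : ℝ => ‖ε‖⁻¹ * ‖M ε - NormedSpace.exp (ε • A)‖) (𝓝 0) (𝓝 0) := by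
    have h2 := hasDerivAt_iff_tendsto.1 hdiff
    simpa [hM0] using h2
  have hseq : Tendsto (fun N : ℕ => s / (N + 1 : ℕ)) atTop (𝓝 0) := by
    have := (tendsto_const_div_atTop_nhds_zero_nat s).comp (tendsto_add_atTop_nat 1)
    exact this
  have hlim : Tendsto (fun N : ℕ => s * Real.exp (s * |c|) *
      (‖s / (N + 1 : ℕ)‖⁻¹ * ‖M (s / (N + 1 : ℕ)) - NormedSpace.exp ((s / (N + 1 : ℕ)) • A)‖))
      atTop (𝓝 0) := by
    have h2 := (ho.comp hseq).const_mul (s * Real.exp (s * |c|))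
    rw [mul_zero] at h2
    exact h2
  rw [tendsto_iff_norm_sub_tendsto_zero]
  refine squeeze_zero (fun _ => norm_nonneg _) (fun N => ?_) hlim
  have hN : (0 : ℝ) < (N + 1 : ℕ) := by positivity
  set ε : ℝ := s / (N + 1 : ℕ) with hε
  have hε0 : 0 ≤ ε := by positivity
  have hsε : s = (N + 1 : ℕ) * ε := by rw [hε]; field_simp
  have hexp : NormedSpace.exp (s • A) = NormedSpace.exp (ε • A) ^ (N + 1) := by
    let _ : NormedAlgebra ℚ 𝔸 := NormedAlgebra.restrictScalars ℚ ℝ 𝔸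
    rw [← NormedSpace.exp_nsmul, ← Nat.cast_smul_eq_nsmul ℝ, smul_smul, ← hsε]
  rw [hexp]
  refine (key _ _ _ (hMc ε hε0) (hAc ε hε0) N).trans ?_
  rcases hε0.eq_or_lt with h0 | h0
  · rw [← h0]; simp [hM0]
  · have h1 : Real.exp (ε * c) ^ N ≤ Real.exp (s * |c|) := by
      rw [← Real.exp_nat_mul]
      apply Real.exp_le_exp.2
      have : (N : ℝ) * ε ≤ s := by rw [hsε]; push_cast; nlinarith
      calc (N : ℝ) * (ε * c) ≤ N * (ε * |c|) := by gcongr; exact le_abs_self c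
        _ = (N * ε) * |c| := by ring
        _ ≤ s * |c| := by gcongr
    rw [Real.norm_of_nonneg hε0]
    have h2 : s * Real.exp (s * |c|) * (ε⁻¹ * ‖M ε - NormedSpace.exp (ε • A)‖) =
        ((N : ℝ) + 1) * Real.exp (s * |c|) * ‖M ε - NormedSpace.exp (ε • A)‖ := by
      have : s * ε⁻¹ = N + 1 := by rw [hsε]; field_simp; push_cast; ring
      rw [← this]; ring
    rw [h2]
    gcongr

/-- If `D` has norm at most one, then `1 + D (e^{εΛ} - 1)` satisfies the assumptions of Chernoff's
formula with derivative `D Λ`. -/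
lemma tendsto_one_add_mul_exp_sub_one_pow [NormOneClass 𝔸] (D Λ : 𝔸) (hD : ‖D‖ ≤ 1) (s : ℝ)
    (hs : 0 ≤ s) :
    Tendsto (fun N : ℕ => (1 + D * (NormedSpace.exp ((s / (N + 1 : ℕ)) • Λ) - 1)) ^ (N + 1)) atTop
      (𝓝 (NormedSpace.exp (s • (D * Λ)))) := by
  have hexpn : ∀ X : 𝔸, ‖NormedSpace.exp X - 1‖ ≤ Real.exp ‖X‖ - 1 := by
    intro X
    have h1 : HasSum (fun n : ℕ => ((n.factorial : ℝ)⁻¹ • X ^ n)) (NormedSpace.exp X) :=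
      NormedSpace.exp_series_hasSum_exp' X
    have h2 : HasSum (fun n : ℕ => ((n.factorial : ℝ)⁻¹ • ‖X‖ ^ n)) (Real.exp ‖X‖) := by
      rw [Real.exp_eq_exp_ℝ]; exact NormedSpace.exp_series_hasSum_exp' ‖X‖
    have h1' := (hasSum_nat_add_iff' 1).2 h1
    have h2' := (hasSum_nat_add_iff' 1).2 h2
    simp only [Finset.range_one, Finset.sum_singleton, Nat.factorial_zero, Nat.cast_one, inv_one,
      pow_zero, one_smul] at h1' h2'
    refine h1'.norm_le_of_bounded h2' fun n => ?_
    rw [norm_smul, smul_eq_mul, norm_inv, Real.norm_natCast]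
    gcongr
    exact norm_pow_le' X n.succ_pos
  refine tendsto_pow_of_hasDerivAt (c := ‖Λ‖)
    (M := fun ε => 1 + D * (NormedSpace.exp (ε • Λ) - 1)) ?_ ?_ ?_ ?_ s hs
  · simp
  · have h1 := ((hasDerivAt_exp_smul_const Λ (0 : ℝ)).sub_const 1).const_mul D
    rw [zero_smul, NormedSpace.exp_zero, one_mul] at h1
    exact h1.const_add 1
  · intro ε hε
    calc ‖1 + D * (NormedSpace.exp (ε • Λ) - 1)‖
        ≤ ‖(1 : 𝔸)‖ + ‖D‖ * ‖NormedSpace.exp (ε • Λ) - 1‖ :=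
          (norm_add_le _ _).trans (by gcongr; exact norm_mul_le _ _)
      _ ≤ 1 + 1 * (Real.exp ‖ε • Λ‖ - 1) := by
          gcongr
          · rw [norm_one]
          · exact hexpn _
      _ = Real.exp (ε * ‖Λ‖) := by rw [norm_smul, Real.norm_of_nonneg hε]; ring
  · intro ε hε
    calc ‖NormedSpace.exp (ε • (D * Λ))‖
        = ‖1 + (NormedSpace.exp (ε • (D * Λ)) - 1)‖ := by congr 1; abel
      _ ≤ 1 + (Real.exp ‖ε • (D * Λ)‖ - 1) :=
          (norm_add_le _ _).trans (add_le_add (by rw [norm_one]) (hexpn _))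
      _ = Real.exp (ε * ‖D * Λ‖) := by
          rw [norm_smul, Real.norm_of_nonneg hε]; ring
      _ ≤ Real.exp (ε * ‖Λ‖) := by
          apply Real.exp_le_exp.2
          gcongr
          calc ‖D * Λ‖ ≤ ‖D‖ * ‖Λ‖ := norm_mul_le _ _
            _ ≤ 1 * ‖Λ‖ := by gcongr
            _ = ‖Λ‖ := one_mul _

end BanachAlgebra

section MatrixExp

attribute [local instance] Matrix.linftyOpNormedRing Matrix.linftyOpNormedAlgebra

variable {I : Type*} [Fintype I] [DecidableEq I]

lemma hasDerivAt_matrixExp (A : Matrix I I ℝ) (t : ℝ) :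
    HasDerivAt (fun u : ℝ => NormedSpace.exp (u • A)) (NormedSpace.exp (t • A) * A) t :=
  hasDerivAt_exp_smul_const A t

lemma hasDerivAt_vecMul_matrixExp (A : Matrix I I ℝ) (x : I → ℝ) (t : ℝ) :
    HasDerivAt (fun u : ℝ => x ᵥ* NormedSpace.exp (u • A))
      ((x ᵥ* NormedSpace.exp (t • A)) ᵥ* A) t := by
  rw [Matrix.vecMul_vecMul]
  let L : Matrix I I ℝ →ₗ[ℝ] (I → ℝ) :=
    { toFun := fun M => x ᵥ* M
      map_add' := fun M N => Matrix.vecMul_add M N x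
      map_smul' := fun c M => Matrix.vecMul_smul x c M }
  exact (LinearMap.toContinuousLinearMap L).hasFDerivAt.comp_hasDerivAt t (hasDerivAt_matrixExp A t)

lemma continuous_matrixExp_smul (A : Matrix I I ℝ) :
    Continuous fun u : ℝ => NormedSpace.exp (u • A) :=
  continuous_iff_continuousAt.2 fun t => (hasDerivAt_matrixExp A t).continuousAt

/-- The exponential series of an entrywise nonnegative matrix dominates its zeroth term. -/
lemma one_apply_le_exp_apply {B : Matrix I I ℝ} (hB : ∀ i j, 0 ≤ B i j) (i j : I) :
    (1 : Matrix I I ℝ) i j ≤ NormedSpace.exp B i j := by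
  have hs : HasSum (fun n : ℕ => ((n.factorial : ℝ)⁻¹ • B ^ n)) (NormedSpace.exp B) :=
    NormedSpace.exp_series_hasSum_exp' B
  have hs' : HasSum (fun n : ℕ => ((n.factorial : ℝ)⁻¹ • B ^ n) i j) (NormedSpace.exp B i j) :=
    Pi.hasSum.1 (Pi.hasSum.1 hs i) j
  have hpow : ∀ n : ℕ, ∀ i j, 0 ≤ (B ^ n) i j := by
    intro n
    induction n with
    | zero => intro i j; rw [pow_zero, Matrix.one_apply]; split_ifs <;> norm_num
    | succ n ih =>
      intro i j
      rw [pow_succ, Matrix.mul_apply]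
      exact Finset.sum_nonneg fun k _ => mul_nonneg (ih i k) (hB k j)
  have h0 := le_hasSum hs' 0 fun n _ => by
    rw [Matrix.smul_apply]
    exact smul_nonneg (by positivity) (hpow n i j)
  simpa using h0

/-- A matrix with nonnegative off-diagonal entries has an exponential with nonnegative entries
and with a positive diagonal, uniformly on compact time intervals. -/
lemma exists_exp_neg_mul_le_exp_apply {A : Matrix I I ℝ} (hA : ∀ i j, i ≠ j → 0 ≤ A i j) :
    ∃ c : ℝ, ∀ t : ℝ, 0 ≤ t → ∀ i j,
      Real.exp (-(t * c)) * (1 : Matrix I I ℝ) i j ≤ NormedSpace.exp (t • A) i j := by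
  refine ⟨∑ k, |A k k|, fun t ht i j => ?_⟩
  set c : ℝ := ∑ k, |A k k|
  have hB : ∀ i j, 0 ≤ (t • A + (t * c) • (1 : Matrix I I ℝ)) i j := by
    intro i j
    rw [Matrix.add_apply, Matrix.smul_apply, Matrix.smul_apply, Matrix.one_apply]
    split_ifs with hij
    · subst hij
      have h1 : |A i i| ≤ c :=
        Finset.single_le_sum (f := fun k => |A k k|) (fun k _ => abs_nonneg _) (Finset.mem_univ i)
      have h2 := neg_abs_le (A i i)
      simp only [smul_eq_mul, mul_one]
      nlinarith
    · simpa using mul_nonneg ht (hA i j hij)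
  have h1 := one_apply_le_exp_apply hB i j
  have hcomm : Commute (t • A) ((t * c) • (1 : Matrix I I ℝ)) :=
    (Commute.one_right (t • A)).smul_right (t * c)
  have hscal : NormedSpace.exp ((t * c) • (1 : Matrix I I ℝ)) =
      Real.exp (t * c) • (1 : Matrix I I ℝ) := by
    have h3 := NormedSpace.algebraMap_exp_comm (𝔸 := Matrix I I ℝ) (t * c)
    rw [Algebra.algebraMap_eq_smul_one, Algebra.algebraMap_eq_smul_one] at h3
    rw [Real.exp_eq_exp_ℝ]; exact h3.symm
  rw [Matrix.exp_add_of_commute _ _ hcomm, hscal, Matrix.mul_smul, mul_one, Matrix.smul_apply,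
    smul_eq_mul] at h1
  calc Real.exp (-(t * c)) * (1 : Matrix I I ℝ) i j
      ≤ Real.exp (-(t * c)) * (Real.exp (t * c) * NormedSpace.exp (t • A) i j) := by gcongr
    _ = NormedSpace.exp (t • A) i j := by
      rw [← mul_assoc, ← Real.exp_add]; simp

/-- The chain sampled with mesh `ε` and frozen on leaving the set marked by the `0`-`1` vector `d`
converges to the chain stopped on leaving that set. -/
lemma tendsto_frozen_pow (Λ : Matrix I I ℝ) (d : I → ℝ) (hd : ∀ i, d i = 0 ∨ d i = 1) (s : ℝ)
    (hs : 0 ≤ s) :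
    Tendsto (fun N : ℕ => (diagonal d * NormedSpace.exp ((s / (N + 1 : ℕ)) • Λ) +
      diagonal (1 - d)) ^ (N + 1)) atTop (𝓝 (NormedSpace.exp (s • (diagonal d * Λ)))) := by
  cases isEmpty_or_nonempty I
  · refine tendsto_const_nhds.congr fun N => Subsingleton.elim _ _
  have hdn : ‖(diagonal d : Matrix I I ℝ)‖ ≤ 1 := by
    rw [Matrix.linfty_opNorm_diagonal]
    refine (pi_norm_le_iff_of_nonneg zero_le_one).2 fun i => ?_
    rcases hd i with h | h <;> simp [h]
  have hsplit : ∀ X : Matrix I I ℝ, diagonal d * X + diagonal (1 - d) =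
      1 + diagonal d * (X - 1) := by
    intro X
    have : (diagonal (1 - d) : Matrix I I ℝ) = 1 - diagonal d := by
      rw [← diagonal_one, diagonal_sub]; rfl
    rw [this]; noncomm_ring
  simp only [hsplit]
  exact tendsto_one_add_mul_exp_sub_one_pow (𝔸 := Matrix I I ℝ) (diagonal d) Λ hdn s hs

end MatrixExp

/-! ### Faces of the simplex and rates -/

section Flow

variable {I O : Type*}

lemma classInd_of_eq {h : I → O} {a : O} {i : I} (hi : h i = a) : classInd h a i = 1 := by
  simp [classInd, hi]

lemma classInd_of_ne {h : I → O} {a : O} {i : I} (hi : h i ≠ a) : classInd h a i = 0 := by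
  simp [classInd, hi]

lemma classInd_nonneg (h : I → O) (a : O) (i : I) : 0 ≤ classInd h a i :=
  Set.indicator_nonneg (fun _ _ => zero_le_one) i

variable [Fintype I]

lemma eq_of_mem_face {h : I → O} {a b : O} {x : I → ℝ} (ha : x ∈ face h a) (hb : x ∈ face h b) :
    a = b := by
  by_contra hab
  have : ∑ i, x i = 0 := Finset.sum_eq_zero fun i _ => by
    by_cases hi : h i = a
    · exact hb.2 i (hi ▸ hab)
    · exact ha.2 i hi
  linarith [ha.1.2]

lemma classInd_mul_of_mem_face {h : I → O} {a : O} {x : I → ℝ} (ha : x ∈ face h a) :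
    classInd h a * x = x := by
  ext i
  by_cases hi : h i = a
  · simp [classInd_of_eq hi]
  · simp [classInd_of_ne hi, ha.2 i hi]

lemma dotProduct_classInd_of_mem_face {h : I → O} {a : O} {x : I → ℝ} (ha : x ∈ face h a) :
    x ⬝ᵥ classInd h a = 1 := by
  rw [dotProduct_comm, ← ha.1.2]
  exact Finset.sum_congr rfl fun i _ => congrFun (classInd_mul_of_mem_face ha) i

lemma rate_smul (Λ : Matrix I I ℝ) (h : I → O) (c : ℝ) (ν : I → ℝ) (a : O) :
    rate Λ h (c • ν) a = c * rate Λ h ν a := by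
  rw [rate, rate, smul_vecMul, smul_dotProduct, smul_eq_mul]

lemma rate_eq_sum (Λ : Matrix I I ℝ) (h : I → O) (ν : I → ℝ) (a : O) :
    rate Λ h ν a = ∑ j, (ν ᵥ* Λ) j * classInd h a j := rfl

lemma vecMul_nonneg_of_ne {Λ : Matrix I I ℝ} (hΛ : IsRateMatrix Λ) {h : I → O} {a : O}
    {w : I → ℝ} (hw : ∀ i, 0 ≤ w i) (hwa : ∀ i, h i ≠ a → w i = 0) {j : I} (hj : h j ≠ a) :
    0 ≤ (w ᵥ* Λ) j := by
  refine Finset.sum_nonneg fun i _ => ?_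
  by_cases hij : i = j
  · simp [hwa i (hij ▸ hj)]
  · exact mul_nonneg (hw i) (hΛ.1 i j hij)

lemma rate_nonneg_of_ne {Λ : Matrix I I ℝ} (hΛ : IsRateMatrix Λ) {h : I → O} {a b : O}
    {w : I → ℝ} (hw : ∀ i, 0 ≤ w i) (hwa : ∀ i, h i ≠ a → w i = 0) (hb : b ≠ a) :
    0 ≤ rate Λ h w b := by
  rw [rate_eq_sum]
  refine Finset.sum_nonneg fun j _ => ?_
  by_cases hj : h j = b
  · exact mul_nonneg (vecMul_nonneg_of_ne hΛ hw hwa (hj ▸ hb)) (classInd_nonneg _ _ _)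
  · simp [classInd_of_ne hj]

lemma sum_vecMul_eq_zero {Λ : Matrix I I ℝ} (hΛ : IsRateMatrix Λ) (w : I → ℝ) :
    ∑ j, (w ᵥ* Λ) j = 0 := by
  simp only [vecMul, dotProduct]
  rw [Finset.sum_comm]
  refine Finset.sum_eq_zero fun i _ => ?_
  rw [← Finset.mul_sum, hΛ.2 i, mul_zero]

open Classical in
/-- The total rate of leaving the class `a` is the sum of the rates to the other states. -/
lemma neg_rate_eq_sum {Λ : Matrix I I ℝ} (hΛ : IsRateMatrix Λ) (h : I → O) (w : I → ℝ) (a : O) :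
    -rate Λ h w a = ∑ j, if h j ≠ a then (w ᵥ* Λ) j else 0 := by
  rw [rate_eq_sum, neg_eq_iff_add_eq_zero, ← Finset.sum_add_distrib]
  refine (Finset.sum_congr rfl fun j _ => ?_).trans (sum_vecMul_eq_zero hΛ w)
  by_cases hj : h j = a
  · simp [classInd_of_eq hj, hj]
  · simp [classInd_of_ne hj, hj]

lemma contDiff_field (Λ : Matrix I I ℝ) (h : I → O) (a : O) : ContDiff ℝ 1 (field Λ h a) := by
  unfold field rate vecMul dotProduct
  rw [contDiff_pi]
  intro i
  simp only [Pi.sub_apply, Pi.mul_apply, Pi.smul_apply, smul_eq_mul]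
  fun_prop

lemma continuous_rate (Λ : Matrix I I ℝ) (h : I → O) (a : O) :
    Continuous fun ν : I → ℝ => rate Λ h ν a :=
  (continuous_id.matrix_vecMul continuous_const).dotProduct continuous_const

/-! ### The operators `H` and `q` -/

variable {Λ : Matrix I I ℝ} {h : I → O} {a : O} {x : I → ℝ}

lemma condOp_smul (h : I → O) (νd : O → I → ℝ) (b : O) {c : ℝ} (hc : c ≠ 0) (ν : I → ℝ) :
    condOp h νd b (c • ν) = condOp h νd b ν := by
  unfold condOp
  rw [smul_dotProduct, smul_eq_mul]
  by_cases h0 : ν ⬝ᵥ classInd h b = 0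
  · simp [h0]
  · rw [if_pos (mul_ne_zero hc h0), if_pos h0]
    ext i
    simp only [Pi.smul_apply, Pi.mul_apply, smul_eq_mul]
    field_simp

lemma condOp_mem_face {νd : O → I → ℝ} (hνd : ∀ a, νd a ∈ face h a) {b : O} {ν : I → ℝ}
    (hν : ∀ i, h i = b → 0 ≤ ν i) : condOp h νd b ν ∈ face h b := by
  unfold condOp
  split_ifs with h0
  · have hterm : ∀ i, 0 ≤ ν i * classInd h b i := fun i => by
      by_cases hi : h i = b
      · exact mul_nonneg (hν i hi) (classInd_nonneg _ _ _)
      · simp [classInd_of_ne hi]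
    have hs : 0 ≤ ν ⬝ᵥ classInd h b := Finset.sum_nonneg fun i _ => hterm i
    refine ⟨⟨fun i => ?_, ?_⟩, fun i hi => ?_⟩
    · simp only [Pi.smul_apply, Pi.mul_apply, smul_eq_mul]
      exact mul_nonneg (inv_nonneg.2 hs) (by rw [mul_comm]; exact hterm i)
    · simp only [Pi.smul_apply, Pi.mul_apply, smul_eq_mul]
      rw [← Finset.mul_sum]
      simp only [mul_comm (classInd h b _)]
      exact inv_mul_cancel₀ h0
    · simp [classInd_of_ne hi]
  · exact hνd b

/-- Bayes' formula: conditioning on the class `b` and multiplying by its mass gives back the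
restriction to the class. -/
lemma rate_mul_condOp (hΛ : IsRateMatrix Λ) (νd : O → I → ℝ) {w : I → ℝ} (hw : ∀ i, 0 ≤ w i)
    (hwa : ∀ i, h i ≠ a → w i = 0) {j : I} (hj : h j ≠ a) :
    rate Λ h w (h j) * condOp h νd (h j) (w ᵥ* Λ) j = (w ᵥ* Λ) j := by
  unfold condOp
  by_cases h0 : (w ᵥ* Λ) ⬝ᵥ classInd h (h j) = 0
  · rw [if_neg (not_not.2 h0), rate, h0, zero_mul]
    have h1 := (Finset.sum_eq_zero_iff_of_nonneg (fun i _ => ?_)).1 h0 j (Finset.mem_univ j)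
    · rw [classInd_of_eq rfl, mul_one] at h1; exact h1.symm
    · by_cases hi : h i = h j
      · exact mul_nonneg (vecMul_nonneg_of_ne hΛ hw hwa (hi ▸ hj)) (classInd_nonneg _ _ _)
      · simp [classInd_of_ne hi]
  · rw [if_pos h0, rate]
    simp only [Pi.smul_apply, Pi.mul_apply, smul_eq_mul, classInd_of_eq]
    field_simp

open Classical in
/-- The value of `q(ν, b)` as a function of the class `a` of `ν`. -/
noncomputable def jumpProb (Λ : Matrix I I ℝ) (h : I → O) (qd : O → O → ℝ) (a b : O)
    (w : I → ℝ) : ℝ :=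
  if rate Λ h w a ≠ 0 then if b ≠ a then rate Λ h w b / (-rate Λ h w a) else 0 else qd a b

lemma jumpProb_smul (qd : O → O → ℝ) (b : O) {c : ℝ} (hc : c ≠ 0) (w : I → ℝ) :
    jumpProb Λ h qd a b (c • w) = jumpProb Λ h qd a b w := by
  unfold jumpProb
  simp only [rate_smul]
  by_cases h0 : rate Λ h w a = 0
  · simp [h0]
  · rw [if_pos (mul_ne_zero hc h0), if_pos h0]
    split_ifs
    · field_simp
    · rfl

lemma postJumpLaw_eq (qd : O → O → ℝ) (hx : x ∈ face h a) (b : O) :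
    postJumpLaw Λ h qd x b = jumpProb Λ h qd a b x := by
  have H : ∃ a, x ∈ face h a := ⟨a, hx⟩
  have h1 : H.choose = a := eq_of_mem_face H.choose_spec hx
  rw [postJumpLaw, dif_pos H, h1, jumpProb]

lemma jumpProb_nonneg (hΛ : IsRateMatrix Λ) {qd : O → O → ℝ} {b : O} (hqd : 0 ≤ qd a b)
    {w : I → ℝ} (hw : ∀ i, 0 ≤ w i) (hwa : ∀ i, h i ≠ a → w i = 0) :
    0 ≤ jumpProb Λ h qd a b w := by
  classical
  unfold jumpProb
  split_ifs with h1 h2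
  · refine div_nonneg (rate_nonneg_of_ne hΛ hw hwa h2) ?_
    rw [neg_rate_eq_sum hΛ]
    refine Finset.sum_nonneg fun j _ => ?_
    split_ifs with hj
    · exact vecMul_nonneg_of_ne hΛ hw hwa hj
    · exact le_rfl
  · exact le_rfl
  · exact hqd

open Classical in
/-- The total exit rate times the jump probability is the exit rate to the class `b`. -/
lemma neg_rate_mul_jumpProb (hΛ : IsRateMatrix Λ) (qd : O → O → ℝ) (b : O)
    {w : I → ℝ} (hw : ∀ i, 0 ≤ w i) (hwa : ∀ i, h i ≠ a → w i = 0) :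
    -rate Λ h w a * jumpProb Λ h qd a b w = if b ≠ a then rate Λ h w b else 0 := by
  unfold jumpProb
  by_cases h0 : rate Λ h w a = 0
  · rw [h0, neg_zero, zero_mul]
    split_ifs with hb
    · have h1 : ∑ j, (if h j ≠ a then (w ᵥ* Λ) j else 0) = 0 := by
        rw [← neg_rate_eq_sum hΛ, h0, neg_zero]
      have h2 := (Finset.sum_eq_zero_iff_of_nonneg (fun j _ => ?_)).1 h1
      · refine (Finset.sum_eq_zero fun j hj => ?_).symm
        have h3 := h2 j hj
        by_cases hjb : h j = b
        · rw [if_pos (hjb ▸ hb)] at h3; rw [h3, zero_mul]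
        · rw [classInd_of_ne hjb, mul_zero]
      · split_ifs with hj
        · exact vecMul_nonneg_of_ne hΛ hw hwa hj
        · exact le_rfl
    · rfl
  · rw [if_pos h0]
    split_ifs
    · field_simp
    · simp

/-- Solutions of the filtering equation are unique: the field is smooth, hence Lipschitz on the
balls which contain two given solutions up to a given time. -/
lemma IsFlowLine.eq_of_nonneg {y z : ℝ → I → ℝ} (hy : IsFlowLine Λ h a x y)
    (hz : IsFlowLine Λ h a x z) {t : ℝ} (ht : 0 ≤ t) : y t = z t := by
  have hc : ∀ {y : ℝ → I → ℝ}, IsFlowLine Λ h a x y → ContinuousOn y (Set.Icc 0 t) :=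
    fun hy s hs => ((hy.2 s hs.1).continuousWithinAt).mono Set.Icc_subset_Ici_self
  obtain ⟨R₁, h₁⟩ := (isCompact_Icc.image_of_continuousOn (hc hy)).isBounded.subset_closedBall 0
  obtain ⟨R₂, h₂⟩ := (isCompact_Icc.image_of_continuousOn (hc hz)).isBounded.subset_closedBall 0
  set B := Metric.closedBall (0 : I → ℝ) (max R₁ R₂)
  obtain ⟨K, hK⟩ := ((contDiff_field Λ h a).locallyLipschitz.locallyLipschitzOn
    (s := B)).exists_lipschitzOnWith_of_compact (isCompact_closedBall _ _)
  have hder : ∀ {y : ℝ → I → ℝ}, IsFlowLine Λ h a x y → ∀ s ∈ Set.Ico 0 t,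
      HasDerivWithinAt y (field Λ h a (y s)) (Set.Ici s) s :=
    fun hy s hs => (hy.2 s hs.1).mono (Set.Ici_subset_Ici.2 hs.1)
  refine ODE_solution_unique_of_mem_Icc_right (v := fun _ => field Λ h a) (s := fun _ => B)
    (K := K) (fun _ _ => hK) (hc hy) (hder hy) (fun s hs => ?_) (hc hz) (hder hz)
    (fun s hs => ?_) (hy.1.trans hz.1.symm) (Set.right_mem_Icc.2 ht)
  · exact Metric.closedBall_subset_closedBall (le_max_left _ _)
      (h₁ ⟨s, Set.Ico_subset_Icc_self hs, rfl⟩)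
  · exact Metric.closedBall_subset_closedBall (le_max_right _ _)
      (h₂ ⟨s, Set.Ico_subset_Icc_self hs, rfl⟩)

/-! ### The stopped semigroup and the flow -/

variable [DecidableEq I]

/-- The generator of the chain stopped on leaving `h⁻¹(a)`: the rows of `Λ` outside that class are
replaced by zero. -/
noncomputable def stoppedGen (Λ : Matrix I I ℝ) (h : I → O) (a : O) : Matrix I I ℝ :=
  diagonal (classInd h a) * Λ

/-- The law at time `t` of the chain started from `x` and stopped on leaving `h⁻¹(a)`. -/
noncomputable def stoppedLaw (Λ : Matrix I I ℝ) (h : I → O) (a : O) (t : ℝ) (x : I → ℝ) : I → ℝ :=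
  x ᵥ* NormedSpace.exp (t • stoppedGen Λ h a)

/-- The part of `stoppedLaw` carried by `h⁻¹(a)`: the unnormalised filter. -/
noncomputable def killedLaw (Λ : Matrix I I ℝ) (h : I → O) (a : O) (t : ℝ) (x : I → ℝ) : I → ℝ :=
  classInd h a * stoppedLaw Λ h a t x

/-- The probability that the chain started from `x` has not left `h⁻¹(a)` by time `t`. -/
noncomputable def survival (Λ : Matrix I I ℝ) (h : I → O) (a : O) (t : ℝ) (x : I → ℝ) : ℝ :=
  stoppedLaw Λ h a t x ⬝ᵥ classInd h a

lemma stoppedLaw_zero (x : I → ℝ) : stoppedLaw Λ h a 0 x = x := by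
  simp [stoppedLaw]

lemma vecMul_stoppedGen (z : I → ℝ) : z ᵥ* stoppedGen Λ h a = (classInd h a * z) ᵥ* Λ := by
  rw [stoppedGen, ← vecMul_vecMul]
  congr 1
  ext i
  rw [vecMul_diagonal, Pi.mul_apply, mul_comm]

lemma hasDerivAt_stoppedLaw (x : I → ℝ) (t : ℝ) :
    HasDerivAt (fun u => stoppedLaw Λ h a u x) (killedLaw Λ h a t x ᵥ* Λ) t := by
  have h1 := hasDerivAt_vecMul_matrixExp (stoppedGen Λ h a) x t
  rw [vecMul_stoppedGen] at h1
  exact h1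

lemma hasDerivAt_killedLaw (x : I → ℝ) (t : ℝ) :
    HasDerivAt (fun u => killedLaw Λ h a u x) (classInd h a * (killedLaw Λ h a t x ᵥ* Λ)) t := by
  have h1 := hasDerivAt_pi.1 (hasDerivAt_stoppedLaw (Λ := Λ) (h := h) (a := a) x t)
  exact hasDerivAt_pi.2 fun i => (h1 i).const_mul (classInd h a i)

lemma hasDerivAt_survival (x : I → ℝ) (t : ℝ) :
    HasDerivAt (fun u => survival Λ h a u x) (rate Λ h (killedLaw Λ h a t x) a) t := by
  have h1 := hasDerivAt_pi.1 (hasDerivAt_stoppedLaw (Λ := Λ) (h := h) (a := a) x t)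
  exact HasDerivAt.fun_sum fun i _ => (h1 i).mul_const (classInd h a i)

lemma continuous_stoppedLaw_prod :
    Continuous fun p : ℝ × (I → ℝ) => stoppedLaw Λ h a p.1 p.2 := by
  have h1 : Continuous fun p : ℝ × (I → ℝ) => NormedSpace.exp (p.1 • stoppedGen Λ h a) :=
    (continuous_matrixExp_smul _).comp continuous_fst
  exact continuous_snd.matrix_vecMul h1

lemma continuous_killedLaw_prod :
    Continuous fun p : ℝ × (I → ℝ) => killedLaw Λ h a p.1 p.2 :=
  continuous_const.mul continuous_stoppedLaw_prod

lemma continuous_survival_prod :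
    Continuous fun p : ℝ × (I → ℝ) => survival Λ h a p.1 p.2 :=
  continuous_stoppedLaw_prod.dotProduct continuous_const

lemma survival_eq_sum_killedLaw (t : ℝ) (x : I → ℝ) :
    survival Λ h a t x = ∑ i, killedLaw Λ h a t x i :=
  Finset.sum_congr rfl fun _ _ => mul_comm _ _

lemma killedLaw_of_ne {t : ℝ} {i : I} (hi : h i ≠ a) : killedLaw Λ h a t x i = 0 := by
  simp [killedLaw, classInd_of_ne hi]

lemma killedLaw_zero (hx : x ∈ face h a) : killedLaw Λ h a 0 x = x := by
  rw [killedLaw, stoppedLaw_zero, classInd_mul_of_mem_face hx]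

lemma survival_zero (hx : x ∈ face h a) : survival Λ h a 0 x = 1 := by
  rw [survival, stoppedLaw_zero, dotProduct_classInd_of_mem_face hx]

lemma exists_exp_neg_mul_le_exp_stoppedGen (hΛ : IsRateMatrix Λ) (h : I → O) (a : O) :
    ∃ c : ℝ, ∀ t : ℝ, 0 ≤ t → ∀ i j, Real.exp (-(t * c)) * (1 : Matrix I I ℝ) i j ≤
      NormedSpace.exp (t • stoppedGen Λ h a) i j := by
  refine exists_exp_neg_mul_le_exp_apply fun i j hij => ?_
  rw [stoppedGen, diagonal_mul]
  exact mul_nonneg (classInd_nonneg _ _ _) (hΛ.1 i j hij)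

lemma stoppedLaw_nonneg (hΛ : IsRateMatrix Λ) (hx : ∀ i, 0 ≤ x i) {t : ℝ} (ht : 0 ≤ t) (j : I) :
    0 ≤ stoppedLaw Λ h a t x j := by
  obtain ⟨c, hc⟩ := exists_exp_neg_mul_le_exp_stoppedGen hΛ h a
  refine Finset.sum_nonneg fun i _ => mul_nonneg (hx i) (le_trans ?_ (hc t ht i j))
  rw [Matrix.one_apply]
  split_ifs <;> positivity

lemma killedLaw_nonneg (hΛ : IsRateMatrix Λ) (hx : ∀ i, 0 ≤ x i) {t : ℝ} (ht : 0 ≤ t) (j : I) :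
    0 ≤ killedLaw Λ h a t x j :=
  mul_nonneg (classInd_nonneg _ _ _) (stoppedLaw_nonneg hΛ hx ht j)

lemma survival_pos (hΛ : IsRateMatrix Λ) (hx : x ∈ face h a) {t : ℝ} (ht : 0 ≤ t) :
    0 < survival Λ h a t x := by
  obtain ⟨c, hc⟩ := exists_exp_neg_mul_le_exp_stoppedGen hΛ h a
  have h1 : ∀ j, Real.exp (-(t * c)) * x j ≤ stoppedLaw Λ h a t x j := by
    intro j
    have h2 : ∑ i, x i * (Real.exp (-(t * c)) * (1 : Matrix I I ℝ) i j) ≤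
        stoppedLaw Λ h a t x j :=
      Finset.sum_le_sum fun i _ => mul_le_mul_of_nonneg_left (hc t ht i j) (hx.1.1 i)
    simpa [Matrix.one_apply, mul_comm] using h2
  calc (0 : ℝ) < Real.exp (-(t * c)) * (x ⬝ᵥ classInd h a) := by
        rw [dotProduct_classInd_of_mem_face hx]; positivity
    _ = ∑ j, Real.exp (-(t * c)) * x j * classInd h a j := by
        rw [dotProduct, Finset.mul_sum]; simp only [mul_assoc]
    _ ≤ survival Λ h a t x :=
        Finset.sum_le_sum fun j _ => mul_le_mul_of_nonneg_right (h1 j) (classInd_nonneg _ _ _)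

/-- The normalised killed law solves the filtering equation. -/
lemma isFlowLine_normalised (hΛ : IsRateMatrix Λ) (hx : x ∈ face h a) :
    IsFlowLine Λ h a x fun t => (survival Λ h a t x)⁻¹ • killedLaw Λ h a t x := by
  refine ⟨by simp [survival_zero hx, killedLaw_zero hx], fun t ht => ?_⟩
  have hm := (survival_pos hΛ hx ht).ne'
  have h1 := ((hasDerivAt_survival (Λ := Λ) (h := h) (a := a) x t).fun_inv hm).fun_smul
    (hasDerivAt_killedLaw (Λ := Λ) (h := h) (a := a) x t)
  refine (h1.congr_deriv ?_).hasDerivWithinAt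
  rw [field, rate_smul, smul_vecMul]
  ext i
  simp only [Pi.add_apply, Pi.smul_apply, Pi.sub_apply, Pi.mul_apply, smul_eq_mul]
  field_simp
  ring

/-- The nonlinear flow is the normalised linear one. -/
lemma flow_eq (hΛ : IsRateMatrix Λ) (hx : x ∈ face h a) {t : ℝ} (ht : 0 ≤ t) :
    flow Λ h t x = (survival Λ h a t x)⁻¹ • killedLaw Λ h a t x := by
  have H : ∃ y : ℝ → I → ℝ, ∃ a, x ∈ face h a ∧ IsFlowLine Λ h a x y :=
    ⟨_, a, hx, isFlowLine_normalised hΛ hx⟩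
  rw [flow, dif_pos H]
  obtain ⟨b, hb, hy⟩ := H.choose_spec
  obtain rfl := eq_of_mem_face hx hb
  exact hy.eq_of_nonneg (isFlowLine_normalised hΛ hx) ht

lemma flow_zero (hΛ : IsRateMatrix Λ) (hx : x ∈ face h a) : flow Λ h 0 x = x := by
  rw [flow_eq hΛ hx le_rfl, survival_zero hx, killedLaw_zero hx, inv_one, one_smul]

lemma flow_mem_face (hΛ : IsRateMatrix Λ) (hx : x ∈ face h a) {t : ℝ} (ht : 0 ≤ t) :
    flow Λ h t x ∈ face h a := by
  have hm := survival_pos hΛ hx ht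
  rw [flow_eq hΛ hx ht]
  refine ⟨⟨fun i => ?_, ?_⟩, fun i hi => ?_⟩
  · exact mul_nonneg (inv_nonneg.2 hm.le) (killedLaw_nonneg hΛ hx.1.1 ht i)
  · simp only [Pi.smul_apply, smul_eq_mul]
    rw [← Finset.mul_sum, ← survival_eq_sum_killedLaw, inv_mul_cancel₀ hm.ne']
  · simp [killedLaw_of_ne hi]

lemma continuousOn_flow (hΛ : IsRateMatrix Λ) (hx : x ∈ face h a) :
    ContinuousOn (fun t => flow Λ h t x) (Set.Ici 0) := by
  have h1 : ContinuousOn (fun t => (survival Λ h a t x)⁻¹ • killedLaw Λ h a t x) (Set.Ici 0) := by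
    refine ContinuousOn.smul (ContinuousOn.inv₀ ?_ fun t ht => (survival_pos hΛ hx ht).ne') ?_
    · exact (continuous_survival_prod.comp (Continuous.prodMk_left x)).continuousOn
    · exact (continuous_killedLaw_prod.comp (Continuous.prodMk_left x)).continuousOn
  exact h1.congr fun t ht => flow_eq hΛ hx ht

/-- The survival probability solves `m' = m ρ`, where `ρ` is the rate along the flow, so it is the
exponential of the integrated rate. -/
lemma exp_integral_rate_flow (hΛ : IsRateMatrix Λ) (hx : x ∈ face h a) {t : ℝ} (ht : 0 ≤ t) :
    Real.exp (∫ s in (0 : ℝ)..t, rate Λ h (flow Λ h s x) a) = survival Λ h a t x := by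
  have hsub : Set.uIcc 0 t ⊆ Set.Ici 0 := by
    rw [Set.uIcc_of_le ht]; exact Set.Icc_subset_Ici_self
  have h1 : ∫ s in (0 : ℝ)..t, rate Λ h (flow Λ h s x) a =
      Real.log (survival Λ h a t x) - Real.log (survival Λ h a 0 x) := by
    refine intervalIntegral.integral_eq_sub_of_hasDerivAt
      (f := fun s => Real.log (survival Λ h a s x)) (fun s hs => ?_) ?_
    · have hs0 : 0 ≤ s := hsub hs
      have h2 := (hasDerivAt_survival (Λ := Λ) (h := h) (a := a) x s).log
        (survival_pos hΛ hx hs0).ne'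
      rw [flow_eq hΛ hx hs0, rate_smul, inv_mul_eq_div]
      exact h2
    · exact (((continuous_rate Λ h a).comp_continuousOn
        (continuousOn_flow hΛ hx)).mono hsub).intervalIntegrable
  rw [h1, survival_zero hx, Real.log_one, sub_zero, Real.exp_log (survival_pos hΛ hx ht)]

/-- Outside the class, the stopped chain accumulates the flux `(x e^{uA} 1_a) Λ`. -/
lemma ofReal_stoppedLaw_eq_lintegral (hΛ : IsRateMatrix Λ) (hx : ∀ i, 0 ≤ x i)
    (hxa : ∀ i, h i ≠ a → x i = 0) {j : I} (hj : h j ≠ a) {s : ℝ} (hs : 0 ≤ s) :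
    ENNReal.ofReal (stoppedLaw Λ h a s x j) =
      ∫⁻ u in Set.Ioc 0 s, ENNReal.ofReal ((killedLaw Λ h a u x ᵥ* Λ) j) := by
  have hcont : Continuous fun u => (killedLaw Λ h a u x ᵥ* Λ) j :=
    (continuous_apply j).comp ((continuous_killedLaw_prod.comp
      (Continuous.prodMk_left x)).matrix_vecMul continuous_const)
  have h1 : ∫ u in (0 : ℝ)..s, (killedLaw Λ h a u x ᵥ* Λ) j =
      stoppedLaw Λ h a s x j - stoppedLaw Λ h a 0 x j :=
    intervalIntegral.integral_eq_sub_of_hasDerivAt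
      (fun u _ => hasDerivAt_pi.1 (hasDerivAt_stoppedLaw x u) j) (hcont.intervalIntegrable _ _)
  rw [stoppedLaw_zero, hxa j hj, sub_zero, intervalIntegral.integral_of_le hs] at h1
  rw [← h1, ofReal_integral_eq_lintegral_ofReal]
  · exact hcont.integrableOn_Ioc
  · refine (ae_restrict_mem measurableSet_Ioc).mono fun u hu => ?_
    exact vecMul_nonneg_of_ne hΛ (killedLaw_nonneg hΛ hx hu.1.le)
      (fun i hi => killedLaw_of_ne hi) hj

lemma condOp_flow_mem_face (hΛ : IsRateMatrix Λ) {νd : O → I → ℝ} (hνd : ∀ a, νd a ∈ face h a)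
    (hx : x ∈ face h a) {b : O} (hb : b ≠ a) {t : ℝ} (ht : 0 ≤ t) :
    condOp h νd b (flow Λ h t x ᵥ* Λ) ∈ face h b := by
  have h1 := flow_mem_face hΛ hx ht
  refine condOp_mem_face hνd fun i hi => ?_
  exact vecMul_nonneg_of_ne hΛ h1.1.1 h1.2 (hi ▸ hb)

lemma condOp_flow_eq (hΛ : IsRateMatrix Λ) (νd : O → I → ℝ) (hx : x ∈ face h a) (b : O) {t : ℝ}
    (ht : 0 ≤ t) :
    condOp h νd b (flow Λ h t x ᵥ* Λ) = condOp h νd b (killedLaw Λ h a t x ᵥ* Λ) := by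
  rw [flow_eq hΛ hx ht, smul_vecMul,
    condOp_smul _ _ _ (inv_ne_zero (survival_pos hΛ hx ht).ne')]

lemma postJumpLaw_flow_eq (hΛ : IsRateMatrix Λ) (qd : O → O → ℝ) (hx : x ∈ face h a) (b : O)
    {t : ℝ} (ht : 0 ≤ t) :
    postJumpLaw Λ h qd (flow Λ h t x) b = jumpProb Λ h qd a b (killedLaw Λ h a t x) := by
  rw [postJumpLaw_eq qd (flow_mem_face hΛ hx ht), flow_eq hΛ hx ht,
    jumpProb_smul _ _ (inv_ne_zero (survival_pos hΛ hx ht).ne')]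

end Flow

/-! ### Jump times of a cadlag path -/

section Paths

variable {I O : Type*}

lemma exists_coe_eq {x : ℝ≥0∞} (hx : x < ⊤) : ∃ t : ℝ≥0, (t : ℝ≥0∞) = x :=
  ⟨_, ENNReal.coe_toNNReal hx.ne⟩

lemma CadlagPath.exists_coord_eq (ω : CadlagPath I) (t : ℝ≥0) :
    ∃ r, t < r ∧ ∀ s, t ≤ s → s < r → coord s ω = coord t ω := by
  obtain ⟨r, hr, hs⟩ := (mem_nhdsGT_iff_exists_Ioo_subset).1 (ω.2.1 t)
  refine ⟨r, hr, fun s h1 h2 => ?_⟩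
  rcases h1.eq_or_lt with rfl | h1
  · rfl
  · exact hs ⟨h1, h2⟩

lemma not_isJump_of_forall_obs_eq {h : I → O} {ω : CadlagPath I} {t r : ℝ≥0}
    (hc : ∀ s, t ≤ s → s < r → obs h ω s = obs h ω t) {s : ℝ≥0} (hts : t < s) (hsr : s < r) :
    ¬ IsJump h ω s := fun hs => hs.2 <| by
  filter_upwards [Ioo_mem_nhdsLT hts] with u hu
  rw [hc u hu.1.le (hu.2.trans hsr), hc s hts.le hsr]

lemma CadlagPath.exists_obs_eq (h : I → O) (ω : CadlagPath I) (t : ℝ≥0) :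
    ∃ r, t < r ∧ ∀ s, t ≤ s → s < r → obs h ω s = obs h ω t := by
  obtain ⟨r, hr, hs⟩ := ω.exists_coord_eq t
  exact ⟨r, hr, fun s h1 h2 => congrArg h (hs s h1 h2)⟩

/-- If the observation differs from its value at `t` later on, then it jumps in between. -/
lemma exists_isJump_of_obs_ne {h : I → O} {ω : CadlagPath I} {t s : ℝ≥0} (hts : t ≤ s)
    (hne : obs h ω s ≠ obs h ω t) : ∃ r, t < r ∧ r ≤ s ∧ IsJump h ω r := by
  set D : Set ℝ≥0 := {u | t ≤ u ∧ obs h ω u ≠ obs h ω t}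
  have hD : D.Nonempty := ⟨s, hts, hne⟩
  have hbd : BddBelow D := OrderBot.bddBelow D
  obtain ⟨r, hr, hc⟩ := ω.exists_obs_eq h t
  have htσ : t < sInf D := by
    refine hr.trans_le (le_csInf hD fun u hu => ?_)
    by_contra! hlt
    exact hu.2 (hc u hu.1 hlt)
  have hbefore : ∀ u, t ≤ u → u < sInf D → obs h ω u = obs h ω t := by
    intro u h1 h2
    by_contra h3
    exact absurd (csInf_le hbd ⟨h1, h3⟩) (not_le.2 h2)
  have hσ : obs h ω (sInf D) ≠ obs h ω t := by
    intro heq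
    obtain ⟨r', hr', hc'⟩ := ω.exists_obs_eq h (sInf D)
    have : r' ≤ sInf D := le_csInf hD fun u hu => by
      by_contra! hlt
      exact hu.2 ((hc' u (csInf_le hbd hu) hlt).trans heq)
    exact absurd hr' (not_lt.2 this)
  refine ⟨sInf D, htσ, csInf_le hbd ⟨hts, hne⟩, (zero_le (a := t)).trans_lt htσ, fun hev => ?_⟩
  have : (𝓝[<] (sInf D)).NeBot := nhdsLT_neBot_of_exists_lt ⟨t, htσ⟩
  obtain ⟨u, hu1, hu2⟩ := (hev.and (Ioo_mem_nhdsLT htσ)).exists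
  exact hσ (hu1.symm.trans (hbefore u hu2.1.le hu2.2))

variable {h : I → O} {ω : CadlagPath I} {n : ℕ}

lemma jumpTime_succ (h : I → O) (n : ℕ) (ω : CadlagPath I) : jumpTime h (n + 1) ω =
    ⨅ (t : ℝ≥0) (_ : IsJump h ω t ∧ jumpTime h n ω < t), (t : ℝ≥0∞) := rfl

lemma jumpTime_succ_le {t : ℝ≥0} (ht : IsJump h ω t) (hn : jumpTime h n ω < t) :
    jumpTime h (n + 1) ω ≤ t := iInf₂_le t ⟨ht, hn⟩

lemma jumpTime_le_succ (h : I → O) (n : ℕ) (ω : CadlagPath I) :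
    jumpTime h n ω ≤ jumpTime h (n + 1) ω := le_iInf₂ fun _ ht => ht.2.le

lemma jumpTime_mono (h : I → O) (ω : CadlagPath I) : Monotone fun n => jumpTime h n ω :=
  monotone_nat_of_le_succ fun n => jumpTime_le_succ h n ω

/-- Jumps do not accumulate from the right. -/
lemma exists_lt_le_of_isJump (h : I → O) (ω : CadlagPath I) (t : ℝ≥0) :
    ∃ r, t < r ∧ ∀ s, IsJump h ω s → t < s → r ≤ s := by
  obtain ⟨r, hr, hc⟩ := ω.exists_obs_eq h t
  refine ⟨r, hr, fun s hs hts => ?_⟩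
  by_contra! hlt
  exact not_isJump_of_forall_obs_eq hc hts hlt hs

lemma jumpTime_lt_succ (hn : jumpTime h n ω < ⊤) : jumpTime h n ω < jumpTime h (n + 1) ω := by
  obtain ⟨t, ht⟩ := exists_coe_eq hn
  obtain ⟨r, hr, hs⟩ := exists_lt_le_of_isJump h ω t
  rw [← ht]
  refine (ENNReal.coe_lt_coe.2 hr).trans_le (le_iInf₂ fun s hs' => ?_)
  rw [← ht] at hs'
  exact ENNReal.coe_le_coe.2 (hs s hs'.1 (ENNReal.coe_lt_coe.1 hs'.2))

lemma isJump_jumpTime_succ {r : ℝ≥0} (hr : jumpTime h (n + 1) ω = r) : IsJump h ω r := by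
  obtain ⟨r', hr', hs⟩ := exists_lt_le_of_isJump h ω r
  have h1 : jumpTime h (n + 1) ω < r' := hr ▸ ENNReal.coe_lt_coe.2 hr'
  simp only [jumpTime_succ, iInf_lt_iff] at h1
  obtain ⟨s, hs1, hs2⟩ := h1
  have h2 : r ≤ s := ENNReal.coe_le_coe.1 (hr ▸ jumpTime_succ_le hs1.1 hs1.2)
  rcases h2.eq_or_lt with rfl | h2
  · exact hs1.1
  · exact absurd (hs s hs1.1 h2) (not_le.2 (ENNReal.coe_lt_coe.1 hs2))

/-- The observation is constant between two successive jump times. -/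
lemma obs_eq_obsAtJump {t : ℝ≥0} (h1 : jumpTime h n ω ≤ t)
    (h2 : (t : ℝ≥0∞) < jumpTime h (n + 1) ω) : obs h ω t = obsAtJump h n ω := by
  have hn : jumpTime h n ω ≠ ⊤ := (h1.trans_lt ENNReal.coe_lt_top).ne
  have hle : (jumpTime h n ω).toNNReal ≤ t := by
    simpa using ENNReal.toNNReal_mono ENNReal.coe_ne_top h1
  by_contra hne
  obtain ⟨r, hr1, hr2, hr3⟩ := exists_isJump_of_obs_ne hle hne
  have : jumpTime h n ω < r := by
    rw [← ENNReal.coe_toNNReal hn]; exact ENNReal.coe_lt_coe.2 hr1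
  exact absurd ((jumpTime_succ_le hr3 this).trans (ENNReal.coe_le_coe.2 hr2)) (not_le.2 h2)

lemma obsAtJump_succ_ne (hn : jumpTime h (n + 1) ω < ⊤) :
    obsAtJump h (n + 1) ω ≠ obsAtJump h n ω := by
  obtain ⟨r, hr⟩ := exists_coe_eq hn
  have hlt : jumpTime h n ω < r :=
    hr ▸ jumpTime_lt_succ ((jumpTime_le_succ h n ω).trans_lt hn)
  obtain ⟨t, ht⟩ := exists_coe_eq (hlt.trans ENNReal.coe_lt_top)
  have hJ := isJump_jumpTime_succ hr.symm
  intro heq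
  apply hJ.2
  rw [← ht] at hlt
  filter_upwards [Ioo_mem_nhdsLT (ENNReal.coe_lt_coe.1 hlt)] with u hu
  rw [obs_eq_obsAtJump (n := n) (ht ▸ ENNReal.coe_le_coe.2 hu.1.le)
    (hr ▸ ENNReal.coe_lt_coe.2 hu.2), ← heq, obsAtJump, ← hr, ENNReal.toNNReal_coe]

lemma jumpTime_succ_eq_add_sojourn (h : I → O) (n : ℕ) (ω : CadlagPath I) :
    jumpTime h (n + 1) ω = jumpTime h n ω + sojourn h (n + 1) ω :=
  (add_tsub_cancel_of_le (jumpTime_le_succ h n ω)).symm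

lemma lt_sojourn_iff {s : ℝ≥0∞} :
    s < sojourn h (n + 1) ω ↔ jumpTime h n ω + s < jumpTime h (n + 1) ω := by
  rw [sojourn, Nat.add_sub_cancel, lt_tsub_iff_left]

lemma sojourn_lt_top (hn : jumpTime h (n + 1) ω < ⊤) : sojourn h (n + 1) ω < ⊤ :=
  tsub_le_self.trans_lt hn

lemma jumpCount_eq {t : ℝ≥0} (h1 : jumpTime h n ω ≤ t) (h2 : (t : ℝ≥0∞) < jumpTime h (n + 1) ω) :
    jumpCount h ω t = n := by
  refine le_antisymm (Nat.sInf_le h2) (le_csInf ⟨n, h2⟩ fun m hm => ?_)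
  by_contra! hlt
  exact absurd ((jumpTime_mono h ω (Nat.succ_le_of_lt hlt)).trans h1) (not_le.2 hm)

/-- The position `X_τ` at a random time, with junk value `X_0` where `τ = ∞`. -/
noncomputable def coordAt (τ : CadlagPath I → ℝ≥0∞) (ω : CadlagPath I) : I :=
  coord (τ ω).toNNReal ω

lemma obsAtJump_eq (h : I → O) (n : ℕ) (ω : CadlagPath I) :
    obsAtJump h n ω = h (coordAt (jumpTime h n) ω) := rfl

/-! ### The filtering process along a path -/

variable [Fintype I] {Λ : Matrix I I ℝ} {νd : O → I → ℝ} {μ : I → ℝ}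

lemma filterProc_eq_flow {t : ℝ≥0} (h1 : jumpTime h n ω ≤ t)
    (h2 : (t : ℝ≥0∞) < jumpTime h (n + 1) ω) :
    filterProc Λ h νd μ ω t =
      flow Λ h (t - (jumpTime h n ω).toReal) (filterAtJump Λ h νd μ ω n) := by
  rw [filterProc, jumpCount_eq h1 h2]

variable [DecidableEq I]

lemma filterAtJump_mem_face (hΛ : IsRateMatrix Λ) (hνd : ∀ a, νd a ∈ face h a)
    (hμ : μ ∈ stdSimplex ℝ I) (hn : jumpTime h n ω < ⊤) :
    filterAtJump Λ h νd μ ω n ∈ face h (obsAtJump h n ω) := by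
  induction n with
  | zero => exact condOp_mem_face hνd fun i _ => hμ.1 i
  | succ n ih =>
    exact condOp_flow_mem_face hΛ hνd (ih ((jumpTime_le_succ h n ω).trans_lt hn))
      (obsAtJump_succ_ne hn) ENNReal.toReal_nonneg

lemma filterProc_jumpTime (hΛ : IsRateMatrix Λ) (hνd : ∀ a, νd a ∈ face h a)
    (hμ : μ ∈ stdSimplex ℝ I) (hn : jumpTime h n ω < ⊤) :
    filterProc Λ h νd μ ω (jumpTime h n ω).toNNReal = filterAtJump Λ h νd μ ω n := by
  have h1 := ENNReal.coe_toNNReal hn.ne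
  rw [filterProc_eq_flow (n := n) h1.ge (h1.symm ▸ jumpTime_lt_succ hn),
    ENNReal.coe_toNNReal_eq_toReal, sub_self, flow_zero hΛ (filterAtJump_mem_face hΛ hνd hμ hn)]

/-- The left limit `Π_{T_{n+1}-}` is the flow run over the whole sojourn time. -/
lemma leftLim_filterProc (hΛ : IsRateMatrix Λ) (hνd : ∀ a, νd a ∈ face h a)
    (hμ : μ ∈ stdSimplex ℝ I) (hn : jumpTime h (n + 1) ω < ⊤) :
    Function.leftLim (filterProc Λ h νd μ ω) (jumpTime h (n + 1) ω).toNNReal =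
      flow Λ h (sojourn h (n + 1) ω).toReal (filterAtJump Λ h νd μ ω n) := by
  have hn0 := (jumpTime_le_succ h n ω).trans_lt hn
  have hlt := jumpTime_lt_succ hn0
  have hx := filterAtJump_mem_face hΛ hνd hμ hn0
  obtain ⟨r, hr⟩ := exists_coe_eq hn
  obtain ⟨t, ht⟩ := exists_coe_eq hn0
  rw [← hr, ← ht] at hlt
  have htr : t < r := ENNReal.coe_lt_coe.1 hlt
  have hS : (sojourn h (n + 1) ω).toReal = r - t := by
    rw [sojourn, Nat.add_sub_cancel, ← hr, ← ht, ENNReal.toReal_sub_of_le hlt.le ENNReal.coe_ne_top]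
    rfl
  rw [hS, ← hr, ENNReal.toNNReal_coe]
  have : (𝓝[<] r).NeBot := nhdsLT_neBot_of_exists_lt ⟨t, htr⟩
  refine leftLim_eq_of_tendsto ?_
  have htend : Tendsto (fun s : ℝ≥0 => (s : ℝ) - t) (𝓝[<] r) (𝓝[Set.Ici 0] ((r : ℝ) - t)) := by
    refine tendsto_nhdsWithin_iff.2 ⟨?_, ?_⟩
    · exact ((NNReal.continuous_coe.sub continuous_const).tendsto r).mono_left nhdsWithin_le_nhds
    · filter_upwards [Ioo_mem_nhdsLT htr] with s hs
      exact sub_nonneg.2 (NNReal.coe_le_coe.2 hs.1.le)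
  have hmem : (0 : ℝ) ≤ (r : ℝ) - t := sub_nonneg.2 (NNReal.coe_le_coe.2 htr.le)
  refine ((continuousOn_flow hΛ hx _ hmem).tendsto.comp htend).congr' ?_
  filter_upwards [Ioo_mem_nhdsLT htr] with s hs
  rw [filterProc_eq_flow (n := n) (ht ▸ ENNReal.coe_le_coe.2 hs.1.le)
    (hr ▸ ENNReal.coe_lt_coe.2 hs.2), ← ht]
  rfl

end Paths

/-! ### Optional times and the strong Markov property -/

section Optional

variable {I : Type*}

lemma natSigma_mono {s t : ℝ≥0} (hst : s ≤ t) : natSigma I s ≤ natSigma I t :=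
  iSup₂_le fun r hr => le_iSup₂_of_le r (hr.trans hst) le_rfl

lemma natSigma_le (t : ℝ≥0) :
    natSigma I t ≤ (inferInstance : MeasurableSpace (CadlagPath I)) :=
  iSup₂_le fun r _ => le_iSup (fun s : ℝ≥0 => MeasurableSpace.comap (coord s) ⊤) r

lemma measurableSet_coord_natSigma {s t : ℝ≥0} (hst : s ≤ t) (A : Set I) :
    MeasurableSet[natSigma I t] {ω | coord s ω ∈ A} := by
  have h1 : MeasurableSpace.comap (coord s) ⊤ ≤ natSigma I t := le_iSup₂_of_le s hst le_rfl
  exact h1 _ ⟨A, MeasurableSpace.measurableSet_top, rfl⟩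

lemma measurableSet_coord (s : ℝ≥0) (A : Set I) :
    MeasurableSet {ω : CadlagPath I | coord s ω ∈ A} :=
  natSigma_le s _ (measurableSet_coord_natSigma le_rfl A)

/-- `τ` is an optional time of the natural filtration: `{τ < t} ∈ ℱ_t` for all `t`. -/
def IsOptional (τ : CadlagPath I → ℝ≥0∞) : Prop :=
  ∀ t : ℝ≥0, MeasurableSet[natSigma I t] {ω | τ ω < t}

/-- `C` belongs to `ℱ_{τ+}`, as far as the event `{τ < ∞}` is concerned. -/
def IsPrior (τ : CadlagPath I → ℝ≥0∞) (C : Set (CadlagPath I)) : Prop :=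
  ∀ t : ℝ≥0, MeasurableSet[natSigma I t] (C ∩ {ω | τ ω < t})

variable {τ σ : CadlagPath I → ℝ≥0∞} {C D : Set (CadlagPath I)}

lemma IsOptional.add_const (hτ : IsOptional τ) (u : ℝ≥0) : IsOptional fun ω => τ ω + u := by
  intro t
  rcases lt_or_ge u t with hut | hut
  · have h1 : {ω | τ ω + u < t} = {ω | τ ω < (t - u : ℝ≥0)} := by
      ext ω
      rw [Set.mem_ofPred_eq, Set.mem_ofPred_eq, ENNReal.coe_sub, lt_tsub_iff_right]
    rw [h1]
    exact natSigma_mono tsub_le_self _ (hτ (t - u))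
  · have h1 : {ω | τ ω + u < t} = ∅ := by
      refine Set.eq_empty_of_forall_notMem fun ω hω => ?_
      exact absurd (le_add_self.trans_lt hω) (not_lt.2 (ENNReal.coe_le_coe.2 hut))
    rw [h1]
    exact @MeasurableSet.empty _ (natSigma I t)

lemma isOptional_min (hτ : IsOptional τ) (hσ : IsOptional σ) :
    IsOptional fun ω => min (τ ω) (σ ω) := by
  intro t
  have h1 : {ω | min (τ ω) (σ ω) < t} = {ω | τ ω < t} ∪ {ω | σ ω < t} := by
    ext ω; exact min_lt_iff (b := τ ω)
  rw [h1]
  exact (hτ t).union (hσ t)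

lemma IsPrior.inter (hC : IsPrior τ C) (hD : IsPrior τ D) : IsPrior τ (C ∩ D) := fun t => by
  rw [Set.inter_inter_distrib_right]
  exact (hC t).inter (hD t)

lemma IsPrior.compl (hτ : IsOptional τ) (hC : IsPrior τ C) : IsPrior τ Cᶜ := fun t => by
  have h1 : Cᶜ ∩ {ω | τ ω < t} = {ω | τ ω < t} \ (C ∩ {ω | τ ω < t}) := by
    ext ω; simp only [Set.mem_inter_iff, Set.mem_compl_iff, Set.mem_sdiff]; tauto
  rw [h1]
  exact (hτ t).diff (hC t)

lemma IsPrior.iUnion {C : ℕ → Set (CadlagPath I)} (hC : ∀ k, IsPrior τ (C k)) :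
    IsPrior τ (⋃ k, C k) := fun t => by
  rw [Set.iUnion_inter]
  exact MeasurableSet.iUnion fun k => hC k t

lemma IsPrior.mono (hC : IsPrior τ C) (hτσ : ∀ ω, τ ω ≤ σ ω) (hσ : IsOptional σ) :
    IsPrior σ C := fun t => by
  have h1 : C ∩ {ω | σ ω < t} = (C ∩ {ω | τ ω < t}) ∩ {ω | σ ω < t} := by
    ext ω
    simp only [Set.mem_inter_iff, Set.mem_ofPred_eq]
    exact ⟨fun hω => ⟨⟨hω.1, (hτσ ω).trans_lt hω.2⟩, hω.2⟩, fun hω => ⟨hω.1.1, hω.2⟩⟩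
  rw [h1]
  exact (hC t).inter (hσ t)

lemma IsPrior.lt_top (hτ : IsOptional τ) : IsPrior τ {ω | τ ω < ⊤} := fun t => by
  have h1 : {ω | τ ω < ⊤} ∩ {ω | τ ω < t} = {ω | τ ω < t} :=
    Set.inter_eq_right.2 fun ω hω => lt_trans hω ENNReal.coe_lt_top
  rw [h1]
  exact hτ t

lemma IsPrior.measurableSet (hC : IsPrior τ C) (hCτ : C ⊆ {ω | τ ω < ⊤}) : MeasurableSet C := by
  have h1 : C = ⋃ k : ℕ, C ∩ {ω | τ ω < ((k : ℝ≥0) : ℝ≥0∞)} := by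
    ext ω
    rw [← Set.inter_iUnion, Set.mem_inter_iff, Set.mem_iUnion, iff_self_and]
    intro hω
    obtain ⟨k, hk⟩ := ENNReal.exists_nat_gt (hCτ hω).ne
    exact ⟨k, by simpa using hk⟩
  rw [h1]
  exact MeasurableSet.iUnion fun k => natSigma_le _ _ (hC k)

lemma IsOptional.measurableSet_lt_top (hτ : IsOptional τ) : MeasurableSet {ω | τ ω < ⊤} :=
  (IsPrior.lt_top hτ).measurableSet subset_rfl

lemma IsOptional.measurable (hτ : IsOptional τ) : Measurable τ := by
  refine measurable_of_Iio fun c => ?_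
  induction c with
  | top => exact hτ.measurableSet_lt_top
  | coe t => exact natSigma_le t _ (hτ t)

/-- The index `k` with `k / (m + 1) ≤ τ < (k + 1) / (m + 1)`. -/
noncomputable def gridIndex (τ : CadlagPath I → ℝ≥0∞) (m : ℕ) (ω : CadlagPath I) : ℕ :=
  ⌊(m + 1 : ℝ≥0) * (τ ω).toNNReal⌋₊

/-- The `k`-th point of the grid, used to approximate from the right. -/
noncomputable def gridPoint (m k : ℕ) : ℝ≥0 := (k + 1) / (m + 1)

lemma gridIndex_spec {ω : CadlagPath I} {m : ℕ} :
    (τ ω).toNNReal < gridPoint m (gridIndex τ m ω) ∧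
      gridPoint m (gridIndex τ m ω) ≤ (τ ω).toNNReal + 1 / (m + 1) := by
  have hm : (0 : ℝ≥0) < m + 1 := by positivity
  constructor
  · rw [gridPoint, lt_div_iff₀ hm, mul_comm]
    exact Nat.lt_floor_add_one _
  · rw [gridPoint, add_div]
    gcongr
    rw [div_le_iff₀ hm, mul_comm]
    exact Nat.floor_le (zero_le (a := _))

lemma tendsto_gridPoint (τ : CadlagPath I → ℝ≥0∞) (ω : CadlagPath I) :
    Tendsto (fun m => gridPoint m (gridIndex τ m ω)) atTop (𝓝[>] (τ ω).toNNReal) := by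
  refine tendsto_nhdsWithin_iff.2 ⟨?_, Eventually.of_forall fun m => gridIndex_spec.1⟩
  refine tendsto_of_tendsto_of_tendsto_of_le_of_le tendsto_const_nhds ?_
    (fun m => gridIndex_spec.1.le) (fun m => gridIndex_spec.2)
  have h1 : Tendsto (fun m : ℕ => 1 / ((m : ℝ≥0) + 1)) atTop (𝓝 0) :=
    tendsto_one_div_add_atTop_nhds_zero_nat
  simpa using h1.const_add (τ ω).toNNReal

lemma eventually_coord_gridPoint_add (τ : CadlagPath I → ℝ≥0∞) (s : ℝ≥0) {ω : CadlagPath I}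
    (hω : τ ω < ⊤) : ∀ᶠ m in atTop,
      coord (gridPoint m (gridIndex τ m ω) + s) ω = coordAt (fun ω => τ ω + s) ω := by
  obtain ⟨r, hr, hs⟩ := ω.exists_coord_eq ((τ ω).toNNReal + s)
  have h1 : (τ ω + s).toNNReal = (τ ω).toNNReal + s := by
    rw [ENNReal.toNNReal_add hω.ne ENNReal.coe_ne_top, ENNReal.toNNReal_coe]
  have h2 : (τ ω).toNNReal < r - s := lt_tsub_iff_right.2 hr
  filter_upwards [(tendsto_gridPoint τ ω).eventually (Ioo_mem_nhdsGT h2)] with m hm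
  rw [coordAt, h1]
  exact hs _ (add_le_add hm.1.le le_rfl) (lt_tsub_iff_right.1 hm.2)

lemma eventually_coord_gridPoint (τ : CadlagPath I → ℝ≥0∞) {ω : CadlagPath I}
    (hω : τ ω < ⊤) : ∀ᶠ m in atTop,
      coord (gridPoint m (gridIndex τ m ω)) ω = coordAt τ ω := by
  simpa using eventually_coord_gridPoint_add τ 0 hω

lemma IsPrior.measurableSet_inter_gridIndex (hτ : IsOptional τ) (hC : IsPrior τ C)
    (hCτ : C ⊆ {ω | τ ω < ⊤}) (m k : ℕ) :
    MeasurableSet[natSigma I (gridPoint m k)] (C ∩ {ω | gridIndex τ m ω = k}) := by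
  have hm : (0 : ℝ≥0) < m + 1 := by positivity
  have hle : (k : ℝ≥0) / (m + 1) ≤ gridPoint m k := by rw [gridPoint]; gcongr; simp
  have h1 : C ∩ {ω | gridIndex τ m ω = k} =
      (C ∩ {ω | τ ω < gridPoint m k}) \ {ω | τ ω < ((k : ℝ≥0) / (m + 1) : ℝ≥0)} := by
    ext ω
    simp only [Set.mem_inter_iff, Set.mem_ofPred_eq, Set.mem_sdiff, and_assoc]
    refine and_congr_right fun hω => ?_
    obtain ⟨t, ht⟩ := exists_coe_eq (hCτ hω)
    rw [← ht, ENNReal.coe_lt_coe, ENNReal.coe_lt_coe, gridIndex, ← ht, ENNReal.toNNReal_coe,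
      Nat.floor_eq_iff (zero_le (a := _)), not_lt, gridPoint, lt_div_iff₀ hm, div_le_iff₀ hm,
      mul_comm t, and_comm]
  rw [h1]
  exact (hC _).diff (natSigma_mono hle _ (hτ _))

/-- The position at an optional time belongs to its past: by right continuity it is the limit of the
positions at the grid points just after `τ`, which are before `t` if the grid is fine enough. -/
lemma isPrior_coordAt (hτ : IsOptional τ) (i : I) : IsPrior τ {ω | coordAt τ ω = i} := by
  intro t
  let A : ℕ → Set (CadlagPath I) := fun m => ⋃ k : ℕ, ⋃ (_ : gridPoint m k < t),
    ({ω | τ ω < ⊤} ∩ {ω | gridIndex τ m ω = k}) ∩ {ω | coord (gridPoint m k) ω ∈ ({i} : Set I)}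
  have hA : ∀ m, MeasurableSet[natSigma I t] (A m) := fun m =>
    MeasurableSet.iUnion fun k => MeasurableSet.iUnion fun hk =>
      (natSigma_mono hk.le _
        ((IsPrior.lt_top hτ).measurableSet_inter_gridIndex hτ subset_rfl m k)).inter
        (measurableSet_coord_natSigma hk.le {i})
  refine @measurableSet_of_tendsto_indicator _ (natSigma I t) _ _ atTop _ _ _ hA fun ω => ?_
  by_cases hω : τ ω < t
  · have hωt : τ ω < ⊤ := hω.trans ENNReal.coe_lt_top
    have h1 : (τ ω).toNNReal < t := by
      rw [← ENNReal.coe_lt_coe, ENNReal.coe_toNNReal hωt.ne]; exact hω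
    filter_upwards [eventually_coord_gridPoint τ hωt,
      (tendsto_gridPoint τ ω).eventually (Ioo_mem_nhdsGT h1)] with m hm1 hm2
    simp only [A, Set.mem_iUnion, Set.mem_inter_iff, Set.mem_ofPred_eq, Set.mem_singleton_iff, hω,
      hωt, true_and, and_true, exists_prop]
    constructor
    · rintro ⟨k, _, rfl, hk⟩; rw [← hm1, hk]
    · intro hi; exact ⟨_, hm2.2, rfl, by rw [hm1, hi]⟩
  · refine Eventually.of_forall fun m => ?_
    simp only [A, Set.mem_iUnion, Set.mem_inter_iff, Set.mem_ofPred_eq, hω, and_false, iff_false]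
    rintro ⟨k, hk, ⟨h1, rfl⟩, -⟩
    refine hω ?_
    rw [← ENNReal.coe_toNNReal h1.ne, ENNReal.coe_lt_coe]
    exact gridIndex_spec.1.trans hk

lemma measureReal_hasSum_fiber {Ω : Type*} [MeasurableSpace Ω] {P : Measure Ω} [IsFiniteMeasure P]
    {D : Set Ω} (f : Ω → ℕ) (hf : ∀ k, MeasurableSet (D ∩ {ω | f ω = k})) :
    HasSum (fun k => P.real (D ∩ {ω | f ω = k})) (P.real D) := by
  have h1 : D = ⋃ k, D ∩ {ω | f ω = k} := by
    ext ω; simp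
  have h2 : P D = ∑' k, P (D ∩ {ω | f ω = k}) := by
    conv_lhs => rw [h1]
    refine measure_iUnion (fun k l hkl => ?_) hf
    refine Set.disjoint_left.2 fun ω hk hl => hkl (hk.2.symm.trans hl.2)
  have h3 : P.real D = ∑' k, P.real (D ∩ {ω | f ω = k}) := by
    rw [measureReal_def, h2, ENNReal.tsum_toReal_eq fun k => measure_ne_top P _]; rfl
  rw [h3]
  refine (ENNReal.summable_toReal ?_).hasSum
  rw [← h2]; exact measure_ne_top P _

variable [Fintype I] [DecidableEq I] {Λ : Matrix I I ℝ} {μ : I → ℝ} {P : Measure (CadlagPath I)}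

/-- The Markov property at a deterministic time, in terms of probabilities. -/
lemma IsMarkovLaw.measureReal_coord_add (hP : IsMarkovLaw Λ μ P) {t : ℝ≥0}
    (hC : MeasurableSet[natSigma I t] C) (s : ℝ≥0) (j : I) :
    P.real (C ∩ {ω | coord (t + s) ω = j}) =
      ∑ i, P.real (C ∩ {ω | coord t ω = i}) * NormedSpace.exp ((s : ℝ) • Λ) i j := by
  have := hP.isProbabilityMeasure
  have hmeas : ∀ (r : ℝ≥0) (i : I), MeasurableSet {ω : CadlagPath I | coord r ω = i} :=
    fun r i => measurableSet_coord r {i}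
  have hC' := natSigma_le t _ hC
  have hsum : ∀ (r : ℝ≥0) (f : I → ℝ), (fun ω : CadlagPath I => f (coord r ω)) =
      fun ω => ∑ i, {ω | coord r ω = i}.indicator (fun _ => f i) ω := by
    intro r f
    ext ω
    rw [Finset.sum_eq_single (coord r ω)]
    · simp
    · intro i _ hi; exact Set.indicator_of_notMem (fun h => hi h.symm) _
    · simp
  have hint : ∀ (r : ℝ≥0) (f : I → ℝ), Integrable (fun ω => f (coord r ω)) P := by
    intro r f
    rw [hsum]
    exact integrable_finsetSum _ fun i _ => (integrable_const _).indicator (hmeas r i)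
  have hval : ∀ (r : ℝ≥0) (f : I → ℝ), ∫ ω in C, f (coord r ω) ∂P =
      ∑ i, P.real (C ∩ {ω | coord r ω = i}) * f i := by
    intro r f
    rw [hsum, integral_finsetSum _ fun i _ =>
      ((integrable_const (f i)).indicator (hmeas r i) : Integrable _ (P.restrict C))]
    refine Finset.sum_congr rfl fun i _ => ?_
    rw [setIntegral_indicator (hmeas r i), setIntegral_const, smul_eq_mul]
  have h1 := setIntegral_condExp (natSigma_le t) (hint (t + s) (Pi.single j 1)) hC
  rw [setIntegral_congr_ae (hC') ((hP.markov t s (Pi.single j 1)).mono fun ω hω _ => hω),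
    hval t fun i => (NormedSpace.exp ((s : ℝ) • Λ) *ᵥ Pi.single j 1) i, hval] at h1
  simp only [Matrix.mulVec_single_one, Matrix.col_apply, Pi.single_apply, mul_ite, mul_one,
    mul_zero, Finset.sum_ite_eq', Finset.mem_univ, if_true] at h1
  exact h1.symm

/-- Strong Markov property at an optional time, over a deterministic time step. -/
lemma IsMarkovLaw.measureReal_coordAt_add (hP : IsMarkovLaw Λ μ P) (hτ : IsOptional τ)
    (hC : IsPrior τ C) (hCτ : C ⊆ {ω | τ ω < ⊤}) (s : ℝ≥0) (j : I) :
    P.real (C ∩ {ω | coordAt (fun ω => τ ω + s) ω = j}) =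
      ∑ i, P.real (C ∩ {ω | coordAt τ ω = i}) * NormedSpace.exp ((s : ℝ) • Λ) i j := by
  have := hP.isProbabilityMeasure
  have hmk := hC.measurableSet_inter_gridIndex hτ hCτ
  have hcomm : ∀ (m k : ℕ) (s : ℝ≥0) (i : I),
      (C ∩ {ω | coord (gridPoint m (gridIndex τ m ω) + s) ω = i}) ∩ {ω | gridIndex τ m ω = k} =
      (C ∩ {ω | gridIndex τ m ω = k}) ∩ {ω | coord (gridPoint m k + s) ω = i} := by
    intro m k s i
    ext ω
    simp only [Set.mem_inter_iff, Set.mem_ofPred_eq]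
    constructor
    · rintro ⟨⟨h1, h2⟩, rfl⟩; exact ⟨⟨h1, rfl⟩, h2⟩
    · rintro ⟨⟨h1, rfl⟩, h2⟩; exact ⟨⟨h1, h2⟩, rfl⟩
  have hmeask : ∀ (m k : ℕ) (s : ℝ≥0) (i : I), MeasurableSet
      ((C ∩ {ω | coord (gridPoint m (gridIndex τ m ω) + s) ω = i}) ∩
        {ω | gridIndex τ m ω = k}) := by
    intro m k s i
    rw [hcomm]
    exact (natSigma_le _ _ (hmk m k)).inter (measurableSet_coord _ {i})
  have hmeas : ∀ (m : ℕ) (s : ℝ≥0) (i : I), MeasurableSet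
      (C ∩ {ω | coord (gridPoint m (gridIndex τ m ω) + s) ω = i}) := by
    intro m s i
    have h1 : (C ∩ {ω | coord (gridPoint m (gridIndex τ m ω) + s) ω = i}) =
        ⋃ k, (C ∩ {ω | coord (gridPoint m (gridIndex τ m ω) + s) ω = i}) ∩
          {ω | gridIndex τ m ω = k} := by
      ext ω; simp
    rw [h1]
    exact MeasurableSet.iUnion fun k => hmeask m k s i
  have hstep : ∀ m : ℕ, P.real (C ∩ {ω | coord (gridPoint m (gridIndex τ m ω) + s) ω = j}) =
      ∑ i, P.real (C ∩ {ω | coord (gridPoint m (gridIndex τ m ω) + 0) ω = i}) *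
        NormedSpace.exp ((s : ℝ) • Λ) i j := by
    intro m
    refine (measureReal_hasSum_fiber (gridIndex τ m) (hmeask m · s j)).unique ?_
    have h1 : HasSum (fun k => ∑ i, P.real
        ((C ∩ {ω | coord (gridPoint m (gridIndex τ m ω) + 0) ω = i}) ∩
          {ω | gridIndex τ m ω = k}) * NormedSpace.exp ((s : ℝ) • Λ) i j)
        (∑ i, P.real (C ∩ {ω | coord (gridPoint m (gridIndex τ m ω) + 0) ω = i}) *
          NormedSpace.exp ((s : ℝ) • Λ) i j) :=
      hasSum_sum fun i _ =>
        (measureReal_hasSum_fiber (gridIndex τ m) (hmeask m · 0 i)).mul_right _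
    refine h1.congr_fun fun k => ?_
    rw [hcomm, hP.measureReal_coord_add (hmk m k)]
    refine Finset.sum_congr rfl fun i _ => ?_
    rw [hcomm, add_zero]
  have hlim : ∀ (s : ℝ≥0) (i : I), Tendsto
      (fun m => P.real (C ∩ {ω | coord (gridPoint m (gridIndex τ m ω) + s) ω = i})) atTop
      (𝓝 (P.real (C ∩ {ω | coordAt (fun ω => τ ω + s) ω = i}))) := by
    intro s i
    refine (ENNReal.tendsto_toReal (measure_ne_top P _)).comp
      (tendsto_measure_of_tendsto_indicator_of_isFiniteMeasure atTop P (hmeas · s i) fun ω => ?_)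
    by_cases hω : ω ∈ C
    · filter_upwards [eventually_coord_gridPoint_add τ s (hCτ hω)] with m hm
      simp only [Set.mem_inter_iff, Set.mem_ofPred_eq, hm]
    · exact Eventually.of_forall fun m => by simp [hω]
  refine tendsto_nhds_unique (hlim s j) ?_
  simp only [hstep]
  refine tendsto_finsetSum _ fun i _ => Tendsto.mul_const _ ?_
  simpa using hlim 0 i

end Optional

/-! ### The jump times are optional -/

section JumpOptional

variable {I O : Type*}

/-- The strict inequality `T_{n+1} < t` is witnessed at a rational time, because a new value of `Y`
is kept for a while. -/
lemma jumpTime_succ_lt_iff (h : I → O) (n : ℕ) (ω : CadlagPath I) (t : ℝ≥0) :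
    jumpTime h (n + 1) ω < t ↔ ∃ q : ℚ, Real.toNNReal q < t ∧
      jumpTime h n ω < Real.toNNReal q ∧ obs h ω (Real.toNNReal q) ≠ obsAtJump h n ω := by
  constructor
  · intro hlt
    have hn1 : jumpTime h (n + 1) ω < ⊤ := hlt.trans ENNReal.coe_lt_top
    have hn := jumpTime_lt_succ ((jumpTime_le_succ h n ω).trans_lt hn1)
    obtain ⟨r, hr⟩ := exists_coe_eq hn1
    obtain ⟨r', hr', hc⟩ := ω.exists_obs_eq h r
    rw [← hr, ENNReal.coe_lt_coe] at hlt
    obtain ⟨q, -, hq1, hq2⟩ := (NNReal.lt_iff_exists_rat_btwn r (min r' t)).1 (lt_min hr' hlt)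
    refine ⟨q, hq2.trans_le (min_le_right _ _), ?_, ?_⟩
    · rw [← hr] at hn
      exact hn.trans (ENNReal.coe_lt_coe.2 hq1)
    · rw [hc _ hq1.le (hq2.trans_le (min_le_left _ _))]
      have h1 := obsAtJump_succ_ne hn1
      rwa [obsAtJump, ← hr, ENNReal.toNNReal_coe] at h1
  · rintro ⟨q, hqt, hq, hne⟩
    have hn : jumpTime h n ω < ⊤ := hq.trans ENNReal.coe_lt_top
    obtain ⟨u, hu⟩ := exists_coe_eq hn
    rw [obsAtJump, ← hu, ENNReal.toNNReal_coe] at hne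
    rw [← hu, ENNReal.coe_lt_coe] at hq
    obtain ⟨r, hr1, hr2, hr3⟩ := exists_isJump_of_obs_ne hq.le hne
    exact (jumpTime_succ_le hr3 (hu ▸ ENNReal.coe_lt_coe.2 hr1)).trans_lt
      (ENNReal.coe_lt_coe.2 (hr2.trans_lt hqt))

lemma isOptional_jumpTime [Countable I] (h : I → O) (n : ℕ) :
    IsOptional (jumpTime h n : CadlagPath I → ℝ≥0∞) := by
  induction n with
  | zero =>
    intro t
    exact @MeasurableSet.const _ (natSigma I t) ((0 : ℝ≥0∞) < t)
  | succ n ih =>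
    intro t
    have h1 : {ω : CadlagPath I | jumpTime h (n + 1) ω < t} =
        ⋃ q : ℚ, ⋃ (_ : Real.toNNReal q < t), ⋃ i : I,
          ({ω | coordAt (jumpTime h n) ω = i} ∩ {ω | jumpTime h n ω < Real.toNNReal q}) ∩
            {ω | coord (Real.toNNReal q) ω ∈ {j | h j ≠ h i}} := by
      ext ω
      simp only [Set.mem_ofPred_eq, jumpTime_succ_lt_iff h n ω t, Set.mem_iUnion,
        Set.mem_inter_iff, exists_prop]
      refine exists_congr fun q => and_congr_right fun _ => ?_
      constructor
      · rintro ⟨h1, h2⟩; exact ⟨_, ⟨rfl, h1⟩, h2⟩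
      · rintro ⟨_, ⟨rfl, h1⟩, h2⟩; exact ⟨h1, h2⟩
    rw [h1]
    refine MeasurableSet.iUnion fun q => MeasurableSet.iUnion fun hq =>
      MeasurableSet.iUnion fun i => MeasurableSet.inter ?_ (measurableSet_coord_natSigma hq.le _)
    exact natSigma_mono hq.le _ (isPrior_coordAt ih i _)

/-- The σ-algebra of the events which are prior to an optional time. -/
@[reducible]
def priorSigma {τ : CadlagPath I → ℝ≥0∞} (hτ : IsOptional τ) : MeasurableSpace (CadlagPath I) where
  MeasurableSet' := IsPrior τ
  measurableSet_empty := fun t => by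
    rw [Set.empty_inter]; exact @MeasurableSet.empty _ (natSigma I t)
  measurableSet_compl := fun _ hC => hC.compl hτ
  measurableSet_iUnion := fun _ hC => IsPrior.iUnion hC

lemma IsOptional.isPrior_lt {τ : CadlagPath I → ℝ≥0∞} (hτ : IsOptional τ) (c : ℝ≥0∞) :
    IsPrior τ {ω | τ ω < c} := by
  induction c with
  | top => exact IsPrior.lt_top hτ
  | coe c =>
    intro t
    have h1 : {ω | τ ω < c} ∩ {ω | τ ω < t} = {ω | τ ω < (min c t : ℝ≥0)} := by
      ext ω
      rw [ENNReal.coe_min]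
      exact (lt_min_iff (a := τ ω)).symm
    rw [h1]
    exact natSigma_mono (min_le_right _ _) _ (hτ _)

lemma obsAtJump?_eq_none_iff {h : I → O} {n : ℕ} {ω : CadlagPath I} :
    obsAtJump? h n ω = none ↔ ¬ jumpTime h n ω < ⊤ := by
  unfold obsAtJump?; split_ifs with h1 <;> simp [h1]

lemma obsAtJump?_eq_some_iff {h : I → O} {n : ℕ} {ω : CadlagPath I} {b : O} :
    obsAtJump? h n ω = some b ↔ jumpTime h n ω < ⊤ ∧ obsAtJump h n ω = b := by
  unfold obsAtJump?; split_ifs with h1 <;> simp [h1]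

lemma isPrior_obsAtJump [Countable I] (h : I → O) (n : ℕ) (b : O) :
    IsPrior (jumpTime h n) {ω : CadlagPath I | obsAtJump h n ω = b} := by
  have h1 : {ω : CadlagPath I | obsAtJump h n ω = b} =
      ⋃ i : I, ⋃ (_ : h i = b), {ω | coordAt (jumpTime h n) ω = i} := by
    ext ω; simp [obsAtJump_eq]
  rw [h1]
  refine @MeasurableSet.iUnion _ _ (priorSigma (isOptional_jumpTime h n)) _ _ fun i =>
    @MeasurableSet.iUnion _ _ (priorSigma (isOptional_jumpTime h n)) _ _ fun _ => ?_
  exact isPrior_coordAt (isOptional_jumpTime h n) i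

/-- The observed history up to `T_n` is part of the past of the optional time `T_n`. -/
lemma pastSigma_le_priorSigma [Countable I] [Countable O] (h : I → O) (n : ℕ) :
    pastSigma h n ≤ priorSigma (isOptional_jumpTime (I := I) h n) := by
  have hmono : ∀ k ≤ n, ∀ C, IsPrior (jumpTime h k) C → IsPrior (jumpTime (I := I) h n) C :=
    fun k hk C hC => hC.mono (fun ω => jumpTime_mono h ω hk) (isOptional_jumpTime h n)
  refine iSup₂_le fun k hk => sup_le ?_ ?_
  · refine Measurable.comap_le ?_
    exact @measurable_of_Iio _ _ _ _ _ (priorSigma (isOptional_jumpTime (I := I) h n)) _ _ _ _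
      fun c => hmono k hk _ ((isOptional_jumpTime h k).isPrior_lt c)
  · have h1 : @Measurable _ _ (priorSigma (isOptional_jumpTime (I := I) h n)) ⊤
        (obsAtJump? h k : CadlagPath I → Option O) := by
      refine @measurable_to_countable' _ _ ⊤ _ (priorSigma (isOptional_jumpTime (I := I) h n)) _
        fun y => hmono k hk _ ?_
      cases y with
      | none =>
        have h2 : obsAtJump? h k ⁻¹' {none} = {ω : CadlagPath I | jumpTime h k ω < ⊤}ᶜ := by
          ext ω; exact obsAtJump?_eq_none_iff
        rw [h2]
        exact (IsPrior.lt_top (isOptional_jumpTime h k)).compl (isOptional_jumpTime h k)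
      | some b =>
        have h2 : obsAtJump? h k ⁻¹' {some b} =
            {ω : CadlagPath I | jumpTime h k ω < ⊤} ∩ {ω | obsAtJump h k ω = b} := by
          ext ω; exact obsAtJump?_eq_some_iff
        rw [h2]
        exact (IsPrior.lt_top (isOptional_jumpTime h k)).inter (isPrior_obsAtJump h k b)
    exact h1.comap_le

lemma measurable_jumpTime [Countable I] (h : I → O) (n : ℕ) :
    Measurable (jumpTime h n : CadlagPath I → ℝ≥0∞) := (isOptional_jumpTime h n).measurable

lemma measurableSet_coordAt_jumpTime [Countable I] (h : I → O) (n : ℕ) (A : Set I) :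
    MeasurableSet {ω : CadlagPath I | jumpTime h n ω < ⊤ ∧ coordAt (jumpTime h n) ω ∈ A} := by
  have h1 : {ω : CadlagPath I | jumpTime h n ω < ⊤ ∧ coordAt (jumpTime h n) ω ∈ A} =
      ⋃ i : I, ⋃ (_ : i ∈ A),
        {ω | jumpTime h n ω < ⊤} ∩ {ω | coordAt (jumpTime h n) ω = i} := by
    ext ω; simp [and_comm]
  rw [h1]
  refine MeasurableSet.iUnion fun i => MeasurableSet.iUnion fun _ => ?_
  exact ((IsPrior.lt_top (isOptional_jumpTime h n)).inter
    (isPrior_coordAt (isOptional_jumpTime h n) i)).measurableSet Set.inter_subset_left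

end JumpOptional

/-! ### Freezing the chain on leaving a class -/

section Frozen

variable {I O : Type*}

open Classical in
/-- The sequence `x` frozen at the first index at which it lies outside `h⁻¹(a)`. -/
noncomputable def frozen (h : I → O) (a : O) (x : ℕ → I) : ℕ → I
  | 0 => x 0
  | k + 1 => if h (frozen h a x k) = a then x (k + 1) else frozen h a x k

lemma frozen_succ_of_eq {h : I → O} {a : O} {x : ℕ → I} {k : ℕ} (hk : h (frozen h a x k) = a) :
    frozen h a x (k + 1) = x (k + 1) := if_pos hk

lemma frozen_succ_of_ne {h : I → O} {a : O} {x : ℕ → I} {k : ℕ} (hk : h (frozen h a x k) ≠ a) :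
    frozen h a x (k + 1) = frozen h a x k := if_neg hk

lemma frozen_eq_of_mem {h : I → O} {a : O} {x : ℕ → I} {k : ℕ} (hk : h (frozen h a x k) = a) :
    frozen h a x k = x k := by
  cases k with
  | zero => rfl
  | succ k =>
    by_cases h1 : h (frozen h a x k) = a
    · exact frozen_succ_of_eq h1
    · rw [frozen_succ_of_ne h1] at hk; exact absurd hk h1

lemma frozen_eq_of_forall_lt {h : I → O} {a : O} {x : ℕ → I} {k : ℕ}
    (hx : ∀ l < k, h (x l) = a) : frozen h a x k = x k := by
  induction k with
  | zero => rfl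
  | succ k ih =>
    have h1 := ih fun l hl => hx l (hl.trans k.lt_succ_self)
    exact frozen_succ_of_eq (h1 ▸ hx k k.lt_succ_self)

lemma frozen_eq_of_le {h : I → O} {a : O} {x : ℕ → I} {k l : ℕ} (hk : h (frozen h a x k) ≠ a)
    (hkl : k ≤ l) : frozen h a x l = frozen h a x k := by
  induction l, hkl using Nat.le_induction with
  | base => rfl
  | succ l _ ih => rw [frozen_succ_of_ne (ih ▸ hk), ih]

/-- The chain sampled at the times `τ + k ε` and frozen on leaving `h⁻¹(a)`. -/
noncomputable def frozenChain (h : I → O) (a : O) (τ : CadlagPath I → ℝ≥0∞) (ε : ℝ≥0) (k : ℕ)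
    (ω : CadlagPath I) : I :=
  frozen h a (fun k => coordAt (fun ω => τ ω + (k * ε : ℝ≥0)) ω) k

/-- As the mesh tends to zero, the frozen chain reaches the position at `(T_n + s) ∧ T_{n+1}`. -/
lemma eventually_frozenChain_eq (h : I → O) {n : ℕ} {ω : CadlagPath I}
    (hn : jumpTime h n ω < ⊤) (s : ℝ≥0) :
    ∀ᶠ N : ℕ in atTop, frozenChain h (obsAtJump h n ω) (jumpTime h n) (s / (N + 1 : ℕ)) (N + 1) ω =
      coordAt (fun ω => min (jumpTime h n ω + s) (jumpTime h (n + 1) ω)) ω := by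
  obtain ⟨t, ht⟩ := exists_coe_eq hn
  have hx : ∀ u : ℝ≥0, coordAt (fun ω => jumpTime h n ω + u) ω = coord (t + u) ω := by
    intro u
    rw [coordAt, ← ht, ← ENNReal.coe_add, ENNReal.toNNReal_coe]
  have hfr : ∀ (ε : ℝ≥0) (k : ℕ), frozenChain h (obsAtJump h n ω) (jumpTime h n) ε k ω =
      frozen h (obsAtJump h n ω) (fun k => coord (t + k * ε) ω) k := by
    intro ε k
    simp only [frozenChain, hx]
  have hend : ∀ N : ℕ, ((N + 1 : ℕ) : ℝ≥0) * (s / (N + 1 : ℕ)) = s := fun N => by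
    field_simp
  have hbefore : ∀ u : ℝ≥0, ((t + u : ℝ≥0) : ℝ≥0∞) < jumpTime h (n + 1) ω →
      h (coord (t + u) ω) = obsAtJump h n ω := fun u hu =>
    obs_eq_obsAtJump (ht ▸ ENNReal.coe_le_coe.2 le_self_add) hu
  simp only [hfr]
  rcases lt_or_ge (jumpTime h n ω + s) (jumpTime h (n + 1) ω) with hs | hs
  · refine Eventually.of_forall fun N => ?_
    rw [frozen_eq_of_forall_lt, hend, coordAt, min_eq_left hs.le, ← ht, ← ENNReal.coe_add,
      ENNReal.toNNReal_coe]
    intro l hl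
    refine hbefore _ (lt_of_le_of_lt ?_ hs)
    rw [← ht, ← ENNReal.coe_add, ENNReal.coe_le_coe]
    calc t + l * (s / (N + 1 : ℕ)) ≤ t + (N + 1 : ℕ) * (s / (N + 1 : ℕ)) := by gcongr
      _ = t + s := by rw [hend]
  · have hn1 : jumpTime h (n + 1) ω < ⊤ :=
      hs.trans_lt (ht ▸ ENNReal.coe_lt_top.trans_le' (ENNReal.coe_add t s).ge)
    obtain ⟨r, hr⟩ := exists_coe_eq hn1
    obtain ⟨r', hr', hc⟩ := ω.exists_coord_eq r
    have htend0 : Tendsto (fun N : ℕ => s / (N : ℝ≥0)) atTop (𝓝 0) :=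
      NNReal.tendsto_coe.1 (by simpa using tendsto_const_div_atTop_nhds_zero_nat (s : ℝ))
    have htend : Tendsto (fun N : ℕ => s / ((N + 1 : ℕ) : ℝ≥0)) atTop (𝓝 0) :=
      htend0.comp (tendsto_add_atTop_nat 1)
    have hr0 : (0 : ℝ≥0) < r' - r := tsub_pos_of_lt hr'
    filter_upwards [htend.eventually (gt_mem_nhds hr0)] with N hN
    have hr1 : r ≤ t + (N + 1 : ℕ) * (s / (N + 1 : ℕ)) := by
      rw [hend, ← ENNReal.coe_le_coe, hr, ENNReal.coe_add, ht]; exact hs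
    set ε : ℝ≥0 := s / (N + 1 : ℕ) with hε
    have hlt := jumpTime_lt_succ hn
    rw [← ht, ← hr, ENNReal.coe_lt_coe] at hlt
    classical
    -- the first sampling time after the jump
    have hex : ∃ k : ℕ, r ≤ t + k * ε := ⟨_, hr1⟩
    set k := Nat.find hex with hk
    have hk1 : r ≤ t + k * ε := Nat.find_spec hex
    have hk2 : k ≤ N + 1 := Nat.find_min' hex hr1
    have hk3 : ∀ l < k, t + l * ε < r := fun l hl => not_le.1 (Nat.find_min hex hl)
    have hk0 : k ≠ 0 := by
      intro h0
      rw [h0, Nat.cast_zero, zero_mul, add_zero] at hk1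
      exact absurd hlt (not_lt.2 hk1)
    obtain ⟨l, hl⟩ := Nat.exists_eq_succ_of_ne_zero hk0
    have hk4 : t + k * ε < r' := by
      have h1 := hk3 l (hl ▸ l.lt_succ_self)
      calc t + k * ε = (t + l * ε) + ε := by rw [hl]; push_cast; ring
        _ < r + (r' - r) := add_lt_add h1 hN
        _ = r' := add_tsub_cancel_of_le hr'.le
    have hxk : coord (t + k * ε) ω = coord r ω := hc _ hk1 hk4
    have hfk : frozen h (obsAtJump h n ω) (fun k => coord (t + k * ε) ω) k = coord r ω := by
      rw [frozen_eq_of_forall_lt fun l hl => ?_]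
      · exact hxk
      · exact hbefore _ (hr ▸ ENNReal.coe_lt_coe.2 (hk3 l hl))
    have hne : h (coord r ω) ≠ obsAtJump h n ω := by
      have h1 := obsAtJump_succ_ne hn1
      rwa [obsAtJump, ← hr, ENNReal.toNNReal_coe] at h1
    rw [frozen_eq_of_le (hfk ▸ hne) hk2, hfk, coordAt, min_eq_right hs, ← hr, ENNReal.toNNReal_coe]

variable {τ : CadlagPath I → ℝ≥0∞} {C : Set (CadlagPath I)} {h : I → O} {a : O}

lemma IsOptional.add_mul (hτ : IsOptional τ) (ε : ℝ≥0) (k : ℕ) :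
    IsOptional fun ω => τ ω + (k * ε : ℝ≥0) := hτ.add_const _

lemma frozenChain_succ_inter_of_eq {ε : ℝ≥0} {k : ℕ} {i : I} (hi : h i = a) (j : I) :
    {ω | frozenChain h a τ ε (k + 1) ω = j} ∩ {ω | frozenChain h a τ ε k ω = i} =
      {ω | frozenChain h a τ ε k ω = i} ∩
        {ω | coordAt (fun ω => τ ω + ((k + 1 : ℕ) * ε : ℝ≥0)) ω = j} := by
  ext ω
  rw [Set.inter_comm]
  refine and_congr_right fun hω => ?_
  have h1 : h (frozenChain h a τ ε k ω) = a := by rw [hω, hi]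
  exact Eq.congr_left (frozen_succ_of_eq h1)

lemma frozenChain_succ_inter_of_ne {ε : ℝ≥0} {k : ℕ} {i : I} (hi : h i ≠ a) (j : I) :
    {ω | frozenChain h a τ ε (k + 1) ω = j} ∩ {ω | frozenChain h a τ ε k ω = i} =
      {ω | frozenChain h a τ ε k ω = i} ∩ {_ω | i = j} := by
  ext ω
  rw [Set.inter_comm]
  refine and_congr_right fun hω => ?_
  have h1 : h (frozenChain h a τ ε k ω) ≠ a := by rw [hω]; exact hi
  have h2 : frozenChain h a τ ε (k + 1) ω = i := (frozen_succ_of_ne h1).trans hω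
  exact Eq.congr_left h2

lemma subset_add_lt_top (hCτ : C ⊆ {ω | τ ω < ⊤}) (D : Set (CadlagPath I)) (u : ℝ≥0) :
    C ∩ D ⊆ {ω | τ ω + u < ⊤} :=
  fun _ hω => ENNReal.add_lt_top.2 ⟨hCτ hω.1, ENNReal.coe_lt_top⟩

lemma measure_eq_sum_fiber {Ω ι : Type*} [Fintype ι] [MeasurableSpace Ω] (P : Measure Ω)
    {D : Set Ω} (f : Ω → ι) (hf : ∀ i, MeasurableSet (D ∩ {ω | f ω = i})) :
    P D = ∑ i, P (D ∩ {ω | f ω = i}) := by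
  have h1 : D = ⋃ i, D ∩ {ω | f ω = i} := by
    ext ω; simp
  conv_lhs => rw [h1]
  rw [measure_iUnion (fun k l hkl => ?_) hf, tsum_fintype]
  exact Set.disjoint_left.2 fun ω hk hl => hkl (hk.2.symm.trans hl.2)

lemma measureReal_eq_sum_fiber {Ω ι : Type*} [Fintype ι] [MeasurableSpace Ω] {P : Measure Ω}
    [IsFiniteMeasure P] {D : Set Ω} (f : Ω → ι)
    (hf : ∀ i, MeasurableSet (D ∩ {ω | f ω = i})) :
    P.real D = ∑ i, P.real (D ∩ {ω | f ω = i}) := by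
  rw [measureReal_def, measure_eq_sum_fiber P f hf,
    ENNReal.toReal_sum fun i _ => measure_ne_top P _]
  rfl

variable [Fintype I]

lemma isPrior_frozenChain (hτ : IsOptional τ) (ε : ℝ≥0) (k : ℕ) (j : I) :
    IsPrior (fun ω => τ ω + (k * ε : ℝ≥0)) {ω | frozenChain h a τ ε k ω = j} := by
  induction k generalizing j with
  | zero => exact isPrior_coordAt (hτ.add_mul ε 0) j
  | succ k ih =>
    have hopt := hτ.add_mul ε (k + 1)
    have hmono : ∀ i, IsPrior (fun ω => τ ω + ((k + 1 : ℕ) * ε : ℝ≥0))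
        {ω | frozenChain h a τ ε k ω = i} := fun i =>
      (ih i).mono (fun ω => by gcongr; exact k.le_succ) hopt
    have h1 : {ω | frozenChain h a τ ε (k + 1) ω = j} =
        ⋃ i, {ω | frozenChain h a τ ε (k + 1) ω = j} ∩ {ω | frozenChain h a τ ε k ω = i} := by
      ext ω; simp
    rw [h1]
    refine @MeasurableSet.iUnion _ _ (priorSigma hopt) _ _ fun i => ?_
    by_cases hi : h i = a
    · rw [frozenChain_succ_inter_of_eq hi]
      exact (hmono i).inter (isPrior_coordAt hopt j)
    · rw [frozenChain_succ_inter_of_ne hi]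
      exact (hmono i).inter (@MeasurableSet.const _ (priorSigma hopt) (i = j))

lemma IsPrior.inter_frozenChain (hτ : IsOptional τ) (hC : IsPrior τ C) (ε : ℝ≥0) (k : ℕ) (j : I) :
    IsPrior (fun ω => τ ω + (k * ε : ℝ≥0)) (C ∩ {ω | frozenChain h a τ ε k ω = j}) :=
  (hC.mono (fun _ => le_self_add) (hτ.add_mul ε k)).inter (isPrior_frozenChain hτ ε k j)

variable [DecidableEq I] {Λ : Matrix I I ℝ} {μ : I → ℝ} {P : Measure (CadlagPath I)}

/-- The transition matrix of the chain sampled with mesh `ε` and frozen on leaving `h⁻¹(a)`. -/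
noncomputable def frozenKernel (Λ : Matrix I I ℝ) (h : I → O) (a : O) (ε : ℝ) : Matrix I I ℝ :=
  diagonal (classInd h a) * NormedSpace.exp (ε • Λ) + diagonal (1 - classInd h a)

lemma frozenKernel_of_eq {ε : ℝ} {i : I} (hi : h i = a) (j : I) :
    frozenKernel Λ h a ε i j = NormedSpace.exp (ε • Λ) i j := by
  rw [frozenKernel, Matrix.add_apply, diagonal_mul, classInd_of_eq hi, one_mul, diagonal_apply,
    Pi.sub_apply, classInd_of_eq hi]
  simp

lemma frozenKernel_of_ne {ε : ℝ} {i : I} (hi : h i ≠ a) (j : I) :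
    frozenKernel Λ h a ε i j = if i = j then 1 else 0 := by
  rw [frozenKernel, Matrix.add_apply, diagonal_mul, classInd_of_ne hi, zero_mul, diagonal_apply,
    Pi.sub_apply, classInd_of_ne hi]
  simp

/-- One step of the frozen chain: the strong Markov property at `τ + k ε` inside the class, and
nothing outside of it. -/
lemma IsMarkovLaw.measureReal_frozenChain_succ (hP : IsMarkovLaw Λ μ P) (hτ : IsOptional τ)
    (hC : IsPrior τ C) (hCτ : C ⊆ {ω | τ ω < ⊤}) (h : I → O) (a : O) (ε : ℝ≥0) (k : ℕ) (j : I) :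
    P.real (C ∩ {ω | frozenChain h a τ ε (k + 1) ω = j}) =
      ∑ i, P.real (C ∩ {ω | frozenChain h a τ ε k ω = i}) * frozenKernel Λ h a ε i j := by
  have := hP.isProbabilityMeasure
  have hprior := fun k j => hC.inter_frozenChain (h := h) (a := a) hτ ε k j
  have hmeas : ∀ k j, MeasurableSet (C ∩ {ω | frozenChain h a τ ε k ω = j}) := fun k j =>
    (hprior k j).measurableSet (subset_add_lt_top hCτ _ _)
  rw [measureReal_eq_sum_fiber (frozenChain h a τ ε k) fun i => ?_]
  · refine Finset.sum_congr rfl fun i _ => ?_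
    rw [Set.inter_assoc]
    by_cases hi : h i = a
    · have hsucc : (fun ω => τ ω + ((k + 1 : ℕ) * ε : ℝ≥0)) =
          fun ω => (τ ω + (k * ε : ℝ≥0)) + ε := by
        ext ω
        rw [add_assoc, ← ENNReal.coe_add]
        congr 2
        push_cast
        ring
      rw [frozenChain_succ_inter_of_eq hi, frozenKernel_of_eq hi, ← Set.inter_assoc, hsucc,
        hP.measureReal_coordAt_add (hτ.add_mul ε k) (hprior k i) (subset_add_lt_top hCτ _ _),
        Finset.sum_eq_single i]
      · congr 2
        refine Set.inter_eq_left.2 fun ω hω => ?_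
        have h1 : h (frozenChain h a τ ε k ω) = a := by rw [hω.2, hi]
        exact (frozen_eq_of_mem h1).symm.trans hω.2
      · intro i' _ hi'
        have h2 : (C ∩ {ω | frozenChain h a τ ε k ω = i}) ∩
            {ω | coordAt (fun ω => τ ω + (k * ε : ℝ≥0)) ω = i'} = ∅ := by
          refine Set.eq_empty_of_forall_notMem fun ω hω => hi' ?_
          have h1 : h (frozenChain h a τ ε k ω) = a := by rw [hω.1.2, hi]
          exact hω.2.symm.trans ((frozen_eq_of_mem h1).symm.trans hω.1.2)
        rw [h2, measureReal_empty, zero_mul]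
      · simp
    · rw [frozenChain_succ_inter_of_ne hi, frozenKernel_of_ne hi]
      by_cases hij : i = j <;> simp [hij]
  · rw [Set.inter_right_comm]
    rw [Set.inter_assoc, Set.inter_comm {ω | frozenChain h a τ ε k ω = i}]
    have h1 := (hmeas (k + 1) j).inter (hmeas k i)
    rwa [← Set.inter_inter_distrib_left] at h1

lemma IsMarkovLaw.measureReal_frozenChain (hP : IsMarkovLaw Λ μ P) (hτ : IsOptional τ)
    (hC : IsPrior τ C) (hCτ : C ⊆ {ω | τ ω < ⊤}) (h : I → O) (a : O) (ε : ℝ≥0) (k : ℕ) (j : I) :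
    P.real (C ∩ {ω | frozenChain h a τ ε k ω = j}) =
      ∑ i, P.real (C ∩ {ω | coordAt τ ω = i}) * (frozenKernel Λ h a ε ^ k) i j := by
  induction k generalizing j with
  | zero =>
    have h1 : ∀ ω, frozenChain h a τ ε 0 ω = coordAt τ ω := fun ω => by
      simp [frozenChain, frozen, coordAt]
    simp only [h1, pow_zero, Matrix.one_apply]
    simp
  | succ k ih =>
    rw [hP.measureReal_frozenChain_succ hτ hC hCτ]
    simp only [ih, pow_succ, Matrix.mul_apply, Finset.mul_sum, Finset.sum_mul]
    rw [Finset.sum_comm]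
    simp only [mul_assoc]

/-- Conditionally on the past of `T_n`, the position at `(T_n + s) ∧ T_{n+1}` is distributed
according to the stopped semigroup started at `X_{T_n}`. -/
theorem IsMarkovLaw.measureReal_stopped (hP : IsMarkovLaw Λ μ P) {n : ℕ}
    (hC : IsPrior (jumpTime h n) C)
    (hCn : C ⊆ {ω | jumpTime h n ω < ⊤ ∧ obsAtJump h n ω = a}) (s : ℝ≥0) (j : I) :
    P.real (C ∩ {ω | coordAt
        (fun ω => min (jumpTime h n ω + s) (jumpTime h (n + 1) ω)) ω = j}) =
      ∑ i, P.real (C ∩ {ω | coordAt (jumpTime h n) ω = i}) *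
        NormedSpace.exp ((s : ℝ) • stoppedGen Λ h a) i j := by
  have := hP.isProbabilityMeasure
  have hτ := isOptional_jumpTime (I := I) h n
  have hCτ : C ⊆ {ω | jumpTime h n ω < ⊤} := fun ω hω => (hCn hω).1
  have hlim1 : Tendsto (fun N : ℕ => P.real (C ∩ {ω | frozenChain h a (jumpTime h n)
      (s / (N + 1 : ℕ)) (N + 1) ω = j})) atTop (𝓝 (P.real (C ∩ {ω | coordAt
        (fun ω => min (jumpTime h n ω + s) (jumpTime h (n + 1) ω)) ω = j}))) := by
    refine (ENNReal.tendsto_toReal (measure_ne_top P _)).comp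
      (tendsto_measure_of_tendsto_indicator_of_isFiniteMeasure atTop P (fun N => ?_) fun ω => ?_)
    · exact (hC.inter_frozenChain hτ _ _ _).measurableSet (subset_add_lt_top hCτ _ _)
    · by_cases hω : ω ∈ C
      · obtain ⟨h1, rfl⟩ := hCn hω
        filter_upwards [eventually_frozenChain_eq h h1 s] with N hN
        simp only [Set.mem_inter_iff, Set.mem_ofPred_eq, hN]
      · exact Eventually.of_forall fun m => by simp [hω]
  refine tendsto_nhds_unique hlim1 ?_
  simp only [hP.measureReal_frozenChain hτ hC hCτ]
  refine tendsto_finsetSum _ fun i _ => Tendsto.const_mul _ ?_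
  have hd : ∀ i, classInd h a i = 0 ∨ classInd h a i = 1 := fun i => by
    by_cases hi : h i = a
    · exact Or.inr (classInd_of_eq hi)
    · exact Or.inl (classInd_of_ne hi)
  have h2 := tendsto_frozen_pow Λ (classInd h a) hd s s.2
  have h3 := ((continuous_id.matrix_elem i j).tendsto _).comp h2
  refine h3.congr fun N => ?_
  simp [frozenKernel]

end Frozen

/-! ### Laws with a conditional density -/

section Density

variable {Ω Ω' : Type*} [MeasurableSpace Ω] [MeasurableSpace Ω'] {P : Measure Ω}
  {G : Ω → Ω'} {S : Ω → ℝ} {A A' : Set Ω} {f f' p : Ω' × ℝ → ℝ≥0∞}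

/-- `f (G, ·)` is a conditional density of `S` given `G` on the event `A`: this is enough to
identify the joint law of `G` and `S` on `A`. -/
lemma map_restrict_eq_withDensity [IsFiniteMeasure P] (hG : Measurable G) (hS : Measurable S)
    (hf : Measurable f)
    (H : ∀ C, MeasurableSet C → ∀ s : ℝ, P (A ∩ G ⁻¹' C ∩ S ⁻¹' Set.Iic s) =
      ∫⁻ ω in G ⁻¹' C, ∫⁻ u in Set.Iic s, f (G ω, u) ∂volume ∂P) :
    (P.restrict A).map (fun ω => (G ω, S ω)) = ((P.map G).prod volume).withDensity f := by
  have hGS : Measurable fun ω => (G ω, S ω) := hG.prodMk hS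
  have hl : ∀ C D, MeasurableSet C → MeasurableSet D →
      (P.restrict A).map (fun ω => (G ω, S ω)) (C ×ˢ D) = P (A ∩ G ⁻¹' C ∩ S ⁻¹' D) := by
    intro C D hC hD
    rw [Measure.map_apply hGS (hC.prod hD), Measure.restrict_apply (hGS (hC.prod hD))]
    congr 1
    ext ω
    simp only [Set.mem_inter_iff, Set.mem_preimage, Set.mem_prod]
    tauto
  have hr : ∀ C D, MeasurableSet C → MeasurableSet D →
      ((P.map G).prod volume).withDensity f (C ×ˢ D) =
        ∫⁻ ω in G ⁻¹' C, ∫⁻ u in D, f (G ω, u) ∂volume ∂P := by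
    intro C D hC hD
    rw [withDensity_apply _ (hC.prod hD), ← Measure.prod_restrict, lintegral_prod _ hf.aemeasurable,
      setLIntegral_map hC (hf.lintegral_prod_right' (ν := volume.restrict D)) hG]
  have hfin : ∀ C, MeasurableSet C → ∀ D, MeasurableSet D →
      (P.restrict A).map (fun ω => (G ω, S ω)) (C ×ˢ D) =
        ((P.map G).prod volume).withDensity f (C ×ˢ D) := by
    intro C hC
    have h1 : (((P.restrict A).map fun ω => (G ω, S ω)).restrict (C ×ˢ Set.univ)).map Prod.snd =
        ((((P.map G).prod volume).withDensity f).restrict (C ×ˢ Set.univ)).map Prod.snd := by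
      refine Measure.ext_of_Iic _ _ fun s => ?_
      have hs : (Prod.snd ⁻¹' Set.Iic s : Set (Ω' × ℝ)) ∩ C ×ˢ Set.univ = C ×ˢ Set.Iic s := by
        ext x; simp [and_comm]
      rw [Measure.map_apply measurable_snd measurableSet_Iic,
        Measure.map_apply measurable_snd measurableSet_Iic,
        Measure.restrict_apply (measurable_snd measurableSet_Iic),
        Measure.restrict_apply (measurable_snd measurableSet_Iic), hs,
        hl _ _ hC measurableSet_Iic, hr _ _ hC measurableSet_Iic, H C hC s]
    intro D hD
    have h2 := congrArg (fun m => m D) h1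
    have hs : (Prod.snd ⁻¹' D : Set (Ω' × ℝ)) ∩ C ×ˢ Set.univ = C ×ˢ D := by
      ext x; simp [and_comm]
    simp only [Measure.map_apply measurable_snd hD,
      Measure.restrict_apply (measurable_snd hD), hs] at h2
    exact h2
  exact Measure.ext_prod fun hC hD => hfin _ hC _ hD

/-- If the densities on two events are proportional, then the second event has the ratio as
conditional probability. -/
lemma measure_inter_eq_lintegral_of_density (hG : Measurable G) (hS : Measurable S)
    (hp : Measurable p) (hf : Measurable f)
    (h : (P.restrict A).map (fun ω => (G ω, S ω)) = ((P.map G).prod volume).withDensity f)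
    (h' : (P.restrict A').map (fun ω => (G ω, S ω)) = ((P.map G).prod volume).withDensity f')
    (hff : ∀ x, f' x = f x * p x) {E : Set (Ω' × ℝ)} (hE : MeasurableSet E) :
    P (A' ∩ {ω | (G ω, S ω) ∈ E}) = ∫⁻ ω in A ∩ {ω | (G ω, S ω) ∈ E}, p (G ω, S ω) ∂P := by
  have hGS : Measurable fun ω => (G ω, S ω) := hG.prodMk hS
  have hEm : MeasurableSet {ω | (G ω, S ω) ∈ E} := hGS hE
  have h1 : (P.restrict A').map (fun ω => (G ω, S ω)) =
      ((P.restrict A).map (fun ω => (G ω, S ω))).withDensity p := by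
    rw [h', h, show f' = f * p from funext hff, withDensity_mul _ hf hp]
  have h2 := congrArg (fun m => m E) h1
  simp only [Measure.map_apply hGS hE, withDensity_apply _ hE, setLIntegral_map hE hp hGS] at h2
  rw [Measure.restrict_apply (hGS hE), Measure.restrict_restrict (hGS hE)] at h2
  rw [Set.inter_comm A', Set.inter_comm A]
  exact h2

end Density

/-! ### The exit flux -/

section Flux

variable {I O : Type*} [Fintype I] {Λ : Matrix I I ℝ} {h : I → O} {a : O}

lemma measurable_condOp (h : I → O) (νd : O → I → ℝ) (b : O) : Measurable (condOp h νd b) := by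
  have h1 : Continuous fun ν : I → ℝ => ν ⬝ᵥ classInd h b :=
    continuous_id.dotProduct continuous_const
  unfold condOp
  refine Measurable.ite ?_ ?_ measurable_const
  · exact (measurableSet_singleton (0 : ℝ)).compl.preimage h1.measurable
  · exact (h1.measurable.inv).smul (measurable_const.mul measurable_id)

lemma measurable_jumpProb (qd : O → O → ℝ) (b : O) : Measurable (jumpProb Λ h qd a b) := by
  have h1 : ∀ a, Measurable fun ν : I → ℝ => rate Λ h ν a := fun a =>
    (continuous_rate Λ h a).measurable
  unfold jumpProb
  refine Measurable.ite ?_ ?_ measurable_const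
  · exact (measurableSet_singleton (0 : ℝ)).compl.preimage (h1 a)
  · split_ifs
    · exact (h1 b).div (h1 a).neg
    · exact measurable_const

variable [DecidableEq I] {x : I → ℝ}

open Classical in
/-- The density at `u` of the time at which the chain started from `x` jumps out of `h⁻¹(a)`, on
the event that it lands in `J`; only `J \ h⁻¹(a)` counts. -/
noncomputable def exitFlux (Λ : Matrix I I ℝ) (h : I → O) (J : Set I) (a : O) (u : ℝ)
    (x : I → ℝ) : ℝ :=
  ∑ j, if j ∈ J ∧ h j ≠ a then (killedLaw Λ h a u x ᵥ* Λ) j else 0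

lemma exitFlux_nonneg (hΛ : IsRateMatrix Λ) (hx : ∀ i, 0 ≤ x i) {u : ℝ} (hu : 0 ≤ u) (J : Set I) :
    0 ≤ exitFlux Λ h J a u x := by
  refine Finset.sum_nonneg fun j _ => ?_
  split_ifs with hj
  · exact vecMul_nonneg_of_ne hΛ (killedLaw_nonneg hΛ hx hu) (fun i hi => killedLaw_of_ne hi) hj.2
  · exact le_rfl

lemma exitFlux_univ (hΛ : IsRateMatrix Λ) (u : ℝ) (x : I → ℝ) :
    exitFlux Λ h Set.univ a u x = -rate Λ h (killedLaw Λ h a u x) a := by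
  rw [neg_rate_eq_sum hΛ]
  refine Finset.sum_congr rfl fun j _ => ?_
  by_cases hj : h j = a
  · rw [if_neg (fun h1 => h1.2 hj), if_neg (not_not.2 hj)]
  · rw [if_pos ⟨Set.mem_univ j, hj⟩, if_pos hj]

open Classical in
lemma exitFlux_preimage (b : O) (u : ℝ) (x : I → ℝ) :
    exitFlux Λ h (h ⁻¹' {b}) a u x =
      if b ≠ a then rate Λ h (killedLaw Λ h a u x) b else 0 := by
  rw [exitFlux]
  split_ifs with hb
  · rw [rate_eq_sum]
    refine Finset.sum_congr rfl fun j _ => ?_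
    by_cases hj : h j = b
    · rw [if_pos ⟨hj, hj ▸ hb⟩, classInd_of_eq hj, mul_one]
    · rw [if_neg (fun h1 => hj h1.1), classInd_of_ne hj, mul_zero]
  · refine Finset.sum_eq_zero fun j _ => if_neg fun h1 => hb ?_
    exact (show h j = b from h1.1) ▸ h1.2

open Classical in
lemma exitFlux_singleton (i : I) (u : ℝ) (x : I → ℝ) :
    exitFlux Λ h {i} a u x = if h i ≠ a then (killedLaw Λ h a u x ᵥ* Λ) i else 0 := by
  rw [exitFlux, Finset.sum_eq_single i]
  · simp
  · intro j _ hj; exact if_neg fun h1 => hj h1.1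
  · simp

/-- Bayes' formula for the exit flux: the ratio of the fluxes into `{i}` and into the class of `i`
is given by the operator `H`. -/
lemma exitFlux_singleton_eq_mul (hΛ : IsRateMatrix Λ) (νd : O → I → ℝ) (hx : ∀ i, 0 ≤ x i) {u : ℝ}
    (hu : 0 ≤ u) (i : I) :
    exitFlux Λ h {i} a u x = exitFlux Λ h (h ⁻¹' {h i}) a u x *
      condOp h νd (h i) (killedLaw Λ h a u x ᵥ* Λ) i := by
  rw [exitFlux_singleton, exitFlux_preimage]
  split_ifs with hi
  · exact (rate_mul_condOp hΛ νd (killedLaw_nonneg hΛ hx hu)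
      (fun i hi => killedLaw_of_ne hi) hi).symm
  · rw [zero_mul]

/-- The ratio of the flux into the class `b` and of the total exit flux is `q`. -/
lemma exitFlux_preimage_eq_mul (hΛ : IsRateMatrix Λ) (qd : O → O → ℝ) (hx : ∀ i, 0 ≤ x i) {u : ℝ}
    (hu : 0 ≤ u) (b : O) :
    exitFlux Λ h (h ⁻¹' {b}) a u x = exitFlux Λ h Set.univ a u x *
      jumpProb Λ h qd a b (killedLaw Λ h a u x) := by
  rw [exitFlux_univ hΛ, exitFlux_preimage, neg_rate_mul_jumpProb hΛ qd b
    (killedLaw_nonneg hΛ hx hu) (fun i hi => killedLaw_of_ne hi)]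

lemma measurable_of_countable_cases {α β ι : Type*} [MeasurableSpace α] [MeasurableSpace β]
    [Countable ι] {Y : α → ι} (hY : ∀ a, MeasurableSet {x | Y x = a}) {F : ι → α → β}
    (hF : ∀ a, Measurable (F a)) : Measurable fun x => F (Y x) x := by
  intro s hs
  have h1 : (fun x => F (Y x) x) ⁻¹' s = ⋃ a, {x | Y x = a} ∩ F a ⁻¹' s := by
    ext x; simp
  rw [h1]
  exact MeasurableSet.iUnion fun a => (hY a).inter (hF a hs)

lemma continuous_killedLaw_vecMul (Λ : Matrix I I ℝ) (h : I → O) (a : O) :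
    Continuous fun p : ℝ × (I → ℝ) => killedLaw Λ h a p.1 p.2 ᵥ* Λ :=
  continuous_killedLaw_prod.matrix_vecMul continuous_const

variable {Ω : Type*} [MeasurableSpace Ω] {W : Ω → I → ℝ}

lemma measurable_killedLaw_vecMul (hW : Measurable W) (a : O) :
    Measurable fun p : Ω × ℝ => killedLaw Λ h a p.2 (W p.1) ᵥ* Λ := by
  have h1 : Measurable fun p : Ω × ℝ => (p.2, W p.1) :=
    measurable_snd.prodMk (hW.comp measurable_fst)
  have h2 : Measurable fun p : ℝ × (I → ℝ) => killedLaw Λ h a p.1 p.2 ᵥ* Λ :=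
    (continuous_killedLaw_vecMul Λ h a).measurable
  have h3 := h2.comp h1
  exact h3

variable [Countable O] {Y : Ω → O}

lemma measurable_exitFlux (hY : ∀ a, MeasurableSet {ω | Y ω = a}) (hW : Measurable W) (J : Set I) :
    Measurable fun p : Ω × ℝ => exitFlux Λ h J (Y p.1) p.2 (W p.1) := by
  classical
  refine measurable_of_countable_cases (Y := fun p : Ω × ℝ => Y p.1)
    (F := fun a p => exitFlux Λ h J a p.2 (W p.1)) (fun a => measurable_fst (hY a)) fun a => ?_
  refine Finset.measurable_sum _ fun j _ => ?_
  split_ifs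
  · exact (measurable_pi_apply j).comp ((continuous_killedLaw_vecMul Λ h a).measurable.comp
      (measurable_snd.prodMk (hW.comp measurable_fst)))
  · exact measurable_const

lemma measurable_condOp_killedLaw (hY : ∀ a, MeasurableSet {ω | Y ω = a}) (hW : Measurable W)
    (νd : O → I → ℝ) (b : O) :
    Measurable fun p : Ω × ℝ => condOp h νd b (killedLaw Λ h (Y p.1) p.2 (W p.1) ᵥ* Λ) := by
  have h1 : Measurable fun p : Ω × ℝ => killedLaw Λ h (Y p.1) p.2 (W p.1) ᵥ* Λ :=
    measurable_of_countable_cases (Y := fun p : Ω × ℝ => Y p.1)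
      (F := fun a p => killedLaw Λ h a p.2 (W p.1) ᵥ* Λ) (fun a => measurable_fst (hY a))
      fun a => measurable_killedLaw_vecMul hW a
  exact (measurable_condOp h νd b).comp h1

lemma measurable_jumpProb_killedLaw (hY : ∀ a, MeasurableSet {ω | Y ω = a}) (hW : Measurable W)
    (qd : O → O → ℝ) (b : O) :
    Measurable fun p : Ω × ℝ => jumpProb Λ h qd (Y p.1) b (killedLaw Λ h (Y p.1) p.2 (W p.1)) := by
  refine measurable_of_countable_cases (Y := fun p : Ω × ℝ => Y p.1)
    (F := fun a p => jumpProb Λ h qd a b (killedLaw Λ h a p.2 (W p.1)))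
    (fun a => measurable_fst (hY a)) fun a => ?_
  have h1 : Measurable fun p : Ω × ℝ => killedLaw Λ h a p.2 (W p.1) :=
    continuous_killedLaw_prod.measurable.comp (measurable_snd.prodMk (hW.comp measurable_fst))
  exact (measurable_jumpProb qd b).comp h1

end Flux

/-! ### The observed history -/

section History

variable {I O : Type*} {h : I → O} {n : ℕ}

lemma measurable_jumpTime_pastSigma {k : ℕ} (hk : k ≤ n) :
    Measurable[pastSigma (I := I) h n] (jumpTime h k) :=
  Measurable.of_comap_le ((le_sup_left).trans (le_iSup₂_of_le k hk le_rfl))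

lemma measurableSet_jumpTime_lt_top_pastSigma {k : ℕ} (hk : k ≤ n) :
    MeasurableSet[pastSigma (I := I) h n] {ω | jumpTime h k ω < ⊤} :=
  measurable_jumpTime_pastSigma hk measurableSet_Iio

/-- With its junk value `Y_0` where `T_k = ∞`, the position `Y_{T_k}` is a function of the observed
history on the whole space. -/
lemma measurableSet_obsAtJump_pastSigma {k : ℕ} (hk : k ≤ n) (b : O) :
    MeasurableSet[pastSigma (I := I) h n] {ω | obsAtJump h k ω = b} := by
  have hq : ∀ l ≤ n, MeasurableSet[pastSigma (I := I) h n] {ω | obsAtJump? h l ω = some b} := by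
    intro l hl
    have h1 : MeasurableSpace.comap (obsAtJump? h l) ⊤ ≤ pastSigma (I := I) h n :=
      le_sup_right.trans (le_iSup₂_of_le l hl le_rfl)
    exact h1 _ ⟨{some b}, MeasurableSpace.measurableSet_top, rfl⟩
  have h0 : ∀ ω : CadlagPath I, obsAtJump? h 0 ω = some b ↔ obsAtJump h 0 ω = b := fun ω => by
    rw [obsAtJump?_eq_some_iff]
    exact and_iff_right ENNReal.zero_lt_top
  have h2 : {ω : CadlagPath I | obsAtJump h k ω = b} =
      {ω | obsAtJump? h k ω = some b} ∪
        ({ω | jumpTime h k ω < ⊤}ᶜ ∩ {ω | obsAtJump? h 0 ω = some b}) := by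
    ext ω
    simp only [Set.mem_ofPred_eq, Set.mem_union, Set.mem_inter_iff, Set.mem_compl_iff, h0,
      obsAtJump?_eq_some_iff]
    by_cases h3 : jumpTime h k ω < ⊤
    · simp [h3]
    · have h4 : obsAtJump h k ω = obsAtJump h 0 ω := by
        rw [obsAtJump, obsAtJump, not_lt_top_iff.1 h3]; rfl
      simp [h3, h4]
  rw [h2]
  exact (hq k hk).union ((measurableSet_jumpTime_lt_top_pastSigma hk).compl.inter
    (hq 0 (Nat.zero_le n)))

lemma pastSigma_mono {m : ℕ} (hmn : m ≤ n) : pastSigma (I := I) h m ≤ pastSigma h n :=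
  iSup₂_le fun k hk => le_iSup₂_of_le k (hk.trans hmn) le_rfl

lemma pastSigma_succ (h : I → O) (n : ℕ) : pastSigma (I := I) h (n + 1) =
    pastSigmaPlus h n ⊔ MeasurableSpace.comap (obsAtJump? h (n + 1)) ⊤ := by
  refine le_antisymm (iSup₂_le fun k hk => ?_) (sup_le (sup_le (pastSigma_mono n.le_succ) ?_) ?_)
  · rcases Nat.le_succ_iff.1 hk with hk | rfl
    · exact (le_iSup₂_of_le (f := fun k (_ : k ≤ n) => MeasurableSpace.comap (jumpTime h k)
        inferInstance ⊔ MeasurableSpace.comap (obsAtJump? (I := I) h k) ⊤) k hk le_rfl).trans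
          (le_sup_left.trans le_sup_left)
    · exact sup_le_sup_right le_sup_right _
  · exact le_sup_left.trans (le_iSup₂_of_le (n + 1) le_rfl le_rfl)
  · exact le_sup_right.trans (le_iSup₂_of_le (n + 1) le_rfl le_rfl)

lemma pastSigmaPlus_le_pastSigma_succ (h : I → O) (n : ℕ) :
    pastSigmaPlus (I := I) h n ≤ pastSigma h (n + 1) := by
  rw [pastSigma_succ]; exact le_sup_left

lemma pastSigma_le [Countable I] [Countable O] (h : I → O) (n : ℕ) :
    pastSigma h n ≤ (inferInstance : MeasurableSpace (CadlagPath I)) := by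
  refine iSup₂_le fun k _ => sup_le (measurable_jumpTime h k).comap_le ?_
  have h1 : @Measurable _ _ _ ⊤ (obsAtJump? h k : CadlagPath I → Option O) := by
    refine @measurable_to_countable' _ _ ⊤ _ _ _ fun y => ?_
    cases y with
    | none =>
      have h2 : obsAtJump? h k ⁻¹' {none} = {ω : CadlagPath I | jumpTime h k ω < ⊤}ᶜ := by
        ext ω; exact obsAtJump?_eq_none_iff
      rw [h2]
      exact (isOptional_jumpTime h k).measurableSet_lt_top.compl
    | some b =>
      have h2 : obsAtJump? h k ⁻¹' {some b} = {ω : CadlagPath I | jumpTime h k ω < ⊤ ∧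
          coordAt (jumpTime h k) ω ∈ h ⁻¹' {b}} := by
        ext ω; exact obsAtJump?_eq_some_iff
      rw [h2]
      exact measurableSet_coordAt_jumpTime h k _
  exact h1.comap_le

/-- On `{T_{n+1} < ∞}`, the events of `Σ_n⁺` are determined by the history up to `T_n` and the
sojourn time. -/
lemma exists_measurableSet_prod_of_pastSigmaPlus {E : Set (CadlagPath I)}
    (hE : MeasurableSet[pastSigmaPlus h n] E) :
    ∃ E' : Set (CadlagPath I × ℝ), MeasurableSet[(pastSigma h n).prod inferInstance] E' ∧
      ∀ ω, jumpTime h (n + 1) ω < ⊤ → (ω ∈ E ↔ (ω, (sojourn h (n + 1) ω).toReal) ∈ E') := by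
  have h1 : pastSigmaPlus (I := I) h n = MeasurableSpace.comap
      (fun ω => (ω, jumpTime h (n + 1) ω)) ((pastSigma h n).prod inferInstance) := by
    rw [MeasurableSpace.comap_prodMk]
    exact congrArg₂ (· ⊔ ·) MeasurableSpace.comap_id.symm rfl
  rw [h1] at hE
  obtain ⟨F, hF, rfl⟩ := hE
  refine ⟨(fun p : CadlagPath I × ℝ => (p.1, jumpTime h n p.1 + ENNReal.ofReal p.2)) ⁻¹' F,
    ?_, fun ω hω => ?_⟩
  · have h2 : @Measurable _ _ ((pastSigma h n).prod inferInstance)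
        ((pastSigma h n).prod inferInstance)
        fun p : CadlagPath I × ℝ => (p.1, jumpTime h n p.1 + ENNReal.ofReal p.2) := by
      refine Measurable.prodMk (@measurable_fst _ _ (pastSigma h n) _) ?_
      refine Measurable.add ?_ ?_
      · exact (measurable_jumpTime_pastSigma le_rfl).comp (@measurable_fst _ _ (pastSigma h n) _)
      · exact Measurable.ennreal_ofReal (@measurable_snd _ _ (pastSigma h n) _)
    exact h2 hF
  · rw [Set.mem_preimage, Set.mem_preimage, ENNReal.ofReal_toReal (sojourn_lt_top hω).ne,
      ← jumpTime_succ_eq_add_sojourn]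

end History

/-! ### Exit from the current class, given the observed history -/

section Exit

variable {I O : Type*} {h : I → O} {n : ℕ} {ω : CadlagPath I}

/-- The position at time `(T_n + s) ∧ T_{n+1}`. -/
noncomputable def stoppedPos (h : I → O) (n : ℕ) (s : ℝ≥0) (ω : CadlagPath I) : I :=
  coordAt (fun ω => min (jumpTime h n ω + s) (jumpTime h (n + 1) ω)) ω

lemma obs_stoppedPos_of_lt {s : ℝ≥0} (hn : jumpTime h n ω < ⊤) (hs : s < sojourn h (n + 1) ω) :
    h (stoppedPos h n s ω) = obsAtJump h n ω := by
  rw [lt_sojourn_iff] at hs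
  have h1 : jumpTime h n ω + s ≠ ⊤ := (ENNReal.add_lt_top.2 ⟨hn, ENNReal.coe_lt_top⟩).ne
  rw [stoppedPos, coordAt, min_eq_left hs.le]
  refine obs_eq_obsAtJump ?_ ?_
  · rw [ENNReal.coe_toNNReal h1]; exact le_self_add
  · rwa [ENNReal.coe_toNNReal h1]

lemma stoppedPos_of_le {s : ℝ≥0} (hs : sojourn h (n + 1) ω ≤ s) :
    stoppedPos h n s ω = coordAt (jumpTime h (n + 1)) ω := by
  rw [← not_lt, lt_sojourn_iff, not_lt] at hs
  rw [stoppedPos, coordAt, min_eq_right hs]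
  rfl

lemma jumpTime_succ_lt_top_of_le {s : ℝ≥0} (hn : jumpTime h n ω < ⊤)
    (hs : sojourn h (n + 1) ω ≤ s) : jumpTime h (n + 1) ω < ⊤ := by
  rw [jumpTime_succ_eq_add_sojourn]
  exact ENNReal.add_lt_top.2 ⟨hn, hs.trans_lt ENNReal.coe_lt_top⟩

lemma obs_stoppedPos_of_le {s : ℝ≥0} (hn : jumpTime h n ω < ⊤) (hs : sojourn h (n + 1) ω ≤ s) :
    h (stoppedPos h n s ω) ≠ obsAtJump h n ω := by
  rw [stoppedPos_of_le hs]
  exact obsAtJump_succ_ne (jumpTime_succ_lt_top_of_le hn hs)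

lemma obs_stoppedPos_eq_iff {s : ℝ≥0} (hn : jumpTime h n ω < ⊤) :
    h (stoppedPos h n s ω) = obsAtJump h n ω ↔ s < sojourn h (n + 1) ω :=
  ⟨fun h1 => not_le.1 fun h2 => obs_stoppedPos_of_le hn h2 h1, obs_stoppedPos_of_lt hn⟩

lemma measurableSet_stoppedPos [Countable I] (h : I → O) (n : ℕ) (s : ℝ≥0) (j : I) :
    MeasurableSet {ω : CadlagPath I | jumpTime h n ω < ⊤ ∧ stoppedPos h n s ω = j} := by
  have h1 : IsOptional fun ω : CadlagPath I =>
      min (jumpTime h n ω + s) (jumpTime h (n + 1) ω) :=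
    isOptional_min ((isOptional_jumpTime h n).add_const s) (isOptional_jumpTime h (n + 1))
  have h2 := ((isPrior_coordAt h1 j).inter (IsPrior.lt_top h1)).measurableSet
    Set.inter_subset_right
  have h3 : {ω : CadlagPath I | jumpTime h n ω < ⊤ ∧ stoppedPos h n s ω = j} =
      {ω | jumpTime h n ω < ⊤} ∩ ({ω | stoppedPos h n s ω = j} ∩
        {ω | min (jumpTime h n ω + s) (jumpTime h (n + 1) ω) < ⊤}) := by
    ext ω
    simp only [Set.mem_ofPred_eq, Set.mem_inter_iff]
    refine and_congr_right fun hn => (and_iff_left ?_).symm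
    exact (min_le_left _ _).trans_lt (ENNReal.add_lt_top.2 ⟨hn, ENNReal.coe_lt_top⟩)
  rw [h3]
  exact (isOptional_jumpTime h n).measurableSet_lt_top.inter h2

lemma measurable_sojourn_pastSigmaPlus (h : I → O) (n : ℕ) :
    Measurable[pastSigmaPlus (I := I) h n] fun ω => (sojourn h (n + 1) ω).toReal := by
  have h1 : Measurable[pastSigmaPlus (I := I) h n] (jumpTime h (n + 1)) :=
    Measurable.of_comap_le le_sup_right
  have h2 : Measurable[pastSigmaPlus (I := I) h n] (jumpTime h n) :=
    (measurable_jumpTime_pastSigma le_rfl).mono le_sup_left le_rfl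
  exact (h1.sub h2).ennreal_toReal

variable [Fintype I] {Λ : Matrix I I ℝ} {νd : O → I → ℝ} {μ : I → ℝ}

/-- The filter `Π_{T_n}`, set to zero where `T_n = ∞`. -/
noncomputable def jumpFilter (Λ : Matrix I I ℝ) (h : I → O) (νd : O → I → ℝ) (μ : I → ℝ) (n : ℕ)
    (ω : CadlagPath I) : I → ℝ :=
  if jumpTime h n ω < ⊤ then filterAtJump Λ h νd μ ω n else 0

lemma jumpFilter_of_lt (hn : jumpTime h n ω < ⊤) :
    jumpFilter Λ h νd μ n ω = filterAtJump Λ h νd μ ω n := if_pos hn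

lemma jumpFilter_of_not_lt (hn : ¬ jumpTime h n ω < ⊤) : jumpFilter Λ h νd μ n ω = 0 := if_neg hn

variable [DecidableEq I]

lemma jumpFilter_mem_face (hΛ : IsRateMatrix Λ) (hνd : ∀ a, νd a ∈ face h a)
    (hμ : μ ∈ stdSimplex ℝ I) (hn : jumpTime h n ω < ⊤) :
    jumpFilter Λ h νd μ n ω ∈ face h (obsAtJump h n ω) := by
  rw [jumpFilter_of_lt hn]; exact filterAtJump_mem_face hΛ hνd hμ hn

lemma jumpFilter_nonneg (hΛ : IsRateMatrix Λ) (hνd : ∀ a, νd a ∈ face h a)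
    (hμ : μ ∈ stdSimplex ℝ I) (n : ℕ) (ω : CadlagPath I) (i : I) :
    0 ≤ jumpFilter Λ h νd μ n ω i := by
  by_cases hn : jumpTime h n ω < ⊤
  · exact (jumpFilter_mem_face hΛ hνd hμ hn).1.1 i
  · simp [jumpFilter_of_not_lt hn]

lemma jumpFilter_of_ne (hΛ : IsRateMatrix Λ) (hνd : ∀ a, νd a ∈ face h a)
    (hμ : μ ∈ stdSimplex ℝ I) {i : I} (hi : h i ≠ obsAtJump h n ω) :
    jumpFilter Λ h νd μ n ω i = 0 := by
  by_cases hn : jumpTime h n ω < ⊤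
  · exact (jumpFilter_mem_face hΛ hνd hμ hn).2 i hi
  · simp [jumpFilter_of_not_lt hn]

lemma jumpFilter_succ (hΛ : IsRateMatrix Λ) (hνd : ∀ a, νd a ∈ face h a)
    (hμ : μ ∈ stdSimplex ℝ I) (hn : jumpTime h (n + 1) ω < ⊤) :
    jumpFilter Λ h νd μ (n + 1) ω = condOp h νd (obsAtJump h (n + 1) ω)
      (killedLaw Λ h (obsAtJump h n ω) (sojourn h (n + 1) ω).toReal
        (jumpFilter Λ h νd μ n ω) ᵥ* Λ) := by
  have hn0 := (jumpTime_le_succ h n ω).trans_lt hn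
  rw [jumpFilter_of_lt hn, jumpFilter_of_lt hn0, filterAtJump,
    condOp_flow_eq hΛ νd (filterAtJump_mem_face hΛ hνd hμ hn0) _ ENNReal.toReal_nonneg]

variable [Fintype O]

lemma measurable_jumpFilter (hΛ : IsRateMatrix Λ) (hνd : ∀ a, νd a ∈ face h a)
    (hμ : μ ∈ stdSimplex ℝ I) (n : ℕ) :
    Measurable[pastSigma h n] (jumpFilter Λ h νd μ n) := by
  induction n with
  | zero =>
    have h1 : jumpFilter Λ h νd μ 0 = fun ω => condOp h νd (obsAtJump h 0 ω) μ := by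
      ext1 ω
      exact jumpFilter_of_lt (n := 0) ENNReal.zero_lt_top
    rw [h1]
    exact @measurable_of_countable_cases _ _ _ (pastSigma h 0) _ _ _
      (fun a => measurableSet_obsAtJump_pastSigma le_rfl a) (fun a _ => condOp h νd a μ)
      fun a => measurable_const
  | succ n ih =>
    have h1 : jumpFilter Λ h νd μ (n + 1) = fun ω => if jumpTime h (n + 1) ω < ⊤ then
        condOp h νd (obsAtJump h (n + 1) ω) (killedLaw Λ h (obsAtJump h n ω)
          (sojourn h (n + 1) ω).toReal (jumpFilter Λ h νd μ n ω) ᵥ* Λ) else 0 := by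
      ext1 ω
      split_ifs with hn
      · exact jumpFilter_succ hΛ hνd hμ hn
      · exact jumpFilter_of_not_lt hn
    rw [h1]
    refine Measurable.ite (measurableSet_jumpTime_lt_top_pastSigma le_rfl) ?_ measurable_const
    refine @measurable_of_countable_cases _ _ _ (pastSigma h (n + 1)) _ _ _
      (fun a => measurableSet_obsAtJump_pastSigma le_rfl a) (fun b ω => condOp h νd b
        (killedLaw Λ h (obsAtJump h n ω) (sojourn h (n + 1) ω).toReal
          (jumpFilter Λ h νd μ n ω) ᵥ* Λ)) fun b => ?_
    have h2 := @measurable_condOp_killedLaw _ _ _ Λ h _ _ (pastSigma h n) _ _ _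
      (fun a => measurableSet_obsAtJump_pastSigma le_rfl a) ih νd b
    have h3 : @Measurable _ _ (pastSigma h (n + 1))
        ((pastSigma h n).prod inferInstance)
        fun ω : CadlagPath I => (ω, (sojourn h (n + 1) ω).toReal) :=
      Measurable.prodMk (measurable_id'' (pastSigma_mono n.le_succ))
        ((measurable_sojourn_pastSigmaPlus h n).mono (pastSigmaPlus_le_pastSigma_succ h n) le_rfl)
    have h4 := h2.comp h3
    exact h4

lemma measurable_stoppedLaw_jumpFilter (hΛ : IsRateMatrix Λ) (hνd : ∀ a, νd a ∈ face h a)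
    (hμ : μ ∈ stdSimplex ℝ I) (n : ℕ) (s : ℝ) :
    Measurable[pastSigma h n] fun ω => stoppedLaw Λ h (obsAtJump h n ω) s
      (jumpFilter Λ h νd μ n ω) := by
  refine @measurable_of_countable_cases _ _ _ (pastSigma h n) _ _ _
    (fun a => measurableSet_obsAtJump_pastSigma le_rfl a)
    (fun a ω => stoppedLaw Λ h a s (jumpFilter Λ h νd μ n ω)) fun a => ?_
  have h1 : Measurable fun x : I → ℝ => stoppedLaw Λ h a s x :=
    (continuous_stoppedLaw_prod.comp (Continuous.prodMk_right s)).measurable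
  exact h1.comp (measurable_jumpFilter hΛ hνd hμ n)

variable {P : Measure (CadlagPath I)}

/-- `Π_{T_n}` is the conditional law of `X_{T_n}` given the history observed up to `T_n`. -/
def IsFilterAt (Λ : Matrix I I ℝ) (h : I → O) (νd : O → I → ℝ) (μ : I → ℝ)
    (P : Measure (CadlagPath I)) (n : ℕ) : Prop :=
  ∀ B, MeasurableSet[pastSigma h n] B → ∀ i,
    P (B ∩ {ω | jumpTime h n ω < ⊤} ∩ {ω | coordAt (jumpTime h n) ω = i}) =
      ∫⁻ ω in B ∩ {ω | jumpTime h n ω < ⊤}, ENNReal.ofReal (jumpFilter Λ h νd μ n ω i) ∂P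

end Exit

/-! ### Conditional law of the sojourn time and of the landing point -/

section Disintegration

variable {I O : Type*} [Fintype I] [DecidableEq I] {h : I → O} {n : ℕ}
  {Λ : Matrix I I ℝ} {νd : O → I → ℝ} {μ : I → ℝ} {P : Measure (CadlagPath I)}

open Classical in
/-- The flux into `J` up to time `s` is the mass of the stopped chain on the part of `J` outside the
class `a`. -/
lemma lintegral_Iic_exitFlux (hΛ : IsRateMatrix Λ) {x : I → ℝ} {a : O} (hx : ∀ i, 0 ≤ x i)
    (hxa : ∀ i, h i ≠ a → x i = 0) (J : Set I) (s : ℝ≥0) :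
    ∫⁻ u in Set.Iic (s : ℝ), ENNReal.ofReal (if 0 < u then exitFlux Λ h J a u x else 0) =
      ∑ j, if j ∈ J ∧ h j ≠ a then ENNReal.ofReal (stoppedLaw Λ h a s x j) else 0 := by
  have h1 : ∀ u : ℝ, ENNReal.ofReal (if 0 < u then exitFlux Λ h J a u x else 0) =
      (Set.Ioi 0).indicator (fun u => ∑ j, if j ∈ J ∧ h j ≠ a then
        ENNReal.ofReal ((killedLaw Λ h a u x ᵥ* Λ) j) else 0) u := by
    intro u
    by_cases hu : 0 < u
    · rw [if_pos hu, Set.indicator_of_mem (show u ∈ Set.Ioi 0 from hu), exitFlux,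
        ENNReal.ofReal_sum_of_nonneg fun j _ => ?_]
      · refine Finset.sum_congr rfl fun j _ => ?_
        split_ifs <;> simp
      · split_ifs with hj
        · exact vecMul_nonneg_of_ne hΛ (killedLaw_nonneg hΛ hx hu.le)
            (fun i hi => killedLaw_of_ne hi) hj.2
        · exact le_rfl
    · rw [if_neg hu, Set.indicator_of_notMem (show u ∉ Set.Ioi 0 from hu), ENNReal.ofReal_zero]
  have hm : ∀ j, Measurable fun u : ℝ => ENNReal.ofReal ((killedLaw Λ h a u x ᵥ* Λ) j) := fun j =>
    ((continuous_apply j).comp ((continuous_killedLaw_vecMul Λ h a).comp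
      (Continuous.prodMk_left x))).measurable.ennreal_ofReal
  simp only [h1]
  rw [setLIntegral_indicator measurableSet_Ioi, Set.Ioi_inter_Iic,
    lintegral_finsetSum _ fun j _ => ?_]
  · refine Finset.sum_congr rfl fun j _ => ?_
    split_ifs with hj
    · exact (ofReal_stoppedLaw_eq_lintegral hΛ hx hxa hj.2 s.2).symm
    · simp
  · split_ifs
    · exact hm j
    · exact measurable_const

variable [Fintype O]

/-- Given the history up to `T_n`, the position at `(T_n + s) ∧ T_{n+1}` is distributed according to
the stopped semigroup started from `Π_{T_n}`. -/
lemma IsFilterAt.measure_stoppedPos (hF : IsFilterAt Λ h νd μ P n) (hΛ : IsRateMatrix Λ)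
    (hνd : ∀ a, νd a ∈ face h a) (hμ : μ ∈ stdSimplex ℝ I) (hP : IsMarkovLaw Λ μ P)
    {B : Set (CadlagPath I)} (hB : MeasurableSet[pastSigma h n] B) (s : ℝ≥0) (j : I) :
    P (B ∩ {ω | jumpTime h n ω < ⊤} ∩ {ω | stoppedPos h n s ω = j}) =
      ∫⁻ ω in B ∩ {ω | jumpTime h n ω < ⊤}, ENNReal.ofReal
        (stoppedLaw Λ h (obsAtJump h n ω) s (jumpFilter Λ h νd μ n ω) j) ∂P := by
  have := hP.isProbabilityMeasure
  have hle := pastSigma_le (I := I) h n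
  have hT := measurableSet_jumpTime_lt_top_pastSigma (I := I) (h := h) (le_refl n)
  have hY := fun a => measurableSet_obsAtJump_pastSigma (I := I) (h := h) (le_refl n) a
  have hpos := measurableSet_stoppedPos h n s j
  have hmeasD : ∀ a, MeasurableSet (B ∩ {ω | jumpTime h n ω < ⊤} ∩
      {ω | stoppedPos h n s ω = j} ∩ {ω | obsAtJump h n ω = a}) := fun a => by
    rw [Set.inter_assoc B]
    exact ((hle _ hB).inter hpos).inter (hle _ (hY a))
  rw [measure_eq_sum_fiber P (obsAtJump h n) hmeasD,
    ← withDensity_apply _ (hle _ (hB.inter hT)),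
    measure_eq_sum_fiber _ (obsAtJump h n) fun a => hle _ ((hB.inter hT).inter (hY a))]
  refine Finset.sum_congr rfl fun a _ => ?_
  rw [withDensity_apply _ (hle _ ((hB.inter hT).inter (hY a)))]
  set E := B ∩ {ω | jumpTime h n ω < ⊤} ∩ {ω | obsAtJump h n ω = a} with hE
  have hEm : MeasurableSet[pastSigma h n] E := (hB.inter hT).inter (hY a)
  have hET : E ∩ {ω | jumpTime h n ω < ⊤} = E := Set.inter_eq_left.2 fun ω hω => hω.1.2
  have hEa : ∀ ω ∈ E, obsAtJump h n ω = a := fun ω hω => hω.2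
  have hexp : ∀ i, 0 ≤ NormedSpace.exp ((s : ℝ) • stoppedGen Λ h a) i j := fun i => by
    obtain ⟨c, hc⟩ := exists_exp_neg_mul_le_exp_stoppedGen hΛ h a
    refine le_trans ?_ (hc s s.2 i j)
    rw [Matrix.one_apply]
    split_ifs <;> positivity
  have h1 := hP.measureReal_stopped (pastSigma_le_priorSigma h n E hEm)
    (fun ω hω => ⟨hω.1.2, hω.2⟩ : E ⊆ {ω | jumpTime h n ω < ⊤ ∧ obsAtJump h n ω = a}) s j
  have h2 : B ∩ {ω | jumpTime h n ω < ⊤} ∩ {ω | stoppedPos h n s ω = j} ∩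
      {ω | obsAtJump h n ω = a} = E ∩ {ω | stoppedPos h n s ω = j} :=
    Set.inter_right_comm _ _ _
  have hWm : ∀ i, Measurable fun ω => jumpFilter Λ h νd μ n ω i := fun i =>
    ((measurable_pi_apply i).comp (measurable_jumpFilter hΛ hνd hμ n)).mono hle le_rfl
  calc P (B ∩ {ω | jumpTime h n ω < ⊤} ∩ {ω | stoppedPos h n s ω = j} ∩
      {ω | obsAtJump h n ω = a})
      = ENNReal.ofReal (P.real (E ∩ {ω | stoppedPos h n s ω = j})) := by
        rw [h2, ofReal_measureReal]
    _ = ∑ i, (∫⁻ ω in E, ENNReal.ofReal (jumpFilter Λ h νd μ n ω i) ∂P) *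
          ENNReal.ofReal (NormedSpace.exp ((s : ℝ) • stoppedGen Λ h a) i j) := by
        refine (congrArg ENNReal.ofReal h1).trans ?_
        rw [ENNReal.ofReal_sum_of_nonneg fun i _ => mul_nonneg measureReal_nonneg (hexp i)]
        refine Finset.sum_congr rfl fun i _ => ?_
        have h3 := hF E hEm i
        rw [hET] at h3
        rw [ENNReal.ofReal_mul measureReal_nonneg, ofReal_measureReal, h3]
    _ = ∫⁻ ω in E, ∑ i, ENNReal.ofReal (jumpFilter Λ h νd μ n ω i) *
          ENNReal.ofReal (NormedSpace.exp ((s : ℝ) • stoppedGen Λ h a) i j) ∂P := by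
        rw [lintegral_finsetSum _ fun i _ => (hWm i).ennreal_ofReal.mul_const _]
        refine Finset.sum_congr rfl fun i _ => ?_
        rw [lintegral_mul_const _ (hWm i).ennreal_ofReal]
    _ = _ := by
        refine setLIntegral_congr_fun (hle _ hEm) fun ω hω => ?_
        simp only [hEa ω hω]
        rw [stoppedLaw, vecMul, dotProduct, ENNReal.ofReal_sum_of_nonneg fun i _ =>
          mul_nonneg (jumpFilter_nonneg hΛ hνd hμ n ω i) (hexp i)]
        refine Finset.sum_congr rfl fun i _ => ?_
        rw [ENNReal.ofReal_mul (jumpFilter_nonneg hΛ hνd hμ n ω i)]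

open Classical in
/-- The probability of an event which is determined by the observed history and the position at
`(T_n + s) ∧ T_{n+1}`. -/
lemma IsFilterAt.measure_eq_lintegral_sum (hF : IsFilterAt Λ h νd μ P n) (hΛ : IsRateMatrix Λ)
    (hνd : ∀ a, νd a ∈ face h a) (hμ : μ ∈ stdSimplex ℝ I) (hP : IsMarkovLaw Λ μ P)
    {B D : Set (CadlagPath I)} (hB : MeasurableSet[pastSigma h n] B) (s : ℝ≥0) (R : I → Set O)
    (hR : ∀ ω, ω ∈ D ↔ ω ∈ B ∧ jumpTime h n ω < ⊤ ∧ obsAtJump h n ω ∈ R (stoppedPos h n s ω)) :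
    P D = ∫⁻ ω in B, ∑ j, (if obsAtJump h n ω ∈ R j then ENNReal.ofReal
        (stoppedLaw Λ h (obsAtJump h n ω) s (jumpFilter Λ h νd μ n ω) j) else 0) ∂P := by
  have hle := pastSigma_le (I := I) h n
  have hT := measurableSet_jumpTime_lt_top_pastSigma (I := I) (h := h) (le_refl n)
  have hRm : ∀ j, MeasurableSet[pastSigma h n] {ω : CadlagPath I | obsAtJump h n ω ∈ R j} := by
    intro j
    have h1 : {ω : CadlagPath I | obsAtJump h n ω ∈ R j} =
        ⋃ a : O, ⋃ (_ : a ∈ R j), {ω | obsAtJump h n ω = a} := by ext ω; simp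
    rw [h1]
    exact MeasurableSet.iUnion fun a => MeasurableSet.iUnion fun _ =>
      measurableSet_obsAtJump_pastSigma le_rfl a
  have hfib : ∀ j, D ∩ {ω | stoppedPos h n s ω = j} =
      (B ∩ {ω | obsAtJump h n ω ∈ R j}) ∩ {ω | jumpTime h n ω < ⊤} ∩
        {ω | stoppedPos h n s ω = j} := by
    intro j
    ext ω
    simp only [Set.mem_inter_iff, Set.mem_ofPred_eq, hR]
    constructor
    · rintro ⟨⟨h1, h2, h3⟩, rfl⟩; exact ⟨⟨⟨h1, h3⟩, h2⟩, rfl⟩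
    · rintro ⟨⟨⟨h1, h3⟩, h2⟩, rfl⟩; exact ⟨⟨h1, h2, h3⟩, rfl⟩
  have hSm : ∀ j, Measurable fun ω => ENNReal.ofReal
      (stoppedLaw Λ h (obsAtJump h n ω) s (jumpFilter Λ h νd μ n ω) j) := fun j =>
    (((measurable_pi_apply j).comp
      (measurable_stoppedLaw_jumpFilter hΛ hνd hμ n s)).mono hle le_rfl).ennreal_ofReal
  rw [measure_eq_sum_fiber P (stoppedPos h n s) fun j => ?_]
  · rw [lintegral_finsetSum _ fun j _ => Measurable.ite (hle _ (hRm j)) (hSm j) measurable_const]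
    refine Finset.sum_congr rfl fun j _ => ?_
    rw [hfib, hF.measure_stoppedPos hΛ hνd hμ hP (hB.inter (hRm j)), Set.inter_assoc,
      Set.inter_comm, ← setLIntegral_indicator (hle _ ((hRm j).inter hT))]
    refine setLIntegral_congr_fun (hle _ hB) fun ω _ => ?_
    by_cases h1 : obsAtJump h n ω ∈ R j
    · by_cases h2 : jumpTime h n ω < ⊤
      · simp [h1, h2]
      · simp [h1, h2, jumpFilter_of_not_lt h2, stoppedLaw]
    · simp [h1]
  · rw [hfib, Set.inter_assoc]
    exact (hle _ (hB.inter (hRm j))).inter (measurableSet_stoppedPos h n s j)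

/-- The conditional law of the sojourn time. -/
lemma IsFilterAt.measure_lt_sojourn (hF : IsFilterAt Λ h νd μ P n) (hΛ : IsRateMatrix Λ)
    (hνd : ∀ a, νd a ∈ face h a) (hμ : μ ∈ stdSimplex ℝ I) (hP : IsMarkovLaw Λ μ P)
    {B : Set (CadlagPath I)} (hB : MeasurableSet[pastSigma h n] B) (s : ℝ≥0) :
    P ({ω | (s : ℝ≥0∞) < sojourn h (n + 1) ω ∧ jumpTime h n ω < ⊤} ∩ B) =
      ∫⁻ ω in B, ENNReal.ofReal
        (survival Λ h (obsAtJump h n ω) s (jumpFilter Λ h νd μ n ω)) ∂P := by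
  classical
  rw [hF.measure_eq_lintegral_sum hΛ hνd hμ hP hB s fun j => {h j}]
  · refine setLIntegral_congr_fun (pastSigma_le h n _ hB) fun ω _ => ?_
    simp only [survival, dotProduct]
    have h0 := stoppedLaw_nonneg (a := obsAtJump h n ω) (h := h) hΛ
      (jumpFilter_nonneg hΛ hνd hμ n ω) s.coe_nonneg
    rw [ENNReal.ofReal_sum_of_nonneg fun j _ => mul_nonneg (h0 j)
      (classInd_nonneg h (obsAtJump h n ω) j)]
    refine Finset.sum_congr rfl fun j _ => ?_
    by_cases hj : h j = obsAtJump h n ω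
    · rw [if_pos (Set.mem_singleton_iff.2 hj.symm), classInd_of_eq hj, mul_one]
    · rw [if_neg fun h1 => hj (Set.mem_singleton_iff.1 h1).symm, classInd_of_ne hj, mul_zero,
        ENNReal.ofReal_zero]
  · intro ω
    simp only [Set.mem_inter_iff, Set.mem_ofPred_eq, Set.mem_singleton_iff]
    by_cases hn : jumpTime h n ω < ⊤
    · rw [eq_comm, obs_stoppedPos_eq_iff hn]; tauto
    · simp [hn]

/-- The density at `p.2` of `T_{n+1} - T_n` given the observed history, on landing in `J`; it
vanishes for `p.2 ≤ 0`. -/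
noncomputable def exitDensity (Λ : Matrix I I ℝ) (h : I → O) (νd : O → I → ℝ) (μ : I → ℝ) (n : ℕ)
    (J : Set I) (p : CadlagPath I × ℝ) : ℝ≥0∞ :=
  ENNReal.ofReal (if 0 < p.2 then
    exitFlux Λ h J (obsAtJump h n p.1) p.2 (jumpFilter Λ h νd μ n p.1) else 0)

lemma measurable_exitDensity (hΛ : IsRateMatrix Λ) (hνd : ∀ a, νd a ∈ face h a)
    (hμ : μ ∈ stdSimplex ℝ I) (n : ℕ) (J : Set I) :
    @Measurable _ _ ((pastSigma h n).prod inferInstance) _ (exitDensity Λ h νd μ n J) := by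
  refine Measurable.ennreal_ofReal ?_
  refine Measurable.ite ?_ ?_ measurable_const
  · exact measurableSet_Ioi.preimage (@measurable_snd _ _ (pastSigma h n) _)
  · exact @measurable_exitFlux _ _ _ Λ h _ _ (pastSigma h n) _ _ _
      (fun a => measurableSet_obsAtJump_pastSigma le_rfl a) (measurable_jumpFilter hΛ hνd hμ n) J

/-- The event that `Y` jumps for the `(n + 1)`-st time and that `X` lands in `J`. -/
def landing (h : I → O) (n : ℕ) (J : Set I) : Set (CadlagPath I) :=
  {ω | jumpTime h (n + 1) ω < ⊤ ∧ coordAt (jumpTime h (n + 1)) ω ∈ J}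

/-- `exitDensity` is the conditional density of the sojourn time on landing in `J`: up to time `s`
the chain has landed in `J` exactly if its position at `(T_n + s) ∧ T_{n+1}` lies in `J` and outside
the current class. -/
lemma IsFilterAt.measure_landing_inter_Iic (hF : IsFilterAt Λ h νd μ P n) (hΛ : IsRateMatrix Λ)
    (hνd : ∀ a, νd a ∈ face h a) (hμ : μ ∈ stdSimplex ℝ I) (hP : IsMarkovLaw Λ μ P)
    {B : Set (CadlagPath I)} (hB : MeasurableSet[pastSigma h n] B) (J : Set I) (s : ℝ) :
    P (landing h n J ∩ B ∩ (fun ω => (sojourn h (n + 1) ω).toReal) ⁻¹' Set.Iic s) =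
      ∫⁻ ω in B, ∫⁻ u in Set.Iic s, exitDensity Λ h νd μ n J (ω, u) ∂volume ∂P := by
  classical
  rcases lt_or_ge s 0 with hs | hs
  · have h1 : (fun ω : CadlagPath I => (sojourn h (n + 1) ω).toReal) ⁻¹' Set.Iic s = ∅ :=
      Set.eq_empty_of_forall_notMem fun ω hω =>
        absurd (ENNReal.toReal_nonneg.trans hω) (not_le.2 hs)
    have h2 : ∀ ω, ∫⁻ u in Set.Iic s, exitDensity Λ h νd μ n J (ω, u) = 0 := fun ω => by
      rw [setLIntegral_congr_fun (g := fun _ => 0) measurableSet_Iic fun u hu => ?_, lintegral_zero]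
      have : ¬ 0 < u := not_lt.2 (hu.trans hs.le)
      simp [exitDensity, this]
    rw [h1, Set.inter_empty, measure_empty]
    simp [h2]
  · lift s to ℝ≥0 using hs
    rw [hF.measure_eq_lintegral_sum hΛ hνd hμ hP hB s fun j => {a | j ∈ J ∧ h j ≠ a}]
    · refine setLIntegral_congr_fun (pastSigma_le h n _ hB) fun ω _ => ?_
      refine Eq.trans (Finset.sum_congr rfl fun j _ => ?_)
        (lintegral_Iic_exitFlux hΛ (jumpFilter_nonneg hΛ hνd hμ n ω)
          (fun i hi => jumpFilter_of_ne hΛ hνd hμ hi) J s).symm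
      by_cases hj : j ∈ J ∧ h j ≠ obsAtJump h n ω
      · exact (if_pos hj).trans (if_pos hj).symm
      · exact (if_neg hj).trans (if_neg hj).symm
    · intro ω
      simp only [Set.mem_inter_iff, landing, Set.mem_ofPred_eq, Set.mem_preimage, Set.mem_Iic]
      constructor
      · rintro ⟨⟨⟨h1, h2⟩, h3⟩, h4⟩
        have h5 : sojourn h (n + 1) ω ≤ s := by
          rw [← ENNReal.ofReal_toReal (sojourn_lt_top h1).ne, ← ENNReal.ofReal_coe_nnreal]
          exact ENNReal.ofReal_le_ofReal h4
        have hn := (jumpTime_le_succ h n ω).trans_lt h1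
        exact ⟨h3, hn, stoppedPos_of_le h5 ▸ h2, obs_stoppedPos_of_le hn h5⟩
      · rintro ⟨h3, hn, h2, h4⟩
        have h5 : sojourn h (n + 1) ω ≤ s := by
          rw [Ne, obs_stoppedPos_eq_iff hn, not_lt] at h4; exact h4
        refine ⟨⟨⟨jumpTime_succ_lt_top_of_le hn h5, stoppedPos_of_le h5 ▸ h2⟩, h3⟩, ?_⟩
        exact ENNReal.toReal_le_coe_of_le_coe h5

/-- If the exit fluxes into `J'` and `J` are proportional with ratio `p`, then `p` is the
conditional probability of landing in `J'`, among the landings in `J`, given the history and the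
jump time. -/
lemma IsFilterAt.measure_landing_eq_lintegral (hF : IsFilterAt Λ h νd μ P n) (hΛ : IsRateMatrix Λ)
    (hνd : ∀ a, νd a ∈ face h a) (hμ : μ ∈ stdSimplex ℝ I) (hP : IsMarkovLaw Λ μ P)
    {J J' : Set I} {p : CadlagPath I × ℝ → ℝ}
    (hp : @Measurable _ _ ((pastSigma h n).prod inferInstance) _ p)
    (hJ : ∀ ω u, 0 ≤ u → exitFlux Λ h J' (obsAtJump h n ω) u (jumpFilter Λ h νd μ n ω) =
      exitFlux Λ h J (obsAtJump h n ω) u (jumpFilter Λ h νd μ n ω) * p (ω, u))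
    {E : Set (CadlagPath I)} (hE : MeasurableSet[pastSigmaPlus h n] E) :
    P (landing h n J' ∩ E) =
      ∫⁻ ω in landing h n J ∩ E, ENNReal.ofReal (p (ω, (sojourn h (n + 1) ω).toReal)) ∂P := by
  have := hP.isProbabilityMeasure
  obtain ⟨E', hE', hEE'⟩ := exists_measurableSet_prod_of_pastSigmaPlus hE
  -- the identity, read as a map onto the path space with the smaller σ-algebra `Σ_n`, is the
  -- conditioning variable
  have hid : @Measurable _ _ _ (pastSigma h n) fun ω : CadlagPath I => ω :=
    measurable_id'' (pastSigma_le h n)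
  have hS : Measurable fun ω : CadlagPath I => (sojourn h (n + 1) ω).toReal :=
    (measurable_sojourn_pastSigmaPlus h n).mono
      ((pastSigmaPlus_le_pastSigma_succ h n).trans (pastSigma_le h (n + 1))) le_rfl
  have hlaw : ∀ J : Set I, _ := fun J =>
    @map_restrict_eq_withDensity _ _ _ (pastSigma h n) P (fun ω => ω) _ (landing h n J) _ _ hid hS
      (measurable_exitDensity hΛ hνd hμ n J)
      fun B hB s => hF.measure_landing_inter_Iic hΛ hνd hμ hP hB J s
  have h1 := @measure_inter_eq_lintegral_of_density _ _ _ (pastSigma h n) P (fun ω => ω) _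
    (landing h n J) (landing h n J') _ _ (fun x => ENNReal.ofReal (p x)) hid hS hp.ennreal_ofReal
    (measurable_exitDensity hΛ hνd hμ n J) (hlaw J) (hlaw J') (fun x => ?_) _ hE'
  · have h2 : ∀ J : Set I, landing h n J ∩ {ω | (ω, (sojourn h (n + 1) ω).toReal) ∈ E'} =
        landing h n J ∩ E := fun J => by
      ext ω
      exact and_congr_right fun hω => (hEE' ω hω.1).symm
    rwa [h2, h2] at h1
  · unfold exitDensity
    split_ifs with hx
    · rw [hJ _ _ hx.le, ENNReal.ofReal_mul
        (exitFlux_nonneg hΛ (jumpFilter_nonneg hΛ hνd hμ n x.1) hx.le J)]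
    · simp

end Disintegration

/-! ### The filter at the jump times -/

/-- Adjoining a random variable which is constant on `K` does not change the trace of a σ-algebra
on `K`. -/
lemma exists_measurableSet_of_const_on {Ω β : Type*} {m : MeasurableSpace Ω}
    {mβ : MeasurableSpace β} {f : Ω → β} {K : Set Ω} {c : β} (hK : ∀ ω ∈ K, f ω = c) {B : Set Ω}
    (hB : MeasurableSet[m ⊔ MeasurableSpace.comap f mβ] B) :
    ∃ E, MeasurableSet[m] E ∧ ∀ ω ∈ K, (ω ∈ B ↔ ω ∈ E) := by
  have h1 : f ∘ (Subtype.val : K → Ω) = fun _ => c := funext fun ω => hK ω ω.2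
  have h2 : MeasurableSpace.comap (Subtype.val : K → Ω) (m ⊔ MeasurableSpace.comap f mβ) =
      MeasurableSpace.comap Subtype.val m := by
    rw [MeasurableSpace.comap_sup, MeasurableSpace.comap_comp, h1, MeasurableSpace.comap_const,
      sup_bot_eq]
  have h3 : MeasurableSet[MeasurableSpace.comap (Subtype.val : K → Ω)
      (m ⊔ MeasurableSpace.comap f mβ)] (Subtype.val ⁻¹' B) := ⟨B, hB, rfl⟩
  rw [h2] at h3
  obtain ⟨E, hE, hEB⟩ := h3
  exact ⟨E, hE, fun ω hω => (Set.ext_iff.1 hEB ⟨ω, hω⟩).symm⟩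

section FilterAt

variable {I O : Type*} [Fintype I] [DecidableEq I] [Fintype O] {h : I → O} {n : ℕ}
  {Λ : Matrix I I ℝ} {νd : O → I → ℝ} {μ : I → ℝ} {P : Measure (CadlagPath I)}

/-- The filter at `T_n` charges the state `i` only where `Y_{T_n} = h i`. -/
lemma setLIntegral_jumpFilter_inter (hΛ : IsRateMatrix Λ) (hνd : ∀ a, νd a ∈ face h a)
    (hμ : μ ∈ stdSimplex ℝ I) (D : Set (CadlagPath I)) (i : I) :
    ∫⁻ ω in D, ENNReal.ofReal (jumpFilter Λ h νd μ n ω i) ∂P =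
      ∫⁻ ω in D ∩ {ω | obsAtJump h n ω = h i}, ENNReal.ofReal (jumpFilter Λ h νd μ n ω i) ∂P := by
  rw [Set.inter_comm, ← setLIntegral_indicator
    (pastSigma_le h n _ (measurableSet_obsAtJump_pastSigma le_rfl (h i)))]
  refine lintegral_congr fun ω => ?_
  by_cases hi : h i = obsAtJump h n ω
  · have hω : ω ∈ {ω | obsAtJump h n ω = h i} := hi.symm
    exact Eq.symm (Set.indicator_of_mem hω fun ω => ENNReal.ofReal (jumpFilter Λ h νd μ n ω i))
  · have hω : ω ∉ {ω | obsAtJump h n ω = h i} := fun h1 => hi (Eq.symm h1)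
    have h0 : ENNReal.ofReal (jumpFilter Λ h νd μ n ω i) = 0 := by
      rw [jumpFilter_of_ne hΛ hνd hμ hi, ENNReal.ofReal_zero]
    exact h0.trans (Eq.symm (Set.indicator_of_notMem hω _))

/-- Since `T_0 = 0`, the initial history is `σ(Y_0)`, so that its trace on `{Y_0 = h i}` is trivial
and the claim is the definition of `H`. -/
lemma isFilterAt_zero (hΛ : IsRateMatrix Λ) (hνd : ∀ a, νd a ∈ face h a)
    (hμ : μ ∈ stdSimplex ℝ I) (hP : IsMarkovLaw Λ μ P) : IsFilterAt Λ h νd μ P 0 := by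
  intro B hB i
  have hT : ∀ ω : CadlagPath I, jumpTime h 0 ω < ⊤ := fun ω => ENNReal.zero_lt_top
  have hX : ∀ ω : CadlagPath I, coordAt (jumpTime h 0) ω = coord 0 ω := fun ω => rfl
  have hY : ∀ ω : CadlagPath I, obsAtJump h 0 ω = h (coord 0 ω) := fun ω => rfl
  have hle : pastSigma (I := I) h 0 ≤ ⊥ ⊔ MeasurableSpace.comap (obsAtJump? h 0) ⊤ := by
    refine iSup₂_le fun k hk => ?_
    obtain rfl := Nat.le_zero.1 hk
    refine sup_le_sup_right ?_ _
    exact (MeasurableSpace.comap_const (0 : ℝ≥0∞)).le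
  obtain ⟨E, hE, hBE⟩ := exists_measurableSet_of_const_on (c := some (h i))
    (K := {ω | obsAtJump h 0 ω = h i}) (fun ω hω => obsAtJump?_eq_some_iff.2 ⟨hT ω, hω⟩)
    (hle B hB)
  rw [setLIntegral_jumpFilter_inter hΛ hνd hμ]
  have hsub : B ∩ {ω | jumpTime h 0 ω < ⊤} ∩ {ω | obsAtJump h 0 ω = h i} =
      E ∩ {ω | obsAtJump h 0 ω = h i} := by
    ext ω
    simp only [Set.mem_inter_iff, Set.mem_ofPred_eq, hT, and_true]
    exact and_congr_left fun hω => hBE ω hω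
  have hsub' : B ∩ {ω | jumpTime h 0 ω < ⊤} ∩ {ω | coordAt (jumpTime h 0) ω = i} =
      E ∩ {ω | coord 0 ω = i} := by
    ext ω
    simp only [Set.mem_inter_iff, Set.mem_ofPred_eq, hT, and_true, hX]
    exact and_congr_left fun hω => hBE ω ((hY ω).trans (congrArg h hω))
  rw [hsub, hsub']
  rcases MeasurableSpace.measurableSet_bot_iff.1 hE with rfl | rfl
  · simp
  rw [Set.univ_inter, Set.univ_inter, hP.initial]
  have hYm : ∀ b, MeasurableSet {ω : CadlagPath I | obsAtJump h 0 ω = b} := fun b =>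
    measurableSet_coord 0 (h ⁻¹' {b})
  have hYb : P {ω | obsAtJump h 0 ω = h i} = ENNReal.ofReal (μ ⬝ᵥ classInd h (h i)) := by
    rw [measure_eq_sum_fiber P (coord 0) fun j => (hYm _).inter (measurableSet_coord 0 {j}),
      dotProduct, ENNReal.ofReal_sum_of_nonneg fun j _ =>
        mul_nonneg (hμ.1 j) (classInd_nonneg h (h i) j)]
    refine Finset.sum_congr rfl fun j _ => ?_
    by_cases hj : h j = h i
    · rw [classInd_of_eq hj, mul_one, ← hP.initial j]
      congr 1
      refine Set.inter_eq_right.2 fun ω hω => ?_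
      exact (hY ω).trans ((congrArg h hω).trans hj)
    · have hempty : {ω : CadlagPath I | obsAtJump h 0 ω = h i} ∩ {ω | coord 0 ω = j} = ∅ :=
        Set.eq_empty_of_forall_notMem fun ω hω =>
          hj ((congrArg h hω.2).symm.trans ((hY ω).symm.trans hω.1))
      rw [classInd_of_ne hj, mul_zero, ENNReal.ofReal_zero]
      exact (congrArg P hempty).trans measure_empty
  have hconst : ∫⁻ ω in {ω | obsAtJump h 0 ω = h i},
      ENNReal.ofReal (jumpFilter Λ h νd μ 0 ω i) ∂P =
      ∫⁻ _ in {ω | obsAtJump h 0 ω = h i}, ENNReal.ofReal (condOp h νd (h i) μ i) ∂P := by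
    refine setLIntegral_congr_fun (hYm _) fun ω hω => ?_
    have h1 : obs h ω 0 = h i := hω
    simp only [jumpFilter_of_lt (hT ω), filterAtJump, h1]
  have hnn : 0 ≤ μ ⬝ᵥ classInd h (h i) :=
    Finset.sum_nonneg fun j _ => mul_nonneg (hμ.1 j) (classInd_nonneg h (h i) j)
  rw [hconst, setLIntegral_const, hYb, mul_comm, ← ENNReal.ofReal_mul hnn]
  congr 1
  unfold condOp
  by_cases h0 : μ ⬝ᵥ classInd h (h i) = 0
  · have h1 := (Finset.sum_eq_zero_iff_of_nonneg fun j _ =>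
      mul_nonneg (hμ.1 j) (classInd_nonneg h (h i) j)).1 h0 i (Finset.mem_univ i)
    rw [classInd_of_eq rfl, mul_one] at h1
    rw [h0, h1, zero_mul]
  · rw [if_pos h0]
    simp only [Pi.smul_apply, Pi.mul_apply, smul_eq_mul, classInd_of_eq]
    field_simp

/-- On `{Y_{T_{n+1}} = h i}` the new history has the same trace as `Σ_n⁺`, and there, by Bayes'
formula, `Π_{T_{n+1}}(i)` is the ratio of the exit fluxes into `{i}` and into the class of `i`. -/
lemma IsFilterAt.succ (hF : IsFilterAt Λ h νd μ P n) (hΛ : IsRateMatrix Λ)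
    (hνd : ∀ a, νd a ∈ face h a) (hμ : μ ∈ stdSimplex ℝ I) (hP : IsMarkovLaw Λ μ P) :
    IsFilterAt Λ h νd μ P (n + 1) := by
  intro B hB i
  rw [pastSigma_succ] at hB
  obtain ⟨E, hE, hBE⟩ := exists_measurableSet_of_const_on (c := some (h i))
    (K := landing h n (h ⁻¹' {h i})) (fun ω hω => obsAtJump?_eq_some_iff.2 hω) hB
  have hsub : B ∩ {ω | jumpTime h (n + 1) ω < ⊤} ∩ {ω | obsAtJump h (n + 1) ω = h i} =
      landing h n (h ⁻¹' {h i}) ∩ E := by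
    ext ω
    constructor
    · rintro ⟨⟨h1, h2⟩, h3⟩; exact ⟨⟨h2, h3⟩, (hBE ω ⟨h2, h3⟩).1 h1⟩
    · rintro ⟨⟨h2, h3⟩, h1⟩; exact ⟨⟨(hBE ω ⟨h2, h3⟩).2 h1, h2⟩, h3⟩
  have hsub' : B ∩ {ω | jumpTime h (n + 1) ω < ⊤} ∩ {ω | coordAt (jumpTime h (n + 1)) ω = i} =
      landing h n {i} ∩ E := by
    ext ω
    have h4 : coordAt (jumpTime h (n + 1)) ω = i → obsAtJump h (n + 1) ω = h i := congrArg h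
    constructor
    · rintro ⟨⟨h1, h2⟩, h3⟩; exact ⟨⟨h2, h3⟩, (hBE ω ⟨h2, h4 h3⟩).1 h1⟩
    · rintro ⟨⟨h2, h3⟩, h1⟩; exact ⟨⟨(hBE ω ⟨h2, h4 h3⟩).2 h1, h2⟩, h3⟩
  have hYm := fun a => measurableSet_obsAtJump_pastSigma (I := I) (h := h) (le_refl n) a
  have hp : @Measurable _ _ ((pastSigma h n).prod inferInstance) _
      fun p : CadlagPath I × ℝ => condOp h νd (h i) (killedLaw Λ h (obsAtJump h n p.1) p.2
        (jumpFilter Λ h νd μ n p.1) ᵥ* Λ) i := by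
    have h1 := @measurable_condOp_killedLaw _ _ _ Λ h _ _ (pastSigma h n) _ _ _ hYm
      (measurable_jumpFilter hΛ hνd hμ n) νd (h i)
    have h2 := (measurable_pi_apply i).comp h1
    exact h2
  rw [setLIntegral_jumpFilter_inter hΛ hνd hμ, hsub, hsub',
    hF.measure_landing_eq_lintegral hΛ hνd hμ hP hp (J := h ⁻¹' {h i}) (fun ω u hu =>
      exitFlux_singleton_eq_mul hΛ νd (jumpFilter_nonneg hΛ hνd hμ n ω) hu i) hE]
  refine setLIntegral_congr_fun ?_ fun ω hω => ?_
  · refine (measurableSet_coordAt_jumpTime h (n + 1) _).inter ?_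
    exact pastSigma_le h (n + 1) _ (pastSigmaPlus_le_pastSigma_succ h n _ hE)
  · have h1 : obsAtJump h (n + 1) ω = h i := hω.1.2
    simp only [jumpFilter_succ hΛ hνd hμ hω.1.1, h1]

/-- The filter property at every jump time, the inductive statement on which both conditional
probabilities rest. -/
theorem isFilterAt (hΛ : IsRateMatrix Λ) (hνd : ∀ a, νd a ∈ face h a)
    (hμ : μ ∈ stdSimplex ℝ I) (hP : IsMarkovLaw Λ μ P) (n : ℕ) : IsFilterAt Λ h νd μ P n := by
  induction n with
  | zero => exact isFilterAt_zero hΛ hνd hμ hP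
  | succ n ih => exact ih.succ hΛ hνd hμ hP

end FilterAt

/-! ### Conditional probabilities -/

/-- A conditional probability is identified by its integrals, here as lower integrals so that no
integrability has to be known in advance. -/
lemma condExp_indicator_ae_eq {Ω : Type*} {m m₀ : MeasurableSpace Ω} (hm : m ≤ m₀)
    {P : Measure Ω} [IsFiniteMeasure P] {D : Set Ω} (hD : MeasurableSet D) {g : Ω → ℝ}
    (hg : Measurable[m] g) (hg0 : ∀ ω, 0 ≤ g ω)
    (H : ∀ C, MeasurableSet[m] C → P (D ∩ C) = ∫⁻ ω in C, ENNReal.ofReal (g ω) ∂P) :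
    P[D.indicator (fun _ => (1 : ℝ)) | m] =ᵐ[P] g := by
  have hgm : Measurable g := hg.mono hm le_rfl
  have hint : Integrable g P := by
    refine ⟨hgm.aestronglyMeasurable, ?_⟩
    rw [hasFiniteIntegral_iff_ofReal (ae_of_all _ hg0), ← setLIntegral_univ,
      ← H _ (@MeasurableSet.univ _ m)]
    exact measure_lt_top P _
  refine (ae_eq_condExp_of_forall_setIntegral_eq hm ((integrable_const _).indicator hD)
    (fun _ _ _ => hint.integrableOn) (fun C hC _ => ?_) hg.aestronglyMeasurable).symm
  rw [setIntegral_indicator hD, setIntegral_const, smul_eq_mul, mul_one, measureReal_def,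
    Set.inter_comm, H C hC, integral_eq_lintegral_of_nonneg_ae (ae_of_all _ hg0)
      hgm.aestronglyMeasurable]

end MarkovFilter

theorem theorem4 {I O : Type*} [Fintype I] [DecidableEq I] [Fintype O]
    (Λ : Matrix I I ℝ) (hΛ : IsRateMatrix Λ)
    (h : I → O) (hh : Function.Surjective h)
    (νd : O → I → ℝ) (hνd : ∀ a, νd a ∈ face h a)
    (μ : I → ℝ) (hμ : μ ∈ stdSimplex ℝ I)
    (P : Measure (CadlagPath I)) (hP : IsMarkovLaw Λ μ P)
    (n : ℕ) (hn : 1 ≤ n) :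
    (∀ t : ℝ≥0,
      P[Set.indicator {ω | (t : ℝ≥0∞) < sojourn h n ω ∧ jumpTime h (n - 1) ω < ⊤}
          (fun _ => (1 : ℝ)) | pastSigma h (n - 1)]
        =ᵐ[P] Set.indicator {ω | jumpTime h (n - 1) ω < ⊤} (fun ω =>
          Real.exp (∫ s in (0 : ℝ)..t,
            rate Λ h
              (flow Λ h s (filterProc Λ h νd μ ω (jumpTime h (n - 1) ω).toNNReal))
              (obsAtJump h (n - 1) ω)))) ∧
    (∀ qd : O → O → ℝ, (∀ a, qd a ∈ stdSimplex ℝ O ∧ qd a a = 0) → ∀ b : O,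
      P[Set.indicator {ω | obsAtJump h n ω = b ∧ jumpTime h n ω < ⊤}
          (fun _ => (1 : ℝ)) | pastSigmaPlus h (n - 1)]
        =ᵐ[P] Set.indicator {ω | jumpTime h n ω < ⊤} (fun ω =>
          postJumpLaw Λ h qd
            (Function.leftLim (filterProc Λ h νd μ ω) (jumpTime h n ω).toNNReal) b) ∧
      Set.indicator {ω | jumpTime h n ω < ⊤} (fun ω =>
          postJumpLaw Λ h qd
            (Function.leftLim (filterProc Λ h νd μ ω) (jumpTime h n ω).toNNReal) b)
        =ᵐ[P] Set.indicator {ω | jumpTime h n ω < ⊤} (fun ω =>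
          postJumpLaw Λ h qd
            (flow Λ h (sojourn h n ω).toReal
              (filterProc Λ h νd μ ω (jumpTime h (n - 1) ω).toNNReal)) b)) := by
  obtain ⟨n, rfl⟩ : ∃ k, n = k + 1 := ⟨n - 1, (Nat.sub_add_cancel hn).symm⟩
  rw [Nat.add_sub_cancel]
  have := hP.isProbabilityMeasure
  have hF := isFilterAt hΛ hνd hμ hP n
  have hYm := fun a => measurableSet_obsAtJump_pastSigma (I := I) (h := h) (le_refl n) a
  have hW := measurable_jumpFilter hΛ hνd hμ n
  have hplus := (pastSigmaPlus_le_pastSigma_succ (I := I) h n).trans (pastSigma_le h (n + 1))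
  refine ⟨fun t => ?_, fun qd hqd b => ?_⟩
  -- the exponential of the integrated rate is the survival probability started from `Π_{T_n}`
  · have hg : Set.indicator {ω | jumpTime h n ω < ⊤} (fun ω => Real.exp (∫ s in (0 : ℝ)..t,
        rate Λ h (flow Λ h s (filterProc Λ h νd μ ω (jumpTime h n ω).toNNReal))
          (obsAtJump h n ω))) =
        fun ω => survival Λ h (obsAtJump h n ω) t (jumpFilter Λ h νd μ n ω) := by
      ext1 ω
      by_cases hT : jumpTime h n ω < ⊤
      · rw [Set.indicator_of_mem (s := {ω | jumpTime h n ω < ⊤}) hT,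
          filterProc_jumpTime hΛ hνd hμ hT, jumpFilter_of_lt hT]
        exact exp_integral_rate_flow hΛ (filterAtJump_mem_face hΛ hνd hμ hT) t.coe_nonneg
      · rw [Set.indicator_of_notMem (s := {ω | jumpTime h n ω < ⊤}) hT, jumpFilter_of_not_lt hT]
        simp [survival, stoppedLaw]
    rw [hg]
    refine condExp_indicator_ae_eq (pastSigma_le h n) ?_ ?_ (fun ω => ?_) fun C hC =>
      hF.measure_lt_sojourn hΛ hνd hμ hP hC t
    · exact (measurableSet_lt measurable_const
        ((measurable_jumpTime h (n + 1)).sub (measurable_jumpTime h n))).inter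
          (isOptional_jumpTime h n).measurableSet_lt_top
    · refine @measurable_of_countable_cases _ _ _ (pastSigma h n) _ _ _ hYm
        (fun a ω => survival Λ h a t (jumpFilter Λ h νd μ n ω)) fun a => ?_
      have h1 : Measurable fun x : I → ℝ => survival Λ h a t x :=
        (continuous_survival_prod.comp (Continuous.prodMk_right (t : ℝ))).measurable
      exact h1.comp hW
    · rw [survival_eq_sum_killedLaw]
      exact Finset.sum_nonneg fun i _ =>
        killedLaw_nonneg hΛ (jumpFilter_nonneg hΛ hνd hμ n ω) t.coe_nonneg i
  -- both expressions for `q` are the ratio of the flux into the class `b` and the total exit flux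
  · set g : CadlagPath I → ℝ := Set.indicator {ω | jumpTime h (n + 1) ω < ⊤} fun ω =>
      jumpProb Λ h qd (obsAtJump h n ω) b (killedLaw Λ h (obsAtJump h n ω)
        (sojourn h (n + 1) ω).toReal (jumpFilter Λ h νd μ n ω)) with hg
    have hg2 : Set.indicator {ω | jumpTime h (n + 1) ω < ⊤} (fun ω => postJumpLaw Λ h qd
        (flow Λ h (sojourn h (n + 1) ω).toReal
          (filterProc Λ h νd μ ω (jumpTime h n ω).toNNReal)) b) = g := by
      refine Set.indicator_congr fun ω hT => ?_
      have hT0 := (jumpTime_le_succ h n ω).trans_lt hT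
      rw [filterProc_jumpTime hΛ hνd hμ hT0, jumpFilter_of_lt hT0,
        postJumpLaw_flow_eq hΛ qd (filterAtJump_mem_face hΛ hνd hμ hT0) b ENNReal.toReal_nonneg]
    have hg1 : Set.indicator {ω | jumpTime h (n + 1) ω < ⊤} (fun ω => postJumpLaw Λ h qd
        (Function.leftLim (filterProc Λ h νd μ ω) (jumpTime h (n + 1) ω).toNNReal) b) = g := by
      rw [← hg2]
      refine Set.indicator_congr fun ω hT => ?_
      rw [leftLim_filterProc hΛ hνd hμ hT,
        filterProc_jumpTime hΛ hνd hμ ((jumpTime_le_succ h n ω).trans_lt hT)]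
    rw [hg1, hg2]
    refine ⟨?_, EventuallyEq.rfl⟩
    have hp := @measurable_jumpProb_killedLaw _ _ _ Λ h _ _ (pastSigma h n) _ _ _ hYm hW qd b
    have hTm : MeasurableSet[pastSigmaPlus h n] {ω : CadlagPath I | jumpTime h (n + 1) ω < ⊤} := by
      have h1 : Measurable[pastSigmaPlus (I := I) h n] (jumpTime h (n + 1)) :=
        Measurable.of_comap_le le_sup_right
      exact h1 measurableSet_Iio
    refine condExp_indicator_ae_eq hplus ?_ ?_ (fun ω => ?_) fun E hE => ?_
    · have h1 := measurableSet_coordAt_jumpTime h (n + 1) (h ⁻¹' {b})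
      have h2 : {ω : CadlagPath I | obsAtJump h (n + 1) ω = b ∧ jumpTime h (n + 1) ω < ⊤} =
          {ω | jumpTime h (n + 1) ω < ⊤ ∧ coordAt (jumpTime h (n + 1)) ω ∈ h ⁻¹' {b}} := by
        ext ω; exact and_comm
      rwa [h2]
    · have h3 : @Measurable _ _ (pastSigmaPlus h n) ((pastSigma h n).prod inferInstance)
          fun ω : CadlagPath I => (ω, (sojourn h (n + 1) ω).toReal) :=
        Measurable.prodMk (measurable_id'' le_sup_left) (measurable_sojourn_pastSigmaPlus h n)
      have h4 := hp.comp h3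
      exact Measurable.indicator h4 hTm
    · refine Set.indicator_nonneg (fun ω _ => ?_) ω
      exact jumpProb_nonneg hΛ ((hqd _).1.1 b) (killedLaw_nonneg hΛ
        (jumpFilter_nonneg hΛ hνd hμ n ω) ENNReal.toReal_nonneg) fun i hi => killedLaw_of_ne hi
    · have h1 := hF.measure_landing_eq_lintegral hΛ hνd hμ hP hp (J := Set.univ)
        (J' := h ⁻¹' {b}) (fun ω u hu =>
          exitFlux_preimage_eq_mul hΛ qd (jumpFilter_nonneg hΛ hνd hμ n ω) hu b) hE
      have h2 : {ω : CadlagPath I | obsAtJump h (n + 1) ω = b ∧ jumpTime h (n + 1) ω < ⊤} =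
          landing h n (h ⁻¹' {b}) := by
        ext ω; exact and_comm
      have h3 : landing h n Set.univ = {ω : CadlagPath I | jumpTime h (n + 1) ω < ⊤} := by
        ext ω; exact and_iff_left (Set.mem_univ _)
      rw [h2, h1, h3, ← setLIntegral_indicator (hplus _ hTm)]
      refine setLIntegral_congr_fun (hplus _ hE) fun ω _ => ?_
      by_cases hT : jumpTime h (n + 1) ω < ⊤ <;> simp [hg, hT]
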